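/- Let $X$ be a Gromov hyperbolic space, i.e. a geodesic metric space in which, for some $\delta$, every side of every geodesic triangle lies in the $\delta$-neighbourhood of the union of the other two sides. Let $G$ be a group acting on $X$ by isometries. An element $g\in G$ is loxodromic if its translation length $\lim_{n\to\infty} d(g^n y,y)/n$ is positive. For $K\ge 0$ and $y,z\in X$ put $$\mathrm{Stab}_K(y,z)=\{g\in G : d(y,gy)\le K \text{ and } d(z,gz)\le K\}.$$ An element $h\in G$ is WPD if it is loxodromic and for all $K\ge 0$ and $y\in X$ there is an integer $M>0$ such that $\mathrm{Stab}_K(y,h^My)$ is finite. Let $\mu$ be a probability measure on $G$ with countable support, and let $\Gamma_\mu$ be the semigroup generated by the support of $\mu$. Suppose that $\mu$ is - non-elementary: $\Gamma_\mu$ contains two loxodromic elements with disjoint fixed point sets on the Gromov boundary $\partial X$ (the set of quasigeodesic rays up to finite Hausdorff distance); - bounded: for some $y\in X$ the set $\{gy : g\in\mathrm{supp}\,\mu\}$ is bounded; - WPD: $\Gamma_\mu$ contains an element that is WPD in $G$. Let $w_n=g_1\cdots g_n$, where $g_1,g_2,\dots$ are independent with distribution $\mu$, and let $x\in X$. For $K_1\ge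 0$, a $(1,K_1)$-quasi-axis of $g\in G$ is the image of a map $\gamma:\mathbb R\to X$ with $\bigl|d(\gamma(s),\gamma(t))-|s-t|\bigr|\le K_1$ for all $s,t$, such that this image is invariant under $g$. Then for all $K\ge 0$ and $K_1\ge 0$ there are constants $N>0$, $B>0$ and $0<c<1$ such that for all $n\ge 0$ $$\mathbb P\bigl(|\mathrm{Stab}_K(x,w_nx)|\le N\bigr)\ \ge\ 1-Bc^{\sqrt n},$$ and, with probability at least $1-Bc^{\sqrt n}$, the element $w_n$ is loxodromic and $$|\mathrm{Stab}_K(p,w_np)|\le N$$ for every $(1,K_1)$-quasi-axis $\alpha$ of $w_n$ and every point $p$ of $\alpha$ at minimal distance from $x$. -/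

import Mathlib

open Filter Topology MeasureTheory
open scoped NNReal

namespace HypWalk

section Hyperbolic

variable {X : Type*} [MetricSpace X]

/-- `s` is (the image of) a geodesic segment from `x` to `y`. -/
def IsGeodesicSegment (s : Set X) (x y : X) : Prop :=
  ∃ γ : ℝ → X, γ 0 = x ∧ γ (dist x y) = y ∧
    (∀ a ∈ Set.Icc 0 (dist x y), ∀ b ∈ Set.Icc 0 (dist x y), dist (γ a) (γ b) = |a - b|) ∧
    s = γ '' Set.Icc 0 (dist x y)

variable (X) in
/-- A geodesic metric space in which every geodesic triangle is `δ`-thin: each side lies in the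
`δ`-neighbourhood of the union of the other two. -/
structure IsHyperbolicWith (δ : ℝ) : Prop where
  geodesic : ∀ x y : X, ∃ s : Set X, IsGeodesicSegment s x y
  thin : ∀ (x y z : X) (s t u : Set X),
    IsGeodesicSegment s x y → IsGeodesicSegment t y z → IsGeodesicSegment u z x →
      ∀ p ∈ s, ∃ q ∈ t ∪ u, dist p q ≤ δ

variable (X) in
/-- Gromov hyperbolic spaces. -/
def IsGromovHyperbolic : Prop := ∃ δ : ℝ, IsHyperbolicWith X δ

/-- `γ`, parametrized by an interval `I ⊆ ℝ`, is a `(Q, C)`-quasigeodesic. -/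
def IsQuasigeodesicOn (Q C : ℝ) (I : Set ℝ) (γ : ℝ → X) : Prop :=
  ∀ s ∈ I, ∀ t ∈ I,
    Q⁻¹ * |s - t| - C ≤ dist (γ s) (γ t) ∧ dist (γ s) (γ t) ≤ Q * |s - t| + C

variable (X) in
/-- Quasigeodesic rays `[0, ∞) → X` (with arbitrary constants). -/
def QuasigeodesicRay : Type _ :=
  {γ : ℝ≥0 → X // ∃ Q C : ℝ, 1 ≤ Q ∧ 0 ≤ C ∧
    IsQuasigeodesicOn Q C (Set.Ici 0) (fun t : ℝ => γ t.toNNReal)}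

/-- Two rays are asymptotic if their images are at finite Hausdorff distance. -/
def Asymptotic (γ η : QuasigeodesicRay X) : Prop :=
  ∃ C : ℝ, (∀ s, ∃ t, dist (γ.1 s) (η.1 t) ≤ C) ∧ (∀ t, ∃ s, dist (γ.1 s) (η.1 t) ≤ C)

variable (X) in
/-- The setoid of asymptotic quasigeodesic rays. -/
def asymptoticSetoid : Setoid (QuasigeodesicRay X) where
  r := Asymptotic
  iseqv :=
    { refl := fun γ => ⟨0, fun s => ⟨s, by simp⟩, fun s => ⟨s, by simp⟩⟩
      symm := by
        rintro γ η ⟨C, h₁, h₂⟩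
        refine ⟨C, fun s => ?_, fun s => ?_⟩
        · obtain ⟨t, ht⟩ := h₂ s
          exact ⟨t, by rwa [dist_comm]⟩
        · obtain ⟨t, ht⟩ := h₁ s
          exact ⟨t, by rwa [dist_comm]⟩
      trans := by
        rintro γ η ζ ⟨C, h₁, h₂⟩ ⟨D, k₁, k₂⟩
        refine ⟨C + D, fun s => ?_, fun s => ?_⟩
        · obtain ⟨t, ht⟩ := h₁ s
          obtain ⟨u, hu⟩ := k₁ t
          exact ⟨u, (dist_triangle _ _ _).trans (add_le_add ht hu)⟩
        · obtain ⟨t, ht⟩ := k₂ s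
          obtain ⟨u, hu⟩ := h₂ t
          exact ⟨u, (dist_triangle _ _ _).trans (add_le_add hu ht)⟩ }

variable (X) in
/-- The Gromov boundary `∂X`: asymptote classes of quasigeodesic rays. -/
def GromovBoundary : Type _ := Quotient (asymptoticSetoid X)

end Hyperbolic

section Action

variable {G : Type*} [Group G] {X : Type*} [MetricSpace X] [MulAction G X] [IsIsometricSMul G X]

/-- The translate of a quasigeodesic ray. -/
def QuasigeodesicRay.translate (g : G) (γ : QuasigeodesicRay X) : QuasigeodesicRay X :=
  ⟨fun t => g • γ.1 t, by
    obtain ⟨Q, C, hQ, hC, h⟩ := γ.2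
    refine ⟨Q, C, hQ, hC, fun s hs t ht => ?_⟩
    simpa only [dist_smul] using h s hs t ht⟩

/-- The action of an isometry `g ∈ G` on the Gromov boundary. -/
def boundaryMap (g : G) : GromovBoundary X → GromovBoundary X :=
  Quotient.map (sa := asymptoticSetoid X) (sb := asymptoticSetoid X)
    (QuasigeodesicRay.translate g) (by
      rintro γ η ⟨C, h₁, h₂⟩
      refine ⟨C, fun s => ?_, fun s => ?_⟩
      · obtain ⟨t, ht⟩ := h₁ s
        exact ⟨t, by simpa only [QuasigeodesicRay.translate, dist_smul] using ht⟩
      · obtain ⟨t, ht⟩ := h₂ s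
        exact ⟨t, by simpa only [QuasigeodesicRay.translate, dist_smul] using ht⟩)

variable (X) in
/-- The fixed points of `g` on the Gromov boundary. -/
def boundaryFixedPoints (g : G) : Set (GromovBoundary X) := {ξ | boundaryMap g ξ = ξ}

variable (X) in
/-- `g` is loxodromic: its translation length `lim d(gⁿ y, y) / n` is positive. -/
def IsLoxodromic (g : G) : Prop :=
  ∃ τ : ℝ, 0 < τ ∧
    ∀ y : X, Tendsto (fun n : ℕ => dist (g ^ n • y) y / (n : ℝ)) atTop (𝓝 τ)

variable (G) in
/-- The joint coarse stabilizer `Stab_K(x, y)`. -/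
def jointStab (K : ℝ) (x y : X) : Set G := {g | dist x (g • x) ≤ K ∧ dist y (g • y) ≤ K}

variable (X) in
/-- `h` is a WPD element of `G`. -/
def IsWPD (h : G) : Prop :=
  IsLoxodromic X h ∧
    ∀ K : ℝ, 0 ≤ K → ∀ y : X, ∃ M : ℕ, 0 < M ∧ (jointStab G K y (h ^ M • y)).Finite

/-- `α` is (the image of) a `(1, K₁)`-quasi-axis of `g`: a bi-infinite
`(1, K₁)`-quasigeodesic whose image is invariant under `g`. -/
def IsQuasiAxis (K₁ : ℝ) (g : G) (α : Set X) : Prop :=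
  (∃ γ : ℝ → X, IsQuasigeodesicOn 1 K₁ Set.univ γ ∧ α = Set.range γ) ∧
    (fun y => g • y) '' α = α

/-- `p` is a closest point projection of `x` to `α`. -/
def IsClosestPoint (x : X) (α : Set X) (p : X) : Prop :=
  p ∈ α ∧ ∀ q ∈ α, dist x p ≤ dist x q

/-- `Γ_μ`: the semigroup generated by the support of `μ`. -/
def generatedSemigroup (μ : PMF G) : Subsemigroup G := Subsemigroup.closure μ.support

variable (X) in
/-- `μ` is non-elementary: `Γ_μ` contains two loxodromic elements with disjoint fixed point sets
on the Gromov boundary. -/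
def IsNonElementary (μ : PMF G) : Prop :=
  ∃ g ∈ generatedSemigroup μ, ∃ h ∈ generatedSemigroup μ,
    IsLoxodromic X g ∧ IsLoxodromic X h ∧
      Disjoint (boundaryFixedPoints X g) (boundaryFixedPoints X h)

variable (X) in
/-- `μ` is bounded: its support moves some point of `X` within a bounded set. -/
def HasBoundedSupport (μ : PMF G) : Prop :=
  ∃ y : X, Bornology.IsBounded ((fun g : G => g • y) '' μ.support)

variable (X) in
/-- `μ` is WPD: `Γ_μ` contains an element which is WPD in `G`. -/
def IsWPDMeasure (μ : PMF G) : Prop := ∃ h ∈ generatedSemigroup μ, IsWPD X h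

/-- The law of the sequence of steps: the infinite product of copies of `μ` on `G^ℕ`, where `G`
is discrete. -/
noncomputable def stepMeasure (μ : PMF G) : @Measure (ℕ → G) (@MeasurableSpace.pi ℕ _ fun _ => ⊤) :=
  letI : MeasurableSpace G := ⊤
  Measure.infinitePi (fun _ : ℕ => μ.toMeasure)

/-- The location `w_n = g₁ ⋯ g_n` of the walk with steps `g_{i+1} = ω i`. -/
def walk (ω : ℕ → G) : ℕ → G
  | 0 => 1
  | n + 1 => walk ω n * ω n

/-- The probability that the `n`-th location `w_n` of the random walk lies in `A`. -/
noncomputable def walkProb (μ : PMF G) (n : ℕ) (A : Set G) : ℝ :=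
  (stepMeasure μ {ω | walk ω n ∈ A}).toReal

end Action

end HypWalk

/-!
Two loxodromic elements of `Γ_μ` with disjoint fixed points play ping-pong, which gives eight words
over the support of `μ`, all of the same length, such that for every pair of points at most two of
the words create backtracking. Hence the expectation of `exp (-t * d(y, w_n x))` decays
exponentially for small `t`, and outside an exponentially small set the walk moves away linearly
from any given point.

Fix a word `F` whose product `f` is a large power of a WPD element. At each time, with probability
bounded below, the walk reads a Schottky word adapted to its past, then `F`, and then drifts away
from its past. If this attempt fails, the time until the failure is noticed has an exponential tail,
so a fresh attempt can be made, and with overwhelming probability one succeeds in the middle half of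
the walk. Then the geodesic from `x` to `w_n x` passes near some `u x` and `u f x`, and an element
which coarsely fixes `x` and `w_n x` also coarsely fixes these two points. After conjugation by `u`
it lies in a joint stabilizer of `x` and `f x`, which is finite by the WPD property. The same
applies to the closest point `p` on a quasi-axis, since `p` is much closer to `x` than `u x` is.
-/

namespace HypWalk

section GromovProduct

variable {X : Type*} [MetricSpace X] {δ : ℝ}

/-- The Gromov product `(a | b)_o`: up to an additive error, the distance from `o` to a geodesic
from `a` to `b`. -/
noncomputable def gromovProd (o a b : X) : ℝ := (dist o a + dist o b - dist a b) / 2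

variable (X) in
/-- Gromov's four point condition. It is the form of hyperbolicity used in all estimates, since it
does not mention geodesics. -/
def FourPointHyperbolic (δ : ℝ) : Prop :=
  ∀ o a b c : X, min (gromovProd o a b) (gromovProd o b c) - δ ≤ gromovProd o a c

lemma gromovProd_comm (o a b : X) : gromovProd o a b = gromovProd o b a := by
  simp only [gromovProd, dist_comm a b, add_comm]

lemma gromovProd_self (o a : X) : gromovProd o a a = dist o a := by simp [gromovProd]

lemma gromovProd_nonneg (o a b : X) : 0 ≤ gromovProd o a b := by
  have := dist_triangle_left a b o
  simp only [gromovProd]; linarith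

lemma gromovProd_le_left (o a b : X) : gromovProd o a b ≤ dist o a := by
  have := dist_triangle o a b
  simp only [gromovProd]; linarith

lemma gromovProd_le_right (o a b : X) : gromovProd o a b ≤ dist o b := by
  rw [gromovProd_comm]; exact gromovProd_le_left o b a

lemma gromovProd_add_gromovProd_swap (a b c : X) :
    gromovProd a b c + gromovProd b a c = dist a b := by
  simp only [gromovProd, dist_comm b a]; ring

lemma dist_sub_dist_le_gromovProd (o a b : X) : dist o a - dist a b ≤ gromovProd o a b := by
  have := dist_triangle_right o a b
  simp only [gromovProd]; linarith

lemma gromovProd_le_add_dist_base (o o' a b : X) :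
    gromovProd o a b ≤ gromovProd o' a b + dist o o' := by
  have to_a := dist_triangle o o' a
  have to_b := dist_triangle o o' b
  simp only [gromovProd]; linarith

lemma gromovProd_le_add_dist_left (o a a' b : X) :
    gromovProd o a b ≤ gromovProd o a' b + dist a a' := by
  have to_o := dist_triangle_right o a a'
  have to_b := dist_triangle_left a' b a
  simp only [gromovProd]; linarith

lemma gromovProd_le_add_dist_right (o a b b' : X) :
    gromovProd o a b ≤ gromovProd o a b' + dist b b' := by
  rw [gromovProd_comm o a b, gromovProd_comm o a b']
  exact gromovProd_le_add_dist_left o b b' a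

lemma dist_eq_sub_gromovProd (o a b : X) :
    dist a b = dist o a + dist o b - 2 * gromovProd o a b := by
  simp only [gromovProd]; ring

lemma FourPointHyperbolic.nonneg (h : FourPointHyperbolic X δ) (x : X) : 0 ≤ δ := by
  simpa [gromovProd] using h x x x x

lemma FourPointHyperbolic.gromovProd_le_of_lt (h : FourPointHyperbolic X δ) {o a b c : X} {C : ℝ}
    (hab : gromovProd o a b ≤ C) (hbc : C + δ < gromovProd o b c) :
    gromovProd o a c ≤ C + δ := by
  have hacb := h o a c b
  rw [gromovProd_comm o c b] at hacb
  by_contra! hac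
  have : C + δ < min (gromovProd o a c) (gromovProd o b c) := lt_min hac hbc
  linarith

end GromovProduct

section ThinTriangles

variable {X : Type*} [MetricSpace X] {δ : ℝ} {s : Set X} {x y : X}

lemma IsGeodesicSegment.left_mem (h : IsGeodesicSegment s x y) : x ∈ s := by
  obtain ⟨γ, h_left, -, -, rfl⟩ := h
  exact ⟨0, ⟨le_rfl, dist_nonneg⟩, h_left⟩

lemma IsGeodesicSegment.right_mem (h : IsGeodesicSegment s x y) : y ∈ s := by
  obtain ⟨γ, -, h_right, -, rfl⟩ := h
  exact ⟨dist x y, ⟨dist_nonneg, le_rfl⟩, h_right⟩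

lemma IsGeodesicSegment.isPreconnected (h : IsGeodesicSegment s x y) : IsPreconnected s := by
  obtain ⟨γ, -, -, h_isom, rfl⟩ := h
  have h_lip : LipschitzOnWith 1 γ (Set.Icc 0 (dist x y)) :=
    LipschitzOnWith.of_dist_le_mul fun a ha b hb => by simp [h_isom a ha b hb, Real.dist_eq]
  exact isPreconnected_Icc.image γ h_lip.continuousOn

lemma IsGeodesicSegment.exists_dist_eq (h : IsGeodesicSegment s x y) {r : ℝ} (hr_nonneg : 0 ≤ r)
    (hr : r ≤ dist x y) : ∃ q ∈ s, dist x q = r := by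
  obtain ⟨γ, h_left, -, h_isom, rfl⟩ := h
  refine ⟨γ r, ⟨r, ⟨hr_nonneg, hr⟩, rfl⟩, ?_⟩
  rw [← h_left, h_isom 0 ⟨le_rfl, dist_nonneg⟩ r ⟨hr_nonneg, hr⟩, zero_sub, abs_neg,
    abs_of_nonneg hr_nonneg]

lemma IsGeodesicSegment.dist_add_dist (h : IsGeodesicSegment s x y) {p : X} (hp : p ∈ s) :
    dist x p + dist p y = dist x y := by
  obtain ⟨γ, h_left, h_right, h_isom, rfl⟩ := h
  obtain ⟨t, ht, rfl⟩ := hp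
  have to_left := h_isom 0 ⟨le_rfl, dist_nonneg⟩ t ht
  have to_right := h_isom t ht (dist x y) ⟨dist_nonneg, le_rfl⟩
  rw [h_left, zero_sub, abs_neg, abs_of_nonneg ht.1] at to_left
  rw [h_right, abs_of_nonpos (by linarith [ht.2])] at to_right
  linarith

lemma IsGeodesicSegment.dist_add_dist_le (h : IsGeodesicSegment s x y) {q : X} (hq : q ∈ s)
    (p : X) : dist x p + dist p y ≤ dist x y + 2 * dist p q := by
  have h_split := h.dist_add_dist hq
  have to_left := dist_triangle_right x p q
  have to_right := dist_triangle p q y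
  linarith

lemma IsGeodesicSegment.gromovProd_le_dist (h : IsGeodesicSegment s x y) {p : X} (hp : p ∈ s)
    (o : X) : gromovProd o x y ≤ dist o p := by
  have h_split := h.dist_add_dist hp
  have to_left := dist_triangle_right o x p
  have to_right := dist_triangle o p y
  simp only [gromovProd]; linarith [dist_triangle_left x p o, dist_triangle o p x, dist_comm p x]

lemma IsHyperbolicWith.nonneg (h : IsHyperbolicWith X δ) (x : X) : 0 ≤ δ := by
  obtain ⟨s, hs⟩ := h.geodesic x x
  obtain ⟨q, -, hq⟩ := h.thin x x x s s s hs hs hs x hs.left_mem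
  exact dist_nonneg.trans hq

lemma IsHyperbolicWith.exists_infDist_le (h : IsHyperbolicWith X δ) {t u : Set X} {z : X}
    (hs : IsGeodesicSegment s x y) (ht : IsGeodesicSegment t y z) (hu : IsGeodesicSegment u z x) :
    ∃ p ∈ s, Metric.infDist p u ≤ δ ∧ Metric.infDist p t ≤ δ := by
  have h_closed (v : Set X) : IsClosed {p | Metric.infDist p v ≤ δ} :=
    isClosed_le (Metric.continuous_infDist_pt v) continuous_const
  have h_cover : s ⊆ {p | Metric.infDist p u ≤ δ} ∪ {p | Metric.infDist p t ≤ δ} := by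
    intro p hp
    obtain ⟨q, hq | hq, hpq⟩ := h.thin x y z s t u hs ht hu p hp
    · exact Or.inr ((Metric.infDist_le_dist_of_mem hq).trans hpq)
    · exact Or.inl ((Metric.infDist_le_dist_of_mem hq).trans hpq)
  exact isPreconnected_closed_iff.1 hs.isPreconnected _ _ (h_closed u) (h_closed t) h_cover
    ⟨x, hs.left_mem, (Metric.infDist_zero_of_mem hu.right_mem).trans_le (h.nonneg x)⟩
    ⟨y, hs.right_mem, (Metric.infDist_zero_of_mem ht.left_mem).trans_le (h.nonneg x)⟩

lemma IsHyperbolicWith.exists_dist_le_gromovProd (h : IsHyperbolicWith X δ)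
    (hs : IsGeodesicSegment s x y) (o : X) :
    ∃ p ∈ s, dist o p ≤ gromovProd o x y + 2 * (δ + 1) := by
  obtain ⟨t, ht⟩ := h.geodesic y o
  obtain ⟨u, hu⟩ := h.geodesic o x
  obtain ⟨p, hp, hpu, hpt⟩ := h.exists_infDist_le hs ht hu
  obtain ⟨v, hv, hpv⟩ :=
    (Metric.infDist_lt_iff ⟨o, hu.left_mem⟩).1 (hpu.trans_lt (lt_add_one δ))
  obtain ⟨w, hw, hpw⟩ :=
    (Metric.infDist_lt_iff ⟨o, ht.right_mem⟩).1 (hpt.trans_lt (lt_add_one δ))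
  refine ⟨p, hp, ?_⟩
  have on_xy := hs.dist_add_dist hp
  have near_ox := hu.dist_add_dist_le hv p
  have near_yo := ht.dist_add_dist_le hw p
  simp only [gromovProd]
  linarith [dist_comm x p, dist_comm y p, dist_comm o p, dist_comm o y]

lemma IsHyperbolicWith.fourPointHyperbolic (h : IsHyperbolicWith X δ) :
    FourPointHyperbolic X (3 * δ + 2) := by
  intro o a b c
  obtain ⟨s, hs⟩ := h.geodesic a c
  obtain ⟨t, ht⟩ := h.geodesic c b
  obtain ⟨u, hu⟩ := h.geodesic b a
  obtain ⟨p, hp, hop⟩ := h.exists_dist_le_gromovProd hs o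
  obtain ⟨q, hq, hpq⟩ := h.thin a c b s t u hs ht hu p hp
  have hoq := dist_triangle o p q
  rcases hq with hq | hq
  · have h_side := ht.gromovProd_le_dist hq o
    rw [gromovProd_comm] at h_side
    linarith [min_le_right (gromovProd o a b) (gromovProd o b c)]
  · have h_side := hu.gromovProd_le_dist hq o
    rw [gromovProd_comm] at h_side
    linarith [min_le_left (gromovProd o a b) (gromovProd o b c)]

/-- The hyperbolicity of a space that has points at prescribed distances between any two of its
points. These two consequences of thin triangles are all that is used below. -/
structure IsGromovSpace (X : Type*) [MetricSpace X] (δ : ℝ) : Prop where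
  fourPoint : FourPointHyperbolic X δ
  exists_between : ∀ (x z : X) (r : ℝ), 0 ≤ r → r ≤ dist x z →
    ∃ q, dist x q = r ∧ dist q z = dist x z - r

lemma IsGromovHyperbolic.exists_isGromovSpace (h : IsGromovHyperbolic X) :
    ∃ δ, IsGromovSpace X δ := by
  obtain ⟨δ, h⟩ := h
  refine ⟨_, h.fourPointHyperbolic, fun x z r hr_nonneg hr => ?_⟩
  obtain ⟨s, hs⟩ := h.geodesic x z
  obtain ⟨q, hq, hxq⟩ := hs.exists_dist_eq hr_nonneg hr
  exact ⟨q, hxq, by linarith [hs.dist_add_dist hq]⟩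

end ThinTriangles

section DivergingPaths

variable {X : Type*} [MetricSpace X] {δ L κ A : ℝ} {v : ℕ → X} {n s : ℕ}

lemma dist_le_mul_of_dist_succ_le (hL : ∀ i < n, dist (v i) (v (i + 1)) ≤ L) {a b : ℕ}
    (hab : a ≤ b) (hb : b ≤ n) : dist (v a) (v b) ≤ L * ((b : ℝ) - a) := by
  have h_sum := dist_le_Ico_sum_of_dist_le hab (d := fun _ => L)
    fun {k} _ hk => hL k (hk.trans_le hb)
  rwa [Finset.sum_const, Nat.card_Ico, nsmul_eq_mul, Nat.cast_sub hab, mul_comm] at h_sum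

-- Backward induction on `a` in steps of length `s`: each step of the path gains `κ s / 2 ≥ δ` of
-- distance, which pays for the loss of `δ` in the four point condition.
lemma FourPointHyperbolic.le_gromovProd_of_diverges (h : FourPointHyperbolic X δ) {q : X}
    (hL_nonneg : 0 ≤ L) (hκ : 0 ≤ κ) (hs : 2 * δ ≤ κ * s) (hs_pos : 0 < s)
    (hL : ∀ i < n, dist (v i) (v (i + 1)) ≤ L) (hdiv : ∀ i ≤ n, A + κ * i ≤ dist q (v i)) :
    ∀ a ≤ n, A + κ / 2 * a - (L * s + δ) ≤ gromovProd q (v a) (v n) := by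
  intro a ha
  induction hk : n - a using Nat.strong_induction_on generalizing a with
  | _ k ih =>
    have h_far := hdiv a ha
    have hδ := h.nonneg q
    have hκa : 0 ≤ κ * a := by positivity
    by_cases has : a + s ≤ n
    · have h_next := ih (n - (a + s)) (by omega) (a + s) has rfl
      have h_four := h q (v a) (v (a + s)) (v n)
      have h_close := dist_sub_dist_le_gromovProd q (v a) (v (a + s))
      have h_length := dist_le_mul_of_dist_succ_le hL (Nat.le_add_right a s) has
      push_cast at h_next h_length
      have : A + κ / 2 * a - L * s ≤
          min (gromovProd q (v a) (v (a + s))) (gromovProd q (v (a + s)) (v n)) :=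
        le_min (by linarith) (by linarith)
      linarith
    · have h_close := dist_sub_dist_le_gromovProd q (v a) (v n)
      have h_length := dist_le_mul_of_dist_succ_le hL ha le_rfl
      have h_last : (n : ℝ) - a ≤ s := by
        rw [sub_le_iff_le_add']; exact_mod_cast (not_le.1 has).le
      linarith [mul_le_mul_of_nonneg_left h_last hL_nonneg]

-- Apply the previous lemma at the point `q` of a geodesic from `v 0` to `z` at distance
-- `(z | v n)_{v 0}` from `v 0`: there the path is still far away, but both ends are separated by
-- at most `δ`.
lemma IsGromovSpace.gromovProd_le_of_diverges (h : IsGromovSpace X δ) {z : X}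
    (hL_nonneg : 0 ≤ L) (hκ : 0 ≤ κ) (hs : 2 * δ ≤ κ * s) (hs_pos : 0 < s)
    (hL : ∀ i < n, dist (v i) (v (i + 1)) ≤ L)
    (hdiv : ∀ i ≤ n, dist z (v 0) + κ * i - A ≤ dist z (v i)) :
    gromovProd (v 0) z (v n) ≤ A + L * s + 2 * δ := by
  set r := gromovProd (v 0) z (v n) with hr
  obtain ⟨q, h_start, h_end⟩ :=
    h.exists_between (v 0) z r (gromovProd_nonneg _ _ _) (gromovProd_le_left _ _ _)
  have hq : gromovProd (v 0) q z = r := by simp only [gromovProd, h_start, h_end]; ring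
  have h_four := h.fourPoint (v 0) q z (v n)
  rw [hq, ← hr, min_self] at h_four
  have h_swap := gromovProd_add_gromovProd_swap q (v 0) (v n)
  rw [dist_comm q, h_start] at h_swap
  have h_far : ∀ i ≤ n, r - A + κ * i ≤ dist q (v i) := fun i hi => by
    have := dist_triangle z q (v i)
    rw [dist_comm z q, h_end, dist_comm (v 0)] at this
    linarith [hdiv i hi]
  have h_dir := h.fourPoint.le_gromovProd_of_diverges hL_nonneg hκ hs hs_pos hL h_far 0 n.zero_le
  simp only [Nat.cast_zero, mul_zero, add_zero] at h_dir
  linarith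

end DivergingPaths

section Isometries

variable {G : Type*} [Group G] {X : Type*} [MetricSpace X] [MulAction G X] [IsIsometricSMul G X]
  {δ : ℝ}

lemma gromovProd_smul (g : G) (o a b : X) :
    gromovProd (g • o) (g • a) (g • b) = gromovProd o a b := by
  simp only [gromovProd, dist_smul]

lemma gromovProd_smul_base (g : G) (o a b : X) :
    gromovProd (g • o) a b = gromovProd o (g⁻¹ • a) (g⁻¹ • b) := by
  rw [← gromovProd_smul g o, smul_inv_smul, smul_inv_smul]

lemma dist_smul_left_eq_dist_inv_smul_right (g : G) (a b : X) :
    dist (g • a) b = dist a (g⁻¹ • b) := by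
  rw [← dist_smul g a, smul_inv_smul]

lemma dist_inv_smul_self (g : G) (x : X) : dist x (g⁻¹ • x) = dist x (g • x) := by
  rw [← dist_smul_left_eq_dist_inv_smul_right, dist_comm]

-- The distances of `o` and of `g • o` to `p` and `q` agree up to `2 * K`, so both are near the same
-- point of a geodesic from `p` to `q`.
lemma FourPointHyperbolic.dist_smul_le (h : FourPointHyperbolic X δ) {g : G} {p q o : X}
    {K C : ℝ} (hp : dist p (g • p) ≤ K) (hq : dist q (g • q) ≤ K) (ho : gromovProd o p q ≤ C) :
    dist o (g • o) ≤ 7 * K + 2 * C + 2 * δ := by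
  have h_four := h p o q (g • o)
  have ho_swap := gromovProd_add_gromovProd_swap p o q
  have hgo_swap := gromovProd_add_gromovProd_swap p (g • o) q
  have h_move_p := gromovProd_le_add_dist_left (g • o) p (g • p) q
  have h_move_q := gromovProd_le_add_dist_right (g • o) (g • p) q (g • q)
  rw [gromovProd_smul] at h_move_q
  have h_lower := dist_triangle_left (g • p) (g • o) p
  have h_upper := dist_triangle p (g • p) (g • o)
  rw [dist_smul] at h_lower h_upper
  have h_dist := dist_eq_sub_gromovProd p o (g • o)
  rw [gromovProd_comm p q (g • o)] at h_four
  rcases min_choice (gromovProd p o q) (gromovProd p (g • o) q) with h_min | h_min <;>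
    rw [h_min] at h_four <;> linarith

end Isometries

section TransverseWords

variable {G : Type*} [Group G] {X : Type*} [MetricSpace X] [MulAction G X] {δ C D : ℝ} {x : X}

/-- The word `l` describes a local quasigeodesic `x, g₁ x, g₁ g₂ x, …`: its steps have length at
least `D`, and consecutive steps have Gromov product at most `C`. -/
structure IsTransverseWord (x : X) (C D : ℝ) (l : List G) : Prop where
  long : ∀ g ∈ l, D ≤ dist x (g • x)
  transverse : l.IsChain fun a b => gromovProd x (a⁻¹ • x) (b • x) ≤ C

lemma IsTransverseWord.tail {g : G} {l : List G} (h : IsTransverseWord x C D (g :: l)) :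
    IsTransverseWord x C D l :=
  ⟨fun a ha => h.long a (List.mem_cons_of_mem _ ha), h.transverse.tail⟩

lemma isTransverseWord_replicate {g : G} (n : ℕ) (htrans : gromovProd x (g⁻¹ • x) (g • x) ≤ C)
    (hlong : D ≤ dist x (g • x)) : IsTransverseWord x C D (List.replicate n g) :=
  ⟨fun a ha => by rwa [List.eq_of_mem_replicate ha], List.isChain_replicate_of_rel n htrans⟩

variable [IsIsometricSMul G X]

lemma IsTransverseWord.gromovProd_le (h_hyp : FourPointHyperbolic X δ) (hC : 0 ≤ C)
    (hCD : 2 * C + 2 * δ < D) {l : List G} {g : G} (h : IsTransverseWord x C D (g :: l)) :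
    gromovProd x (g⁻¹ • x) (l.prod • x) ≤ C + δ := by
  induction l generalizing g with
  | nil =>
    have h_zero := gromovProd_le_right x (g⁻¹ • x) x
    rw [dist_self] at h_zero
    rw [List.prod_nil, one_smul]
    linarith [h_hyp.nonneg x]
  | cons a l ih =>
    have h_tail := ih h.tail
    have h_turn : gromovProd x (g⁻¹ • x) (a • x) ≤ C := (List.isChain_cons_cons.1 h.transverse).1
    have h_swap := gromovProd_add_gromovProd_swap x (a • x) ((a :: l).prod • x)
    rw [gromovProd_smul_base, List.prod_cons, ← mul_smul, inv_mul_cancel_left] at h_swap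
    rw [List.prod_cons]
    exact h_hyp.gromovProd_le_of_lt h_turn (by linarith [h.long a (by simp)])

lemma IsTransverseWord.le_gromovProd (h_hyp : FourPointHyperbolic X δ) (hC : 0 ≤ C)
    (hCD : 2 * C + 2 * δ < D) {l : List G} {g : G} (h : IsTransverseWord x C D (g :: l)) :
    D - C - δ ≤ gromovProd x (g • x) ((g :: l).prod • x) := by
  have h_swap := gromovProd_add_gromovProd_swap x (g • x) ((g :: l).prod • x)
  rw [gromovProd_smul_base, List.prod_cons, ← mul_smul, inv_mul_cancel_left] at h_swap
  rw [List.prod_cons]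
  linarith [h.long g (by simp), h.gromovProd_le h_hyp hC hCD]

lemma IsTransverseWord.sum_le_dist (h_hyp : FourPointHyperbolic X δ) (hC : 0 ≤ C)
    (hCD : 2 * C + 2 * δ < D) {l : List G} (h : IsTransverseWord x C D l) :
    (l.map fun g => dist x (g • x) - (2 * C + 2 * δ)).sum ≤ dist x (l.prod • x) := by
  induction l with
  | nil => simp
  | cons g l ih =>
    have h_tail := ih h.tail
    have h_turn := h.gromovProd_le h_hyp hC hCD
    have h_dist := dist_eq_sub_gromovProd x (g⁻¹ • x) (l.prod • x)
    rw [dist_smul_left_eq_dist_inv_smul_right, inv_inv, ← mul_smul, dist_inv_smul_self] at h_dist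
    rw [List.map_cons, List.sum_cons, List.prod_cons]
    linarith

lemma dist_list_prod_smul_le {L : ℝ} {l : List G} (h : ∀ g ∈ l, dist x (g • x) ≤ L) :
    dist x (l.prod • x) ≤ L * l.length := by
  induction l with
  | nil => simp
  | cons g l ih =>
    have h_tail := ih fun a ha => h a (List.mem_cons_of_mem _ ha)
    have h_head := h g (by simp)
    have h_tri := dist_triangle x (g • x) (g • l.prod • x)
    rw [dist_smul] at h_tri
    rw [List.prod_cons, List.length_cons, mul_smul]
    push_cast; linarith

lemma gromovProd_pow_le (h_hyp : FourPointHyperbolic X δ) (hC : 0 ≤ C) (hCD : 2 * C + 3 * δ < D)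
    {g : G} (htrans : gromovProd x (g⁻¹ • x) (g • x) ≤ C) (hlong : D ≤ dist x (g • x)) (i j : ℕ) :
    gromovProd x (g⁻¹ ^ i • x) (g ^ j • x) ≤ C + 2 * δ := by
  have hδ := h_hyp.nonneg x
  rcases i with _ | i
  · have h_zero := gromovProd_le_left x x (g ^ j • x)
    rw [dist_self] at h_zero
    rw [pow_zero, one_smul]
    linarith
  · have h_fwd := isTransverseWord_replicate (j + 1) htrans hlong
    have h_bwd := isTransverseWord_replicate (x := x) (C := C) (D := D) (g := g⁻¹) (i + 1)
      (by rwa [inv_inv, gromovProd_comm]) (by rwa [dist_inv_smul_self])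
    rw [List.replicate_succ] at h_fwd h_bwd
    have h_turn := h_fwd.gromovProd_le h_hyp hC (by linarith)
    have h_dir := h_bwd.le_gromovProd h_hyp hC (by linarith)
    rw [List.prod_replicate, gromovProd_comm] at h_turn
    rw [← List.replicate_succ, List.prod_replicate] at h_dir
    rw [gromovProd_comm]
    linarith [h_hyp.gromovProd_le_of_lt h_turn (c := g⁻¹ ^ (i + 1) • x) (by linarith)]

lemma mul_le_dist_pow_smul (h_hyp : FourPointHyperbolic X δ) (hC : 0 ≤ C)
    (hCD : 2 * C + 2 * δ < D) {g : G} (htrans : gromovProd x (g⁻¹ • x) (g • x) ≤ C)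
    (hlong : D ≤ dist x (g • x)) (n : ℕ) : (D - 2 * C - 2 * δ) * n ≤ dist x (g ^ n • x) := by
  have h_sum := (isTransverseWord_replicate n htrans hlong).sum_le_dist h_hyp hC hCD
  rw [List.map_replicate, List.sum_replicate, List.prod_replicate, nsmul_eq_mul] at h_sum
  calc (D - 2 * C - 2 * δ) * n ≤ (dist x (g • x) - (2 * C + 2 * δ)) * n :=
        mul_le_mul_of_nonneg_right (by linarith) n.cast_nonneg
    _ ≤ dist x (g ^ n • x) := by rwa [mul_comm]

end TransverseWords

section Loxodromic

variable {G : Type*} [Group G] {X : Type*} [MetricSpace X] [MulAction G X] [IsIsometricSMul G X]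

lemma dist_pow_add_smul_le (g : G) (x : X) (m n : ℕ) :
    dist x (g ^ (m + n) • x) ≤ dist x (g ^ m • x) + dist x (g ^ n • x) := by
  have := dist_triangle x (g ^ m • x) (g ^ m • g ^ n • x)
  rwa [dist_smul, ← mul_smul, ← pow_add] at this

lemma dist_pow_smul_le (g : G) (x : X) (n : ℕ) :
    dist x (g ^ n • x) ≤ dist x (g • x) * n := by
  simpa using dist_list_prod_smul_le (l := List.replicate n g)
    fun a ha => by rw [List.eq_of_mem_replicate ha]

lemma tendsto_dist_pow_smul_div (g : G) (x y : X) {τ : ℝ}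
    (h : Tendsto (fun n : ℕ => dist (g ^ n • x) x / (n : ℝ)) atTop (𝓝 τ)) :
    Tendsto (fun n : ℕ => dist (g ^ n • y) y / (n : ℝ)) atTop (𝓝 τ) := by
  have h_error : Tendsto (fun n : ℕ => 2 * dist x y / (n : ℝ)) atTop (𝓝 0) :=
    tendsto_const_div_atTop_nhds_zero_nat _
  have h_lower := h.sub h_error
  have h_upper := h.add h_error
  simp only [sub_zero, add_zero, ← sub_div, ← add_div] at h_lower h_upper
  refine tendsto_of_tendsto_of_tendsto_of_le_of_le h_lower h_upper (fun n => ?_) (fun n => ?_) <;>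
    dsimp only <;> gcongr
  · linarith [dist_triangle4 (g ^ n • x) (g ^ n • y) y x, dist_smul (g ^ n) x y, dist_comm x y]
  · linarith [dist_triangle4 (g ^ n • y) (g ^ n • x) x y, dist_smul (g ^ n) y x, dist_comm x y]

lemma isLoxodromic_of_mul_le_dist {g : G} {x : X} {c : ℝ} (hc : 0 < c)
    (h : ∀ n : ℕ, c * n ≤ dist x (g ^ n • x)) : IsLoxodromic X g := by
  have h_sub : Subadditive fun n : ℕ => dist x (g ^ n • x) := dist_pow_add_smul_le g x
  have h_bdd : BddBelow (Set.range fun n : ℕ => dist x (g ^ n • x) / n) :=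
    ⟨0, by rintro _ ⟨n, rfl⟩; positivity⟩
  have h_lim := h_sub.tendsto_lim h_bdd
  have h_le : c ≤ h_sub.lim := by
    refine ge_of_tendsto h_lim ?_
    filter_upwards [eventually_gt_atTop 0] with n hn
    rw [le_div_iff₀ (by exact_mod_cast hn)]
    exact h n
  refine ⟨h_sub.lim, hc.trans_le h_le, fun y => tendsto_dist_pow_smul_div g x y ?_⟩
  simpa only [dist_comm x] using h_lim

lemma mul_le_dist_pow_smul_of_tendsto {g : G} {τ : ℝ} {x : X}
    (h : Tendsto (fun n : ℕ => dist (g ^ n • x) x / (n : ℝ)) atTop (𝓝 τ)) (n : ℕ) :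
    τ * n ≤ dist x (g ^ n • x) := by
  simp only [dist_comm _ x] at h
  have h_sub : Subadditive fun n : ℕ => dist x (g ^ n • x) := dist_pow_add_smul_le g x
  have h_bdd : BddBelow (Set.range fun n : ℕ => dist x (g ^ n • x) / n) :=
    ⟨0, by rintro _ ⟨n, rfl⟩; positivity⟩
  rcases Nat.eq_zero_or_pos n with rfl | hn
  · simp
  rw [← tendsto_nhds_unique (h_sub.tendsto_lim h_bdd) h, ← le_div_iff₀ (by exact_mod_cast hn)]
  exact h_sub.lim_le_div h_bdd hn.ne'

-- For large `p` the displacements of `g ^ p` and `g ^ (2 * p)` are close to `p * τ` and to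
-- `2 * p * τ`, so that the Gromov product in question is small compared to `p * τ`.
lemma IsLoxodromic.exists_pow_gromovProd_lt {g : G} (h : IsLoxodromic X g) (x : X) (δ : ℝ) :
    ∃ p : ℕ, 0 < p ∧
      2 * gromovProd x ((g ^ p)⁻¹ • x) (g ^ p • x) + 3 * δ < dist x (g ^ p • x) := by
  obtain ⟨τ, hτ, h_lim⟩ := h
  have h_speed := (h_lim x).eventually (gt_mem_nhds (show τ < τ + τ / 4 by linarith))
  obtain ⟨p, ⟨h_upper, hp_pos⟩, hp_large⟩ := ((h_speed.and (eventually_gt_atTop 0)).and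
    (eventually_gt_atTop ⌈6 * δ / τ⌉₊)).exists
  refine ⟨p, hp_pos, ?_⟩
  have hp : (0 : ℝ) < p := by exact_mod_cast hp_pos
  rw [div_lt_iff₀ hp, dist_comm] at h_upper
  have h_lower := mul_le_dist_pow_smul_of_tendsto (h_lim x) p
  have h_lower_double := mul_le_dist_pow_smul_of_tendsto (h_lim x) (p + p)
  have h_dist := dist_eq_sub_gromovProd x ((g ^ p)⁻¹ • x) (g ^ p • x)
  rw [dist_smul_left_eq_dist_inv_smul_right, inv_inv, ← mul_smul, ← pow_add,
    dist_inv_smul_self] at h_dist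
  have hδ : 6 * δ < p * τ := (div_lt_iff₀ hτ).1 (Nat.lt_of_ceil_lt hp_large)
  push_cast at h_lower_double
  linarith

lemma dist_pow_smul_pow_div_smul_le (g : G) (x : X) (i : ℕ) {p : ℕ} (hp : 0 < p) :
    dist (g ^ i • x) ((g ^ p) ^ (i / p) • x) ≤ dist x (g • x) * p := by
  have h_div : g ^ i = (g ^ p) ^ (i / p) * g ^ (i % p) := by
    rw [← pow_mul, ← pow_add, Nat.div_add_mod]
  rw [h_div, mul_smul, dist_smul, dist_comm]
  refine (dist_pow_smul_le g x _).trans ?_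
  gcongr
  exact (Nat.mod_lt i hp).le

lemma IsLoxodromic.exists_gromovProd_pow_le {δ : ℝ} (h_hyp : FourPointHyperbolic X δ) {g : G}
    (h : IsLoxodromic X g) (x : X) :
    ∃ C : ℝ, ∀ i j : ℕ, gromovProd x (g⁻¹ ^ i • x) (g ^ j • x) ≤ C := by
  obtain ⟨p, hp, hlt⟩ := h.exists_pow_gromovProd_lt x δ
  refine ⟨gromovProd x ((g ^ p)⁻¹ • x) (g ^ p • x) + 2 * δ + dist x (g⁻¹ • x) * p +
    dist x (g • x) * p, fun i j => ?_⟩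
  have h_pow := gromovProd_pow_le h_hyp (gromovProd_nonneg _ _ _) hlt le_rfl le_rfl (i / p) (j / p)
  have h_right := dist_pow_smul_pow_div_smul_le g x j hp
  have h_left := dist_pow_smul_pow_div_smul_le g⁻¹ x i hp
  rw [inv_pow g p] at h_left
  linarith [gromovProd_le_add_dist_left x (g⁻¹ ^ i • x) ((g ^ p)⁻¹ ^ (i / p) • x) (g ^ j • x),
    gromovProd_le_add_dist_right x ((g ^ p)⁻¹ ^ (i / p) • x) (g ^ j • x) ((g ^ p) ^ (j / p) • x)]

lemma IsLoxodromic.inv {g : G} (h : IsLoxodromic X g) : IsLoxodromic X g⁻¹ := by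
  obtain ⟨τ, hτ, h_lim⟩ := h
  have h_inv (y : X) (n : ℕ) : dist (g⁻¹ ^ n • y) y = dist (g ^ n • y) y := by
    rw [inv_pow, dist_smul_left_eq_dist_inv_smul_right, inv_inv, dist_comm]
  exact ⟨τ, hτ, fun y => by simpa only [h_inv] using h_lim y⟩

end Loxodromic

section Boundary

variable {G : Type*} [Group G] {X : Type*} [MetricSpace X] [MulAction G X] [IsIsometricSMul G X]
  {δ C : ℝ}

lemma dist_pow_smul_pow_smul (g : G) (x : X) {m n : ℕ} (h : m ≤ n) :
    dist (g ^ m • x) (g ^ n • x) = dist x (g ^ (n - m) • x) := by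
  conv_lhs => rw [← Nat.add_sub_cancel' h, pow_add, mul_smul, dist_smul]

lemma dist_pow_floor_smul_bounds {g : G} {x : X} {Q : ℝ} (hQ : 1 ≤ Q)
    (h_lower : ∀ n : ℕ, Q⁻¹ * n ≤ dist x (g ^ n • x)) (h_upper : dist x (g • x) ≤ Q) {s t : ℝ}
    (hs : 0 ≤ s) (hst : s ≤ t) :
    Q⁻¹ * (t - s) - 1 ≤ dist (g ^ ⌊s⌋₊ • x) (g ^ ⌊t⌋₊ • x) ∧
      dist (g ^ ⌊s⌋₊ • x) (g ^ ⌊t⌋₊ • x) ≤ Q * (t - s) + Q := by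
  have h_floor : ⌊s⌋₊ ≤ ⌊t⌋₊ := Nat.floor_mono hst
  have h_floor_sub : ((⌊t⌋₊ - ⌊s⌋₊ : ℕ) : ℝ) = ⌊t⌋₊ - ⌊s⌋₊ := Nat.cast_sub h_floor
  have hs_floor := Nat.floor_le hs
  have hs_lt := Nat.lt_floor_add_one s
  have ht_floor := Nat.floor_le (hs.trans hst)
  have ht_lt := Nat.lt_floor_add_one t
  rw [dist_pow_smul_pow_smul g x h_floor]
  constructor
  · have : Q⁻¹ * (t - s - 1) ≤ Q⁻¹ * (⌊t⌋₊ - ⌊s⌋₊ : ℕ) :=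
      mul_le_mul_of_nonneg_left (by linarith) (by positivity)
    linarith [h_lower (⌊t⌋₊ - ⌊s⌋₊), inv_le_one_of_one_le₀ hQ]
  · calc dist x (g ^ (⌊t⌋₊ - ⌊s⌋₊) • x) ≤ dist x (g • x) * (⌊t⌋₊ - ⌊s⌋₊ : ℕ) :=
        dist_pow_smul_le g x _
      _ ≤ Q * (t - s + 1) := mul_le_mul h_upper (by linarith) (Nat.cast_nonneg _) (by linarith)
      _ = Q * (t - s) + Q := by ring

lemma IsLoxodromic.exists_isQuasigeodesicOn {g : G} (h : IsLoxodromic X g) (x : X) :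
    ∃ Q C : ℝ, 1 ≤ Q ∧ 0 ≤ C ∧
      IsQuasigeodesicOn Q C (Set.Ici 0) fun t : ℝ => g ^ ⌊t.toNNReal⌋₊ • x := by
  obtain ⟨τ, hτ, h_lim⟩ := h
  set Q := max 1 (max (dist x (g • x)) τ⁻¹)
  have hQ : 1 ≤ Q := le_max_left _ _
  have hQ_upper : dist x (g • x) ≤ Q := (le_max_left _ _).trans (le_max_right _ _)
  have hQ_lower (n : ℕ) : Q⁻¹ * n ≤ dist x (g ^ n • x) := by
    refine le_trans ?_ (mul_le_dist_pow_smul_of_tendsto (h_lim x) n)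
    gcongr
    exact inv_le_of_inv_le₀ hτ ((le_max_right _ _).trans (le_max_right _ _))
  have h_floor {r : ℝ} (hr : 0 ≤ r) : ⌊r.toNNReal⌋₊ = ⌊r⌋₊ := by
    conv_rhs => rw [← Real.coe_toNNReal r hr]
    exact (Nonneg.nat_floor_coe r.toNNReal).symm
  refine ⟨Q, Q, hQ, by linarith, fun s hs t ht => ?_⟩
  simp only [h_floor hs, h_floor ht]
  rcases le_total s t with hst | hts
  · have := dist_pow_floor_smul_bounds hQ hQ_lower hQ_upper hs hst
    rw [abs_sub_comm, abs_of_nonneg (sub_nonneg.2 hst)]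
    exact ⟨by linarith, this.2⟩
  · have := dist_pow_floor_smul_bounds hQ hQ_lower hQ_upper ht hts
    rw [dist_comm, abs_of_nonneg (sub_nonneg.2 hts)]
    exact ⟨by linarith, this.2⟩

/-- The forward orbit of `x` under a loxodromic element, as a quasigeodesic ray. It represents the
attracting fixed point on the boundary. -/
noncomputable def IsLoxodromic.ray {g : G} (h : IsLoxodromic X g) (x : X) : QuasigeodesicRay X :=
  ⟨fun t => g ^ ⌊t⌋₊ • x, h.exists_isQuasigeodesicOn x⟩

lemma IsLoxodromic.mk_ray_mem_boundaryFixedPoints {g g₀ : G} (h : IsLoxodromic X g) (x : X)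
    (h_comm : Commute g₀ g) :
    Quotient.mk (asymptoticSetoid X) (h.ray x) ∈ boundaryFixedPoints X g₀ := by
  have h_near (s : ℝ≥0) : dist (g₀ • g ^ ⌊s⌋₊ • x) (g ^ ⌊s⌋₊ • x) ≤ dist (g₀ • x) x := by
    rw [← mul_smul, (h_comm.pow_right _).eq, mul_smul, dist_smul]
  exact Quotient.sound (s := asymptoticSetoid X)
    ⟨dist (g₀ • x) x, fun s => ⟨s, h_near s⟩, fun s => ⟨s, h_near s⟩⟩

lemma FourPointHyperbolic.sub_two_mul_le_gromovProd (h : FourPointHyperbolic X δ)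
    {o a b c d : X} {r : ℝ} (hab : r ≤ gromovProd o a b) (hbc : r ≤ gromovProd o b c)
    (hcd : r ≤ gromovProd o c d) : r - 2 * δ ≤ gromovProd o a d := by
  have hδ := h.nonneg o
  have hac : r - δ ≤ gromovProd o a c := (sub_le_sub_right (le_min hab hbc) δ).trans (h o a b c)
  have had : r - δ - δ ≤ gromovProd o a d :=
    (sub_le_sub_right (le_min hac (by linarith)) δ).trans (h o a c d)
  linarith

lemma dist_sub_le_gromovProd_pow_smul {g : G} {x : X} {m n : ℕ} (hmn : m ≤ n)
    (hC : ∀ i j : ℕ, gromovProd x (g⁻¹ ^ i • x) (g ^ j • x) ≤ C) :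
    dist x (g ^ m • x) - C ≤ gromovProd x (g ^ m • x) (g ^ n • x) := by
  have h_swap := gromovProd_add_gromovProd_swap x (g ^ m • x) (g ^ n • x)
  have h_shift : (g ^ m)⁻¹ * g ^ n = g ^ (n - m) := by
    rw [inv_mul_eq_iff_eq_mul, ← pow_add, Nat.add_sub_cancel' hmn]
  rw [gromovProd_smul_base, ← mul_smul, h_shift, ← inv_pow] at h_swap
  linarith [hC m (n - m)]

lemma exists_le_dist_pow_smul_le {g : G} {x : X} {r : ℝ} (hr : 0 ≤ r) {n : ℕ}
    (hn : r ≤ dist x (g ^ n • x)) :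
    ∃ m ≤ n, r ≤ dist x (g ^ m • x) ∧ dist x (g ^ m • x) ≤ r + dist x (g • x) := by
  classical
  have h_ex : ∃ m, r ≤ dist x (g ^ m • x) := ⟨n, hn⟩
  refine ⟨Nat.find h_ex, Nat.find_min' h_ex hn, Nat.find_spec h_ex, ?_⟩
  rcases h_find : Nat.find h_ex with _ | m
  · rw [pow_zero, one_smul, dist_self]; positivity
  · have h_min : dist x (g ^ m • x) < r := not_le.1 (Nat.find_min h_ex (by omega))
    have h_step := dist_pow_add_smul_le g x m 1
    rw [pow_one] at h_step
    linarith

-- An orbit point of `h` far along the direction of `g` also passes near `g ^ i • x`, namely where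
-- its distance to `x` first reaches that of `g ^ i • x`.
lemma exists_dist_pow_smul_pow_smul_le {g h : G} {x : X} (h_hyp : FourPointHyperbolic X δ)
    (hg : ∀ i j : ℕ, gromovProd x (g⁻¹ ^ i • x) (g ^ j • x) ≤ C)
    (hh : ∀ i j : ℕ, gromovProd x (h⁻¹ ^ i • x) (h ^ j • x) ≤ C)
    (h_unbounded : ∀ R : ℝ, ∃ i j : ℕ, R < gromovProd x (g ^ i • x) (h ^ j • x)) (i : ℕ) :
    ∃ j : ℕ, dist (g ^ i • x) (h ^ j • x) ≤ dist x (h • x) + 2 * C + 4 * δ := by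
  obtain ⟨n, k, h_far⟩ := h_unbounded (dist x (g • x) * i)
  have h_near := dist_pow_smul_le g x i
  have h_left := gromovProd_le_left x (g ^ n • x) (h ^ k • x)
  have h_right := gromovProd_le_right x (g ^ n • x) (h ^ k • x)
  have hin : i ≤ n := by
    by_contra! hlt
    have : dist x (g • x) * n ≤ dist x (g • x) * i := by gcongr
    linarith [dist_pow_smul_le g x n]
  obtain ⟨j, hjk, hj_ge, hj_le⟩ :=
    exists_le_dist_pow_smul_le (g := h) (x := x) (r := dist x (g ^ i • x)) dist_nonneg (n := k)
      (by linarith)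
  have hC : 0 ≤ C := (gromovProd_nonneg _ _ _).trans (hg 0 0)
  have h_along_h : dist x (g ^ i • x) - C ≤ gromovProd x (h ^ k • x) (h ^ j • x) := by
    rw [gromovProd_comm]
    linarith [dist_sub_le_gromovProd_pow_smul hjk hh]
  have h_close := h_hyp.sub_two_mul_le_gromovProd (dist_sub_le_gromovProd_pow_smul hin hg)
    (by linarith) h_along_h
  refine ⟨j, ?_⟩
  rw [dist_eq_sub_gromovProd x]
  linarith

lemma IsLoxodromic.exists_gromovProd_pow_smul_le_of_disjoint (h_hyp : FourPointHyperbolic X δ)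
    {g h g₀ h₀ : G} (hg : IsLoxodromic X g) (hh : IsLoxodromic X h) (hg₀ : Commute g₀ g)
    (hh₀ : Commute h₀ h)
    (h_disj : Disjoint (boundaryFixedPoints X g₀) (boundaryFixedPoints X h₀)) (x : X) :
    ∃ C : ℝ, ∀ i j : ℕ, gromovProd x (g ^ i • x) (h ^ j • x) ≤ C := by
  by_contra! h_unbounded
  obtain ⟨Cg, hCg⟩ := hg.exists_gromovProd_pow_le h_hyp x
  obtain ⟨Ch, hCh⟩ := hh.exists_gromovProd_pow_le h_hyp x
  have hg_le (i j : ℕ) := (hCg i j).trans (le_max_left Cg Ch)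
  have hh_le (i j : ℕ) := (hCh i j).trans (le_max_right Cg Ch)
  have near_h := exists_dist_pow_smul_pow_smul_le h_hyp hg_le hh_le h_unbounded
  have near_g := exists_dist_pow_smul_pow_smul_le h_hyp hh_le hg_le fun R => by
    obtain ⟨i, j, hij⟩ := h_unbounded R
    exact ⟨j, i, by rwa [gromovProd_comm]⟩
  have h_asymp : Asymptotic (hg.ray x) (hh.ray x) := by
    refine ⟨dist x (g • x) + dist x (h • x) + 2 * max Cg Ch + 4 * δ, fun s => ?_, fun t => ?_⟩
    · obtain ⟨j, hj⟩ := near_h ⌊s⌋₊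
      refine ⟨j, ?_⟩
      simp only [IsLoxodromic.ray, Nat.floor_natCast]
      linarith [dist_nonneg (x := x) (y := g • x)]
    · obtain ⟨j, hj⟩ := near_g ⌊t⌋₊
      refine ⟨j, ?_⟩
      simp only [IsLoxodromic.ray, Nat.floor_natCast, dist_comm (g ^ j • x)]
      linarith [dist_nonneg (x := x) (y := h • x)]
  refine Set.disjoint_left.1 h_disj (hg.mk_ray_mem_boundaryFixedPoints x hg₀) ?_
  rw [Quotient.sound (s := asymptoticSetoid X) h_asymp]
  exact hh.mk_ray_mem_boundaryFixedPoints x hh₀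

end Boundary

section Schottky

variable {G : Type*} [Group G] {X : Type*} [MetricSpace X] [MulAction G X] {δ C D E : ℝ} {x : X}
  {a b : G}

/-- Two elements `a` and `b` that move `x` by at least `D`, in such a way that the four directions
`a⁻¹ • x`, `a • x`, `b⁻¹ • x`, `b • x` seen from `x` have pairwise Gromov products at most `C`. -/
structure IsTransversePair (x : X) (C D : ℝ) (a b : G) : Prop where
  left : gromovProd x (a⁻¹ • x) (a • x) ≤ C
  right : gromovProd x (b⁻¹ • x) (b • x) ≤ C
  inv_left : gromovProd x (a⁻¹ • x) (b • x) ≤ C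
  inv_right : gromovProd x (b⁻¹ • x) (a • x) ≤ C
  pos : gromovProd x (a • x) (b • x) ≤ C
  neg : gromovProd x (a⁻¹ • x) (b⁻¹ • x) ≤ C
  long_left : D ≤ dist x (a • x)
  long_right : D ≤ dist x (b • x)

/-- A family of elements that move `x` by at least `E + 4 * C + 6 * δ` and at most `2 * E`, in
directions with pairwise Gromov products at most `C`, as do their inverses. Eight elements are
enough for the proportion of bad choices in `IsSchottky.card_not_le` to be small. -/
structure IsSchottky (x : X) (δ C E : ℝ) (s : Fin 8 → G) : Prop where
  nonneg : 0 ≤ C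
  one_le : 1 ≤ E
  sep : ∀ i j, i ≠ j → gromovProd x (s i • x) (s j • x) ≤ C
  sep_inv : ∀ i j, i ≠ j → gromovProd x ((s i)⁻¹ • x) ((s j)⁻¹ • x) ≤ C
  long : ∀ i, E + 4 * C + 6 * δ ≤ dist x (s i • x)
  short : ∀ i, dist x (s i • x) ≤ 2 * E

/-- The word `a ^ i * b ^ q * a ^ i`. It starts and ends with exactly `i` letters `a`, which makes
words with different `i` transverse to each other, and so are their inverses. -/
def palindrome {α : Type*} (a b : α) (i q : ℕ) : List α :=
  List.replicate i a ++ (List.replicate q b ++ List.replicate i a)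

lemma eq_or_eq_of_mem_palindrome {α : Type*} {a b c : α} {i q : ℕ}
    (h : c ∈ palindrome a b i q) : c = a ∨ c = b := by
  simp only [palindrome, List.mem_append, List.mem_replicate] at h
  tauto

lemma map_palindrome {α β : Type*} (f : α → β) (a b : α) (i q : ℕ) :
    (palindrome a b i q).map f = palindrome (f a) (f b) i q := by
  simp [palindrome]

lemma palindrome_prod (a b : G) (i q : ℕ) :
    (palindrome a b i q).prod = a ^ i * (b ^ q * a ^ i) := by
  simp [palindrome]

lemma palindrome_prod_inv (a b : G) (i q : ℕ) :
    (palindrome a b i q).prod⁻¹ = (palindrome a⁻¹ b⁻¹ i q).prod := by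
  simp [palindrome_prod, mul_assoc]

lemma IsTransversePair.nonneg (h : IsTransversePair x C D a b) : 0 ≤ C :=
  (gromovProd_nonneg _ _ _).trans h.left

lemma IsTransversePair.isTransverseWord (h : IsTransversePair x C D a b) {l : List G}
    (hl : ∀ g ∈ l, g = a ∨ g = b) : IsTransverseWord x C D l := by
  refine ⟨fun g hg => ?_, (List.pairwise_of_forall_mem_list fun u hu v hv => ?_).isChain⟩
  · rcases hl g hg with rfl | rfl
    exacts [h.long_left, h.long_right]
  · rcases hl u hu with rfl | rfl <;> rcases hl v hv with rfl | rfl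
    exacts [h.left, h.inv_left, h.inv_right, h.right]

lemma card_not_gromovProd_le {ι : Type*} [Fintype ι] (h_hyp : FourPointHyperbolic X δ) {p : ι → X}
    (hp : ∀ i j, i ≠ j → gromovProd x (p i) (p j) ≤ C) (y : X) :
    (Finset.univ.filter fun i => ¬ gromovProd x y (p i) ≤ C + δ).card ≤ 1 := by
  refine Finset.card_le_one.2 fun i hi j hj => ?_
  simp only [Finset.mem_filter, Finset.mem_univ, true_and, not_le] at hi hj
  by_contra hij
  have h_four := h_hyp x (p i) y (p j)
  rw [gromovProd_comm x (p i) y] at h_four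
  linarith [lt_min hi hj, hp i j hij]

lemma IsSchottky.card_not_le (h_hyp : FourPointHyperbolic X δ) {s : Fin 8 → G}
    (h : IsSchottky x δ C E s) (y z : X) :
    (Finset.univ.filter fun i => ¬ (gromovProd x y (s i • x) ≤ C + δ ∧
      gromovProd x ((s i)⁻¹ • x) z ≤ C + δ)).card ≤ 2 := by
  classical
  simp only [not_and_or, Finset.filter_or, gromovProd_comm x _ z]
  exact (Finset.card_union_le _ _).trans
    (add_le_add (card_not_gromovProd_le h_hyp h.sep y) (card_not_gromovProd_le h_hyp h.sep_inv z))

variable [IsIsometricSMul G X]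

lemma IsTransversePair.inv (h : IsTransversePair x C D a b) :
    IsTransversePair x C D a⁻¹ b⁻¹ where
  left := by rw [inv_inv, gromovProd_comm]; exact h.left
  right := by rw [inv_inv, gromovProd_comm]; exact h.right
  inv_left := by rw [inv_inv, gromovProd_comm]; exact h.inv_right
  inv_right := by rw [inv_inv, gromovProd_comm]; exact h.inv_left
  pos := h.neg
  neg := by rw [inv_inv, inv_inv]; exact h.pos
  long_left := by rw [dist_inv_smul_self]; exact h.long_left
  long_right := by rw [dist_inv_smul_self]; exact h.long_right

lemma IsTransversePair.gromovProd_cons_cons_le (h_hyp : FourPointHyperbolic X δ)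
    (hCD : 2 * C + 3 * δ < D) (h : IsTransversePair x C D a b) {l m : List G}
    (hl : ∀ g ∈ l, g = a ∨ g = b) (hm : ∀ g ∈ m, g = a ∨ g = b) :
    gromovProd x ((b :: l).prod • x) ((a :: m).prod • x) ≤ C + 2 * δ := by
  have hδ := h_hyp.nonneg x
  have hl_word := h.isTransverseWord (l := b :: l) (List.forall_mem_cons.2 ⟨.inr rfl, hl⟩)
  have hm_word := h.isTransverseWord (l := a :: m) (List.forall_mem_cons.2 ⟨.inl rfl, hm⟩)
  have hl_dir := hl_word.le_gromovProd h_hyp h.nonneg (by linarith)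
  have hm_dir := hm_word.le_gromovProd h_hyp h.nonneg (by linarith)
  have h_left := h_hyp.gromovProd_le_of_lt h.pos (c := (b :: l).prod • x) (by linarith)
  rw [gromovProd_comm] at h_left
  linarith [h_hyp.gromovProd_le_of_lt h_left (c := (a :: m).prod • x) (by linarith)]

-- After the common prefix `a ^ i` one word continues with `b` and the other one with `a`.
lemma IsTransversePair.gromovProd_palindrome_le (h_hyp : FourPointHyperbolic X δ)
    (hCD : 2 * C + 3 * δ < D) (h : IsTransversePair x C D a b) {i j q q' : ℕ} (hij : i < j)
    (hq : 0 < q) :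
    gromovProd x ((palindrome a b i q).prod • x) ((palindrome a b j q').prod • x) ≤
      C + 2 * δ + dist x (a • x) * i := by
  set l := List.replicate (q - 1) b ++ List.replicate i a with hl
  set m := List.replicate (j - i - 1) a ++ (List.replicate q' b ++ List.replicate j a) with hm
  have h_left : (palindrome a b i q).prod = a ^ i * (b :: l).prod := by
    simp only [palindrome_prod, hl, List.prod_cons, List.prod_append, List.prod_replicate]
    rw [← mul_assoc b, ← pow_succ', Nat.sub_add_cancel hq]
  have h_right : (palindrome a b j q').prod = a ^ i * (a :: m).prod := by
    simp only [palindrome_prod, hm, List.prod_cons, List.prod_append, List.prod_replicate]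
    rw [← mul_assoc a, ← pow_succ', ← mul_assoc (a ^ i), ← pow_add]
    congr 2; omega
  have h_turn := h.gromovProd_cons_cons_le h_hyp hCD (l := l) (m := m)
    (fun g hg => by simp only [hl, List.mem_append, List.mem_replicate] at hg; tauto)
    (fun g hg => by simp only [hm, List.mem_append, List.mem_replicate] at hg; tauto)
  have h_base := gromovProd_le_add_dist_base x (a ^ i • x) ((palindrome a b i q).prod • x)
    ((palindrome a b j q').prod • x)
  rw [gromovProd_smul_base, h_left, h_right, ← mul_smul, ← mul_smul, inv_mul_cancel_left,
    inv_mul_cancel_left] at h_base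
  rw [h_left, h_right]
  linarith [dist_pow_smul_le a x i]

lemma IsTransversePair.gromovProd_palindrome_le_of_ne (h_hyp : FourPointHyperbolic X δ)
    (hCD : 2 * C + 3 * δ < D) (h : IsTransversePair x C D a b) {N : ℕ} {q : ℕ → ℕ} {i j : ℕ}
    (hi : i < N) (hj : j < N) (hq : ∀ k < N, 0 < q k) (hij : i ≠ j) :
    gromovProd x ((palindrome a b i (q i)).prod • x) ((palindrome a b j (q j)).prod • x) ≤
      C + 2 * δ + dist x (a • x) * N := by
  wlog hlt : i < j generalizing i j
  · rw [gromovProd_comm]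
    exact this hj hi hij.symm (lt_of_le_of_ne (not_lt.1 hlt) hij.symm)
  · refine (h.gromovProd_palindrome_le h_hyp hCD hlt (hq i hi)).trans ?_
    have := hi.le
    gcongr

lemma IsTransversePair.le_dist_palindrome (h_hyp : FourPointHyperbolic X δ)
    (hCD : 2 * C + 2 * δ < D) (h : IsTransversePair x C D a b) (i q : ℕ) :
    q * (dist x (b • x) - (2 * C + 2 * δ)) ≤ dist x ((palindrome a b i q).prod • x) := by
  have h_sum := (h.isTransverseWord (l := palindrome a b i q)
    fun g hg => eq_or_eq_of_mem_palindrome hg).sum_le_dist h_hyp h.nonneg hCD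
  simp only [palindrome, List.map_append, List.map_replicate, List.sum_append,
    List.sum_replicate, nsmul_eq_mul] at h_sum
  have : 0 ≤ (i : ℝ) * (dist x (a • x) - (2 * C + 2 * δ)) :=
    mul_nonneg i.cast_nonneg (by linarith [h.long_left])
  exact le_trans (by linarith) h_sum

lemma dist_mul_smul_le (x : X) (g h : G) :
    dist x ((g * h) • x) ≤ dist x (g • x) + dist x (h • x) := by
  rw [mul_smul, ← dist_smul g x (h • x)]
  exact dist_triangle x (g • x) (g • h • x)

lemma dist_palindrome_le (x : X) (a b : G) (i q : ℕ) :
    dist x ((palindrome a b i q).prod • x) ≤ 2 * (dist x (a • x) * i) + dist x (b • x) * q := by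
  rw [palindrome_prod]
  linarith [dist_mul_smul_le x (a ^ i) (b ^ q * a ^ i), dist_mul_smul_le x (b ^ q) (a ^ i),
    dist_pow_smul_le a x i, dist_pow_smul_le b x q]

-- The exponents of `b` are chosen so that all eight words have the same number of letters.
lemma IsTransversePair.exists_isSchottky (h_hyp : FourPointHyperbolic X δ) (hD : 0 < D)
    (hCD : 8 * (C + δ) ≤ D) (h : IsTransversePair x C D a b) :
    ∃ (T : ℕ) (C' E : ℝ),
      IsSchottky x δ C' E fun i => (palindrome a b i (T + 2 * (8 - i))).prod := by
  have hC := h.nonneg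
  have hδ := h_hyp.nonneg x
  have hβ : D ≤ dist x (b • x) := h.long_right
  have hCD' : 2 * C + 3 * δ < D := by linarith
  set α := dist x (a • x)
  set β := dist x (b • x)
  set C' := C + 2 * δ + α * 8 with hC'
  have hα : 0 ≤ α := dist_nonneg
  have hC'_nonneg : 0 ≤ C' := by positivity
  obtain ⟨T, hT⟩ := exists_nat_ge ((32 * α + 32 * β + 16 * C' + 24 * δ + 2) / D)
  rw [div_le_iff₀ hD] at hT
  have hTβ : (T : ℝ) * D ≤ T * β := by gcongr
  have h_sep {a b : G} (h : IsTransversePair x C D a b) (ha : dist x (a • x) = α) {i j : Fin 8}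
      (hij : i ≠ j) :
      gromovProd x ((palindrome a b i (T + 2 * (8 - i))).prod • x)
        ((palindrome a b j (T + 2 * (8 - j))).prod • x) ≤ C' :=
    (h.gromovProd_palindrome_le_of_ne h_hyp hCD' (q := fun k => T + 2 * (8 - k)) i.2 j.2
      (fun k hk => by omega) (Fin.val_ne_of_ne hij)).trans_eq (by rw [hC', ha, Nat.cast_ofNat])
  have h_exp (i : Fin 8) : (T : ℝ) ≤ (T + 2 * (8 - i) : ℕ) ∧ ((T + 2 * (8 - i) : ℕ) : ℝ) ≤ T + 16 :=
    ⟨by exact_mod_cast Nat.le_add_right _ _, by exact_mod_cast (by omega)⟩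
  refine ⟨T, C', 3 / 4 * T * β - 4 * C' - 6 * δ, hC'_nonneg, by linarith,
    fun i j hij => h_sep h rfl hij, fun i j hij => ?_, fun i => ?_, fun i => ?_⟩
  · rw [palindrome_prod_inv, palindrome_prod_inv]
    exact h_sep h.inv (dist_inv_smul_self a x) hij
  · refine le_trans ?_ (h.le_dist_palindrome h_hyp (by linarith) i _)
    have := mul_le_mul (h_exp i).1 (show 3 / 4 * β ≤ β - (2 * C + 2 * δ) by linarith)
      (by linarith) (Nat.cast_nonneg _)
    linarith
  · refine (dist_palindrome_le x a b i _).trans ?_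
    have h_a : α * (i : ℕ) ≤ α * 8 := by gcongr; exact_mod_cast i.2.le
    have h_b : β * (T + 2 * (8 - i) : ℕ) ≤ β * (T + 16) := by gcongr; exact (h_exp i).2
    linarith

lemma IsSchottky.gromovProd_inv_smul_le (h_hyp : FourPointHyperbolic X δ) {s : Fin 8 → G}
    (h : IsSchottky x δ C E s) {y z : X} {i : Fin 8} (hy : gromovProd x y (s i • x) ≤ C + δ)
    (hz : gromovProd x ((s i)⁻¹ • x) z ≤ C + δ) :
    gromovProd x ((s i)⁻¹ • y) z ≤ C + 2 * δ := by
  have hδ := h_hyp.nonneg x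
  have h_swap := gromovProd_add_gromovProd_swap x ((s i)⁻¹ • x) ((s i)⁻¹ • y)
  rw [gromovProd_smul_base, inv_inv, smul_inv_smul, gromovProd_comm x (s i • x),
    dist_inv_smul_self] at h_swap
  rw [gromovProd_comm] at hz ⊢
  linarith [h_hyp.gromovProd_le_of_lt hz (c := (s i)⁻¹ • y)
    (by linarith [h.long i, h.one_le, h.nonneg])]

end Schottky

section Existence

variable {G : Type*} [Group G] {μ : PMF G}

lemma exists_list_prod_eq_of_mem_generatedSemigroup {g : G} (h : g ∈ generatedSemigroup μ) :
    ∃ l : List G, l ≠ [] ∧ (∀ a ∈ l, a ∈ μ.support) ∧ l.prod = g := by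
  induction h using Subsemigroup.closure_induction with
  | mem g hg => exact ⟨[g], by simp, by simpa using hg, by simp⟩
  | mul a b _ _ ih_left ih_right =>
    obtain ⟨l, hl, hl_supp, rfl⟩ := ih_left
    obtain ⟨m, -, hm_supp, rfl⟩ := ih_right
    exact ⟨l ++ m, by simp [hl], List.forall_mem_append.2 ⟨hl_supp, hm_supp⟩, by simp⟩

variable {X : Type*} [MetricSpace X] [MulAction G X] [IsIsometricSMul G X] {δ : ℝ}

lemma IsLoxodromic.eventually_le_dist_pow_smul {g : G} (h : IsLoxodromic X g) (x : X) (D : ℝ) :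
    ∀ᶠ n : ℕ in atTop, D ≤ dist x (g ^ n • x) := by
  obtain ⟨τ, hτ, h_lim⟩ := h
  have h_atTop : Tendsto (fun n : ℕ => τ * n) atTop atTop :=
    tendsto_natCast_atTop_atTop.const_mul_atTop hτ
  filter_upwards [h_atTop.eventually_ge_atTop D] with n hn
  exact hn.trans (mul_le_dist_pow_smul_of_tendsto (h_lim x) n)

lemma IsLoxodromic.exists_isTransversePair (h_hyp : FourPointHyperbolic X δ) {g h : G}
    (hg : IsLoxodromic X g) (hh : IsLoxodromic X h)
    (h_disj : Disjoint (boundaryFixedPoints X g) (boundaryFixedPoints X h)) (x : X) :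
    ∃ C : ℝ, ∀ D : ℝ, ∀ᶠ n : ℕ in atTop,
      ∀ i ≥ n, ∀ j ≥ n, IsTransversePair x C D (g ^ i) (h ^ j) := by
  have hg_comm : Commute g g⁻¹ := Commute.inv_right rfl
  have hh_comm : Commute h h⁻¹ := Commute.inv_right rfl
  obtain ⟨C₁, hC₁⟩ := hg.exists_gromovProd_pow_le h_hyp x
  obtain ⟨C₂, hC₂⟩ := hh.exists_gromovProd_pow_le h_hyp x
  obtain ⟨C₃, hC₃⟩ :=
    hg.inv.exists_gromovProd_pow_smul_le_of_disjoint h_hyp hh hg_comm rfl h_disj x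
  obtain ⟨C₄, hC₄⟩ :=
    hg.exists_gromovProd_pow_smul_le_of_disjoint h_hyp hh.inv rfl hh_comm h_disj x
  obtain ⟨C₅, hC₅⟩ := hg.exists_gromovProd_pow_smul_le_of_disjoint h_hyp hh rfl rfl h_disj x
  obtain ⟨C₆, hC₆⟩ :=
    hg.inv.exists_gromovProd_pow_smul_le_of_disjoint h_hyp hh.inv hg_comm hh_comm h_disj x
  obtain ⟨C, hC⟩ := ({C₁, C₂, C₃, C₄, C₅, C₆} : Finset ℝ).exists_le
  refine ⟨C, fun D => ?_⟩
  filter_upwards [eventually_forall_ge_atTop.2 (hg.eventually_le_dist_pow_smul x D),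
    eventually_forall_ge_atTop.2 (hh.eventually_le_dist_pow_smul x D)] with n hg_long hh_long
  intro i hi j hj
  refine ⟨?_, ?_, ?_, ?_, ?_, ?_, hg_long i hi, hh_long j hj⟩ <;>
    try simp only [← inv_pow]
  · exact (hC₁ i i).trans (hC _ (by simp))
  · exact (hC₂ j j).trans (hC _ (by simp))
  · exact (hC₃ i j).trans (hC _ (by simp))
  · rw [gromovProd_comm]; exact (hC₄ i j).trans (hC _ (by simp))
  · exact (hC₅ i j).trans (hC _ (by simp))
  · exact (hC₆ i j).trans (hC _ (by simp))

lemma mem_of_mem_flatten_replicate {α : Type*} {n : ℕ} {l : List α} {a : α}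
    (h : a ∈ (List.replicate n l).flatten) : a ∈ l := by
  obtain ⟨l', hl', ha⟩ := List.mem_flatten.1 h
  rwa [← List.eq_of_mem_replicate hl']

-- The powers of `A` and `B` from which the palindromes are built have the same number of letters,
-- so that the eight words have the same length.
lemma IsNonElementary.exists_isSchottky (h_hyp : FourPointHyperbolic X δ)
    (h : IsNonElementary X μ) (x : X) :
    ∃ (m : ℕ) (C E : ℝ) (word : Fin 8 → List G), 0 < m ∧ (∀ i, (word i).length = m) ∧
      (∀ i, ∀ g ∈ word i, g ∈ μ.support) ∧ IsSchottky x δ C E fun i => (word i).prod := by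
  obtain ⟨g, hg, h, hh, hg_lox, hh_lox, h_disj⟩ := h
  obtain ⟨A, hA_ne, hA_supp, rfl⟩ := exists_list_prod_eq_of_mem_generatedSemigroup hg
  obtain ⟨B, hB_ne, hB_supp, rfl⟩ := exists_list_prod_eq_of_mem_generatedSemigroup hh
  have hA : 0 < A.length := List.length_pos_iff.2 hA_ne
  have hB : 0 < B.length := List.length_pos_iff.2 hB_ne
  obtain ⟨C, h_pair⟩ := hg_lox.exists_isTransversePair h_hyp hh_lox h_disj x
  obtain ⟨p, h_pair, hp⟩ :=
    ((h_pair (8 * (C + δ) + 1)).and (eventually_gt_atTop 0)).exists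
  have h_pair := h_pair (p * B.length) (Nat.le_mul_of_pos_right p hB) (p * A.length)
    (Nat.le_mul_of_pos_right p hA)
  obtain ⟨T, C', E, h_schottky⟩ := h_pair.exists_isSchottky h_hyp
    (by linarith [h_pair.nonneg, h_hyp.nonneg x]) (by linarith)
  set a := (List.replicate (p * B.length) A).flatten with ha
  set b := (List.replicate (p * A.length) B).flatten with hb
  have ha_length : a.length = p * B.length * A.length := by simp [ha]
  have hb_length : b.length = p * B.length * A.length := by simp [hb]; ring
  refine ⟨(T + 16) * (p * B.length * A.length), C', E,
    fun i => (palindrome a b i (T + 2 * (8 - i))).flatten, by positivity, fun i => ?_,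
    fun i g hg => ?_, ?_⟩
  · have : (i : ℕ) + (T + 2 * (8 - i) + i) = T + 16 := by omega
    rw [List.length_flatten, map_palindrome, ha_length, hb_length, ← this]
    simp [palindrome]
  · obtain ⟨l, hl, hgl⟩ := List.mem_flatten.1 hg
    rcases eq_or_eq_of_mem_palindrome hl with rfl | rfl
    · exact hA_supp g (mem_of_mem_flatten_replicate hgl)
    · exact hB_supp g (mem_of_mem_flatten_replicate hgl)
  · convert h_schottky using 2 with i
    rw [List.prod_flatten, map_palindrome]
    simp [ha, hb]

lemma HasBoundedSupport.exists_dist_smul_le (h : HasBoundedSupport X μ) (x : X) :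
    ∃ L : ℝ, 1 ≤ L ∧ ∀ g ∈ μ.support, dist x (g • x) ≤ L := by
  obtain ⟨y, hy⟩ := h
  obtain ⟨R, hR⟩ := hy.subset_closedBall y
  refine ⟨max 1 (2 * dist x y + R), le_max_left _ _, fun g hg => le_max_of_le_right ?_⟩
  have h_near : dist (g • y) y ≤ R := hR ⟨g, hg, rfl⟩
  linarith [dist_triangle4 x y (g • y) (g • x), dist_smul g y x, dist_comm x y,
    dist_comm y (g • y)]

end Existence

section WordProbability

open scoped ENNReal

variable {G : Type*}

/-- The expectation of a function of the word `[g₁, …, gₙ]` formed by the first `n` steps of the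
walk. It is defined by conditioning on the first step, so that no measurability is involved; see
`stepMeasure_word_mem_le` for the comparison with the law of the walk. -/
noncomputable def wordExp (μ : PMF G) : ℕ → (List G → ℝ≥0∞) → ℝ≥0∞
  | 0, F => F []
  | n + 1, F => ∑' g, μ g * wordExp μ n fun l => F (g :: l)

/-- The probability that the word formed by the first `n` steps of the walk lies in `S`. -/
noncomputable def wordProb (μ : PMF G) (n : ℕ) (S : Set (List G)) : ℝ≥0∞ :=
  wordExp μ n (S.indicator 1)

variable {μ : PMF G}

lemma wordExp_mono {n : ℕ} {F F' : List G → ℝ≥0∞}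
    (h : ∀ l : List G, l.length = n → (∀ g ∈ l, g ∈ μ.support) → F l ≤ F' l) :
    wordExp μ n F ≤ wordExp μ n F' := by
  induction n generalizing F F' with
  | zero => exact h [] rfl (by simp)
  | succ n ih =>
    refine ENNReal.tsum_le_tsum fun g => ?_
    by_cases hg : g ∈ μ.support
    · gcongr
      exact ih fun l hl hs => h (g :: l) (by simp [hl]) (List.forall_mem_cons.2 ⟨hg, hs⟩)
    · rw [(μ.apply_eq_zero_iff g).2 hg, zero_mul, zero_mul]

lemma wordExp_congr {n : ℕ} {F F' : List G → ℝ≥0∞}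
    (h : ∀ l : List G, l.length = n → F l = F' l) : wordExp μ n F = wordExp μ n F' :=
  le_antisymm (wordExp_mono fun l hl _ => (h l hl).le) (wordExp_mono fun l hl _ => (h l hl).ge)

lemma wordExp_const (n : ℕ) (c : ℝ≥0∞) : wordExp μ n (fun _ => c) = c := by
  induction n with
  | zero => rfl
  | succ n ih => simp only [wordExp, ih, ENNReal.tsum_mul_right, μ.tsum_coe, one_mul]

lemma wordExp_add (n : ℕ) (F F' : List G → ℝ≥0∞) :
    wordExp μ n (fun l => F l + F' l) = wordExp μ n F + wordExp μ n F' := by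
  induction n generalizing F F' with
  | zero => rfl
  | succ n ih => simp only [wordExp, ih, mul_add, ENNReal.tsum_add]

lemma wordExp_const_mul (n : ℕ) (c : ℝ≥0∞) (F : List G → ℝ≥0∞) :
    wordExp μ n (fun l => c * F l) = c * wordExp μ n F := by
  induction n generalizing F with
  | zero => rfl
  | succ n ih => simp only [wordExp, ih, mul_left_comm _ c, ENNReal.tsum_mul_left]

lemma wordExp_mul_const (n : ℕ) (c : ℝ≥0∞) (F : List G → ℝ≥0∞) :
    wordExp μ n (fun l => F l * c) = wordExp μ n F * c := by
  simp only [mul_comm _ c, wordExp_const_mul]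

lemma wordExp_tsum {ι : Type*} (n : ℕ) (F : ι → List G → ℝ≥0∞) :
    wordExp μ n (fun l => ∑' i, F i l) = ∑' i, wordExp μ n (F i) := by
  induction n generalizing F with
  | zero => rfl
  | succ n ih =>
    simp only [wordExp, ih, ← ENNReal.tsum_mul_left]
    exact ENNReal.tsum_comm

lemma wordExp_append (m n : ℕ) (F : List G → ℝ≥0∞) :
    wordExp μ (m + n) F = wordExp μ m fun l => wordExp μ n fun l' => F (l ++ l') := by
  induction m generalizing F with
  | zero => simp [wordExp]
  | succ m ih =>
    rw [Nat.add_right_comm]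
    simp only [wordExp, ih, List.cons_append]

lemma wordExp_take {m n : ℕ} (h : m ≤ n) (F : List G → ℝ≥0∞) :
    wordExp μ n (fun l => F (l.take m)) = wordExp μ m F := by
  obtain ⟨k, rfl⟩ := Nat.exists_eq_add_of_le h
  rw [wordExp_append]
  refine wordExp_congr fun l hl => ?_
  simp only [← hl, List.take_left, wordExp_const]

lemma wordExp_drop {m n : ℕ} (h : m ≤ n) (F : List G → ℝ≥0∞) :
    wordExp μ n (fun l => F (l.drop m)) = wordExp μ (n - m) F := by
  obtain ⟨k, rfl⟩ := Nat.exists_eq_add_of_le h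
  rw [wordExp_append, Nat.add_sub_cancel_left, ← wordExp_const m (wordExp μ k F)]
  refine wordExp_congr fun l hl => ?_
  simp only [← hl, List.drop_left]

lemma wordProb_mono {n : ℕ} {S T : Set (List G)}
    (h : ∀ l : List G, l.length = n → (∀ g ∈ l, g ∈ μ.support) → l ∈ S → l ∈ T) :
    wordProb μ n S ≤ wordProb μ n T := by
  refine wordExp_mono fun l hl hs => ?_
  by_cases hS : l ∈ S
  · simp [hS, h l hl hs hS]
  · simp [hS]

lemma wordProb_le_one (n : ℕ) (S : Set (List G)) : wordProb μ n S ≤ 1 := by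
  rw [← wordExp_const (μ := μ) n 1]
  exact wordExp_mono fun l _ _ => Set.indicator_le_self' (by simp) l

lemma wordProb_union_le (n : ℕ) (S T : Set (List G)) :
    wordProb μ n (S ∪ T) ≤ wordProb μ n S + wordProb μ n T := by
  rw [wordProb, wordProb, wordProb, ← wordExp_add]
  refine wordExp_mono fun l _ _ => ?_
  by_cases hS : l ∈ S <;> by_cases hT : l ∈ T <;> simp [hS, hT]

lemma wordProb_add_compl (n : ℕ) (S : Set (List G)) :
    wordProb μ n S + wordProb μ n Sᶜ = 1 := by
  rw [wordProb, wordProb, ← wordExp_add, ← wordExp_const (μ := μ) n 1]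
  refine wordExp_congr fun l _ => ?_
  by_cases hS : l ∈ S <;> simp [hS]

lemma wordProb_biUnion_le {ι : Type*} (s : Finset ι) (n : ℕ) (S : ι → Set (List G)) :
    wordProb μ n (⋃ i ∈ s, S i) ≤ ∑ i ∈ s, wordProb μ n (S i) := by
  classical
  induction s using Finset.induction_on with
  | empty => simp [wordProb, wordExp_const]
  | insert a s ha ih =>
    rw [Finset.set_biUnion_insert, Finset.sum_insert ha]
    exact (wordProb_union_le _ _ _).trans (by gcongr)

lemma wordProb_append (m n : ℕ) (S : Set (List G)) :
    wordProb μ (m + n) S = wordExp μ m fun l => wordProb μ n {l' | l ++ l' ∈ S} :=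
  wordExp_append m n _

lemma wordProb_take {m n : ℕ} (h : m ≤ n) (S : Set (List G)) :
    wordProb μ n {l | l.take m ∈ S} = wordProb μ m S :=
  wordExp_take h (S.indicator 1)

lemma wordProb_drop {m n : ℕ} (h : m ≤ n) (S : Set (List G)) :
    wordProb μ n {l | l.drop m ∈ S} = wordProb μ (n - m) S :=
  wordExp_drop h (S.indicator 1)

lemma wordProb_singleton_pos {l : List G} (h : ∀ g ∈ l, g ∈ μ.support) :
    0 < wordProb μ l.length {l} := by
  induction l with
  | nil => simp [wordProb, wordExp]
  | cons g l ih =>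
    have h_tail := ih fun a ha => h a (List.mem_cons_of_mem _ ha)
    have h_head : μ g ≠ 0 := (μ.mem_support_iff g).1 (h g (by simp))
    refine (ENNReal.mul_pos h_head h_tail.ne').trans_le (le_trans (le_of_eq ?_)
      (ENNReal.le_tsum g))
    refine congrArg (μ g * ·) (wordExp_congr fun l' _ => ?_)
    by_cases hl : l' = l <;> simp [hl]

end WordProbability

section PathMeasure

open scoped ENNReal

variable {G : Type*}

/-- The sequences of steps which start with the first `k` terms of `η`. -/
def stepCylinder (η : ℕ → G) (k : ℕ) : Set (ℕ → G) := {ω | ∀ i < k, ω i = η i}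

lemma stepCylinder_inter_word_mem_subset (μ : PMF G) (η : ℕ → G) (k n : ℕ) (S : Set (List G)) :
    stepCylinder η k ∩ {ω | (List.range' k (n + 1)).map ω ∈ S} ⊆
      {ω | ω k ∉ μ.support} ∪ ⋃ g : μ.support, stepCylinder (Function.update η k g) (k + 1) ∩
        {ω | (List.range' (k + 1) n).map ω ∈ {l | (g : G) :: l ∈ S}} := by
  rintro ω ⟨hω, hS⟩
  by_cases hk : ω k ∈ μ.support
  · refine Or.inr (Set.mem_iUnion.2 ⟨⟨ω k, hk⟩, fun i hi => ?_, ?_⟩)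
    · rcases Nat.lt_succ_iff_lt_or_eq.1 hi with hi | rfl
      · rw [Function.update_of_ne hi.ne, hω i hi]
      · rw [Function.update_self]
    · simpa [List.range'_succ] using hS
  · exact Or.inl hk

variable {μ : PMF G}

lemma stepMeasure_stepCylinder (η : ℕ → G) (k : ℕ) :
    stepMeasure μ (stepCylinder η k) = ∏ i ∈ Finset.range k, μ (η i) := by
  let _ : MeasurableSpace G := ⊤
  have h_pi : stepCylinder η k = Set.pi (Finset.range k) fun i => {η i} := by
    ext ω; simp [stepCylinder, Set.mem_pi]
  rw [h_pi, stepMeasure, Measure.infinitePi_pi _ fun _ _ => MeasurableSpace.measurableSet_top]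
  exact Finset.prod_congr rfl fun i _ =>
    μ.toMeasure_apply_singleton _ MeasurableSpace.measurableSet_top

lemma stepMeasure_notMem_support (k : ℕ) : stepMeasure μ {ω | ω k ∉ μ.support} = 0 := by
  let _ : MeasurableSpace G := ⊤
  have h_pi : {ω : ℕ → G | ω k ∉ μ.support} =
      Set.pi ({k} : Finset ℕ) fun _ => (μ.support)ᶜ := by
    ext ω; simp
  rw [h_pi, stepMeasure, Measure.infinitePi_pi _ fun _ _ => MeasurableSpace.measurableSet_top,
    Finset.prod_singleton, PMF.toMeasure_apply_eq_zero_iff _ MeasurableSpace.measurableSet_top]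
  exact disjoint_compl_right

lemma stepMeasure_stepCylinder_inter_le (n : ℕ) (η : ℕ → G) (k : ℕ) (S : Set (List G)) :
    stepMeasure μ (stepCylinder η k ∩ {ω | (List.range' k n).map ω ∈ S}) ≤
      (∏ i ∈ Finset.range k, μ (η i)) * wordProb μ n S := by
  induction n generalizing η k S with
  | zero =>
    rw [← stepMeasure_stepCylinder]
    by_cases h : [] ∈ S <;> simp [wordProb, wordExp, h]
  | succ n ih =>
    have : Countable μ.support := μ.support_countable
    calc _ ≤ _ := measure_mono (stepCylinder_inter_word_mem_subset μ η k n S)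
      _ ≤ _ := measure_union_le _ _
      _ ≤ 0 + ∑' g : μ.support, _ :=
        add_le_add (stepMeasure_notMem_support k).le (measure_iUnion_le _)
      _ ≤ ∑' g : μ.support, (∏ i ∈ Finset.range k, μ (η i)) *
          (μ g * wordProb μ n {l | (g : G) :: l ∈ S}) := by
        rw [zero_add]
        refine ENNReal.tsum_le_tsum fun g => (ih _ _ _).trans (le_of_eq ?_)
        rw [Finset.prod_range_succ, Function.update_self, mul_assoc]
        congr 1
        refine Finset.prod_congr rfl fun i hi => ?_
        rw [Function.update_of_ne (Finset.mem_range.1 hi).ne]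
      _ ≤ _ := by
        rw [ENNReal.tsum_mul_left]
        gcongr
        exact ENNReal.tsum_comp_le_tsum_of_injective Subtype.val_injective
          fun g => μ g * wordProb μ n {l | g :: l ∈ S}

lemma stepMeasure_word_mem_le (n : ℕ) (S : Set (List G)) :
    stepMeasure μ {ω | (List.range' 0 n).map ω ∈ S} ≤ wordProb μ n S := by
  simpa [stepCylinder] using stepMeasure_stepCylinder_inter_le (μ := μ) n
    (fun _ => μ.support_nonempty.some) 0 S

lemma walk_eq_prod [Group G] (ω : ℕ → G) (n : ℕ) :
    walk ω n = ((List.range' 0 n).map ω).prod := by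
  rw [← List.range_eq_range']
  induction n with
  | zero => rfl
  | succ n ih => simp [walk, ih, List.range_succ]

lemma one_sub_le_walkProb [Group G] {n : ℕ} {A : Set G} {ε : ℝ} (hε : 0 ≤ ε)
    (h : wordProb μ n {l | l.prod ∉ A} ≤ ENNReal.ofReal ε) : 1 - ε ≤ walkProb μ n A := by
  let _ : MeasurableSpace G := ⊤
  have : IsProbabilityMeasure (stepMeasure μ) := by
    unfold stepMeasure; infer_instance
  have h_compl : (stepMeasure μ).real {ω | walk ω n ∉ A} ≤ ε := by
    refine ENNReal.toReal_le_of_le_ofReal hε (le_trans ?_ h)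
    simp only [walk_eq_prod]
    exact stepMeasure_word_mem_le n {l | l.prod ∉ A}
  have h_cover : (stepMeasure μ).real Set.univ ≤
      (stepMeasure μ).real {ω | walk ω n ∈ A} + (stepMeasure μ).real {ω | walk ω n ∉ A} :=
    (measureReal_mono fun ω _ => em (walk ω n ∈ A)).trans (measureReal_union_le _ _)
  rw [probReal_univ] at h_cover
  change 1 - ε ≤ (stepMeasure μ).real {ω | walk ω n ∈ A}
  linarith

end PathMeasure

section Decay

open scoped ENNReal

variable {X : Type*} [MetricSpace X] {t A : ℝ} {x y z : X}

/-- The potential `exp (-t d(y, x))`, which is small when `y` is far from `x`. -/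
noncomputable def decay (t : ℝ) (x y : X) : ℝ≥0∞ := ENNReal.ofReal (Real.exp (-t * dist y x))

lemma decay_le_exp_mul_decay (ht : 0 ≤ t) (h : dist y x ≤ dist z x + A) :
    decay t x z ≤ ENNReal.ofReal (Real.exp (t * A)) * decay t x y := by
  rw [decay, decay, ← ENNReal.ofReal_mul (Real.exp_nonneg _), ← Real.exp_add]
  refine ENNReal.ofReal_le_ofReal (Real.exp_le_exp.2 ?_)
  linarith [mul_le_mul_of_nonneg_left h ht]

lemma six_mul_exp_neg_add_two_mul_exp_le {u : ℝ} (hu : 0 ≤ u) (hu_le : u ≤ 1 / 14) :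
    6 * Real.exp (-u) + 2 * Real.exp (2 * u) ≤ 8 - u := by
  have h_neg := (abs_le.1 (Real.abs_exp_sub_one_sub_id_le (x := -u)
    (by rw [abs_neg, abs_of_nonneg hu]; linarith))).2
  have h_pos := (abs_le.1 (Real.abs_exp_sub_one_sub_id_le (x := 2 * u)
    (by rw [abs_of_nonneg] <;> linarith))).2
  nlinarith

lemma sum_le_of_card_not_le {ι : Type*} [Fintype ι] {good : ι → Prop} [DecidablePred good]
    {f : ι → ℝ} {a b : ℝ} {k : ℕ} (h_good : ∀ i, good i → f i ≤ a)
    (h_bad : ∀ i, ¬ good i → f i ≤ b) (hab : a ≤ b)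
    (h_card : (Finset.univ.filter fun i => ¬ good i).card ≤ k) :
    ∑ i, f i ≤ Fintype.card ι * a + k * (b - a) := by
  have h_term (i : ι) : f i ≤ a + if ¬ good i then b - a else 0 := by
    by_cases hi : good i
    · simpa [hi] using h_good i hi
    · simpa [hi] using h_bad i hi
  calc ∑ i, f i ≤ ∑ i, (a + if ¬ good i then b - a else 0) := Finset.sum_le_sum fun i _ => h_term i
    _ = Fintype.card ι * a + (Finset.univ.filter fun i => ¬ good i).card * (b - a) := by
      rw [Finset.sum_add_distrib, Finset.sum_const, ← Finset.sum_filter, Finset.sum_const,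
        nsmul_eq_mul, nsmul_eq_mul, Finset.card_univ]
    _ ≤ Fintype.card ι * a + k * (b - a) := by
      have : 0 ≤ b - a := sub_nonneg.2 hab
      gcongr

variable {G : Type*} [Group G] [MulAction G X] [IsIsometricSMul G X]

lemma decay_inv_smul_le (ht : 0 ≤ t) {w : G} (h : dist x (w • x) ≤ A) (y : X) :
    decay t x (w⁻¹ • y) ≤ ENNReal.ofReal (Real.exp (t * A)) * decay t x y := by
  refine decay_le_exp_mul_decay ht ?_
  rw [dist_smul_left_eq_dist_inv_smul_right, inv_inv]
  linarith [dist_triangle_right y x (w • x)]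

lemma decay_le_exp_mul_decay_inv_smul (ht : 0 ≤ t) {w : G} (h : dist x (w • x) ≤ A) (y : X) :
    decay t x y ≤ ENNReal.ofReal (Real.exp (t * A)) * decay t x (w⁻¹ • y) := by
  refine decay_le_exp_mul_decay ht ?_
  rw [dist_smul_left_eq_dist_inv_smul_right, inv_inv]
  linarith [dist_triangle y x (w • x)]

variable {δ C E : ℝ} {s : Fin 8 → G}

lemma IsSchottky.dist_add_le_dist (h_hyp : FourPointHyperbolic X δ) (h : IsSchottky x δ C E s)
    {i : Fin 8} (hy : gromovProd x y (s i • x) ≤ C + δ)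
    (hz : gromovProd x ((s i)⁻¹ • x) z ≤ C + δ) :
    dist y x + (E + dist x z) ≤ dist ((s i)⁻¹ • y) z := by
  have h_near : dist x ((s i)⁻¹ • y) = dist y (s i • x) := by
    rw [dist_comm, dist_smul_left_eq_dist_inv_smul_right, inv_inv]
  linarith [h.gromovProd_inv_smul_le h_hyp hy hz, dist_eq_sub_gromovProd x ((s i)⁻¹ • y) z,
    dist_eq_sub_gromovProd x y (s i • x), h.long i, dist_comm x y]

lemma IsSchottky.dist_le_dist_add (h : IsSchottky x δ C E s) (i : Fin 8) (y z : X) :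
    dist y x ≤ dist ((s i)⁻¹ • y) z + 2 * (E + dist x z) := by
  have h_smul : dist ((s i)⁻¹ • y) z = dist y (s i • z) := by
    rw [dist_smul_left_eq_dist_inv_smul_right, inv_inv]
  linarith [h.short i, dist_triangle4 y (s i • z) (s i • x) x, dist_smul (s i) z x,
    dist_comm z x, dist_comm (s i • x) x, dist_nonneg (x := x) (y := z)]

-- At least six of the eight Schottky elements move `y` away by `b := E + d(x, w • x)`, and the two
-- others bring it closer by at most `2 * b`.
lemma IsSchottky.sum_exp_neg_mul_dist_le (h_hyp : FourPointHyperbolic X δ)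
    (h : IsSchottky x δ C E s) (ht : 0 ≤ t) {w : G} (hw : t * (E + dist x (w • x)) ≤ 1 / 14)
    (y : X) :
    ∑ i, Real.exp (-t * dist (w⁻¹ • (s i)⁻¹ • y) x) ≤
      8 * ((1 - t / 8) * Real.exp (-t * dist y x)) := by
  classical
  set u := t * (E + dist x (w • x))
  set f := Real.exp (-t * dist y x)
  have htu : t ≤ u := le_mul_of_one_le_right ht
    (by linarith [h.one_le, dist_nonneg (x := x) (y := w • x)])
  have h_dist (i : Fin 8) : dist (w⁻¹ • (s i)⁻¹ • y) x = dist ((s i)⁻¹ • y) (w • x) := by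
    rw [dist_smul_left_eq_dist_inv_smul_right, inv_inv]
  have h_good (i : Fin 8) (hi : gromovProd x y (s i • x) ≤ C + δ ∧
      gromovProd x ((s i)⁻¹ • x) (w • x) ≤ C + δ) :
      Real.exp (-t * dist (w⁻¹ • (s i)⁻¹ • y) x) ≤ Real.exp (-u) * f := by
    rw [h_dist, ← Real.exp_add, Real.exp_le_exp]
    linarith [mul_le_mul_of_nonneg_left (h.dist_add_le_dist h_hyp hi.1 hi.2) ht]
  have h_bad (i : Fin 8) :
      Real.exp (-t * dist (w⁻¹ • (s i)⁻¹ • y) x) ≤ Real.exp (2 * u) * f := by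
    rw [h_dist, ← Real.exp_add, Real.exp_le_exp]
    linarith [mul_le_mul_of_nonneg_left (h.dist_le_dist_add i y (w • x)) ht]
  calc
    _ ≤ Fintype.card (Fin 8) * (Real.exp (-u) * f) +
        (2 : ℕ) * (Real.exp (2 * u) * f - Real.exp (-u) * f) := by
      refine sum_le_of_card_not_le h_good (fun i _ => h_bad i) ?_ (h.card_not_le h_hyp y (w • x))
      gcongr
      linarith
    _ = (6 * Real.exp (-u) + 2 * Real.exp (2 * u)) * f := by
      rw [Fintype.card_fin]; push_cast; ring
    _ ≤ (8 - u) * f := by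
      gcongr
      exact six_mul_exp_neg_add_two_mul_exp_le (ht.trans htu) hw
    _ ≤ 8 * ((1 - t / 8) * f) := by
      rw [← mul_assoc]
      exact mul_le_mul_of_nonneg_right (by linarith) (Real.exp_nonneg _)

lemma IsSchottky.sum_decay_le (h_hyp : FourPointHyperbolic X δ) (h : IsSchottky x δ C E s)
    (ht : 0 ≤ t) {w : G} (hw : t * (E + dist x (w • x)) ≤ 1 / 14) (y : X) :
    ∑ i, decay t x (w⁻¹ • (s i)⁻¹ • y) ≤ 8 * (ENNReal.ofReal (1 - t / 8) * decay t x y) := by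
  have ht_le : t ≤ 1 / 14 := le_trans (le_mul_of_one_le_right ht
    (by linarith [h.one_le, dist_nonneg (x := x) (y := w • x)])) hw
  simp only [decay]
  rw [← ENNReal.ofReal_sum_of_nonneg fun i _ => Real.exp_nonneg _,
    ← ENNReal.ofReal_mul (by linarith), ← ENNReal.ofReal_ofNat 8,
    ← ENNReal.ofReal_mul (by norm_num)]
  exact ENNReal.ofReal_le_ofReal (h.sum_exp_neg_mul_dist_le h_hyp ht hw y)

end Decay

section Splitting

open scoped ENNReal

lemma mul_sum_comp_eq_tsum {ι α : Type*} [Fintype ι] {u : ι → α} (hu : Function.Injective u)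
    (a : ℝ≥0∞) (F : α → ℝ≥0∞) :
    a * ∑ i, F (u i) = ∑' l, (Set.range u).indicator (fun _ => a) l * F l := by
  rw [← hu.tsum_eq, tsum_fintype, Finset.mul_sum]
  · simp
  · intro l hl
    by_contra h_range
    simp [h_range] at hl

variable {G : Type*} {μ : PMF G}

lemma wordExp_eq_tsum (n : ℕ) (F : List G → ℝ≥0∞) :
    wordExp μ n F = ∑' l, wordProb μ n {l} * F l := by
  have h_F : F = fun l => ∑' l', ({l'} : Set (List G)).indicator 1 l * F l' := by
    ext l
    rw [tsum_eq_single l]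
    · simp
    · intro l' hl'
      rw [Set.indicator_of_notMem (by simpa using hl'.symm), zero_mul]
  conv_lhs => rw [h_F]
  rw [wordExp_tsum]
  simp only [wordExp_mul_const, wordProb]

lemma mem_support_of_wordProb_ne_zero {n : ℕ} {l : List G} (h : wordProb μ n {l} ≠ 0) :
    l.length = n ∧ ∀ g ∈ l, g ∈ μ.support := by
  by_contra hl
  refine h (le_antisymm ((wordProb_mono (T := ∅) ?_).trans ?_) zero_le)
  · rintro l' h_length h_supp rfl
    exact hl ⟨h_length, h_supp⟩
  · simp [wordProb, wordExp_const]

lemma exists_wordExp_eq_mul_sum_add_tsum {ι : Type*} [Fintype ι] [Nonempty ι] (m : ℕ)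
    {word : ι → List G} (h_inj : Function.Injective word) (h_length : ∀ i, (word i).length = m)
    (h_supp : ∀ i, ∀ g ∈ word i, g ∈ μ.support) :
    ∃ (a : ℝ≥0∞) (r : List G → ℝ≥0∞), 0 < a ∧
      (∀ F, wordExp μ m F = a * ∑ i, F (word i) + ∑' l, r l * F l) ∧
      ∀ l, r l ≠ 0 → l.length = m ∧ ∀ g ∈ l, g ∈ μ.support := by
  set a := Finset.univ.inf' Finset.univ_nonempty fun i => wordProb μ m {word i}
  set u : List G → ℝ≥0∞ := (Set.range word).indicator fun _ => a
  have hu (l : List G) : u l ≤ wordProb μ m {l} := by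
    refine Set.indicator_apply_le' ?_ fun _ => zero_le
    rintro ⟨i, rfl⟩
    exact Finset.inf'_le _ (Finset.mem_univ i)
  refine ⟨a, fun l => wordProb μ m {l} - u l, ?_, fun F => ?_, fun l hl => ?_⟩
  · rw [Finset.lt_inf'_iff]
    intro i _
    rw [← h_length i]
    exact wordProb_singleton_pos (h_supp i)
  · rw [mul_sum_comp_eq_tsum h_inj, ← ENNReal.tsum_add, wordExp_eq_tsum]
    refine tsum_congr fun l => ?_
    rw [← add_mul, add_tsub_cancel_of_le (hu l)]
  · refine mem_support_of_wordProb_ne_zero (μ := μ) fun h => hl ?_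
    simp only [h, zero_tsub]

end Splitting

section StoppedAverage

open scoped ENNReal

variable {ι X : Type*}

/-- The expectation of `f` at the point reached from `y` by the following process: at each time,
stop with probability `α` and apply `T i` with probability `r i`; stop anyway at time `J`. -/
noncomputable def stoppedAverage (α : ℝ≥0∞) (r : ι → ℝ≥0∞) (T : ι → X → X) (f : X → ℝ≥0∞) :
    ℕ → X → ℝ≥0∞
  | 0, y => f y
  | J + 1, y => α * f y + ∑' i, r i * stoppedAverage α r T f J (T i y)

variable {α q : ℝ≥0∞} {r : ι → ℝ≥0∞} {T : ι → X → X} {f : X → ℝ≥0∞}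

lemma stoppedAverage_le (h_mass : α + ∑' i, r i = 1) (hq : 1 ≤ q)
    (hf : ∀ i, r i ≠ 0 → ∀ y, f (T i y) ≤ q * f y) (J : ℕ) (y : X) :
    stoppedAverage α r T f J y ≤ q ^ J * f y := by
  induction J generalizing y with
  | zero => simp [stoppedAverage]
  | succ J ih =>
    have h_term (i : ι) : r i * stoppedAverage α r T f J (T i y) ≤ r i * (q ^ (J + 1) * f y) := by
      by_cases hi : r i = 0
      · simp [hi]
      · rw [pow_succ, mul_assoc]
        gcongr
        exact (ih _).trans (by gcongr; exact hf i hi y)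
    calc stoppedAverage α r T f (J + 1) y
        ≤ α * (q ^ (J + 1) * f y) + ∑' i, r i * (q ^ (J + 1) * f y) := by
          refine add_le_add ?_ (ENNReal.tsum_le_tsum h_term)
          gcongr
          exact le_mul_of_one_le_left zero_le (one_le_pow₀ hq)
      _ = q ^ (J + 1) * f y := by rw [ENNReal.tsum_mul_right, ← add_mul, h_mass, one_mul]

lemma le_stoppedAverage (h_mass : α + ∑' i, r i = 1) (hq : 1 ≤ q)
    (hf : ∀ i, r i ≠ 0 → ∀ y, f y ≤ q * f (T i y)) (J : ℕ) (y : X) :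
    f y ≤ q ^ J * stoppedAverage α r T f J y := by
  induction J generalizing y with
  | zero => simp [stoppedAverage]
  | succ J ih =>
    have h_term (i : ι) :
        r i * f y ≤ q ^ (J + 1) * (r i * stoppedAverage α r T f J (T i y)) := by
      by_cases hi : r i = 0
      · simp [hi]
      · rw [mul_left_comm, pow_succ', mul_assoc]
        gcongr
        exact (hf i hi y).trans (by gcongr; exact ih _)
    calc f y = α * f y + ∑' i, r i * f y := by
          rw [ENNReal.tsum_mul_right, ← add_mul, h_mass, one_mul]
      _ ≤ q ^ (J + 1) * (α * f y) +
          ∑' i, q ^ (J + 1) * (r i * stoppedAverage α r T f J (T i y)) :=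
        add_le_add (le_mul_of_one_le_left zero_le (one_le_pow₀ hq)) (ENNReal.tsum_le_tsum h_term)
      _ = q ^ (J + 1) * stoppedAverage α r T f (J + 1) y := by
        rw [ENNReal.tsum_mul_left, ← mul_add, stoppedAverage]

lemma stoppedAverage_succ_le (h_mass : α + ∑' i, r i = 1) (hq : 1 ≤ q)
    (hf : ∀ i, r i ≠ 0 → ∀ y, f (T i y) ≤ q * f y) (J : ℕ) (y : X) :
    stoppedAverage α r T f (J + 1) y ≤
      stoppedAverage α r T f J y + (∑' i, r i) ^ J * (q ^ J * (q - 1)) * f y := by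
  induction J generalizing y with
  | zero =>
    calc stoppedAverage α r T f 1 y ≤ (1 + (q - 1)) * f y := by
          simpa [add_tsub_cancel_of_le hq] using stoppedAverage_le h_mass hq hf 1 y
      _ = _ := by simp [stoppedAverage, add_mul]
  | succ J ih =>
    set ρ := ∑' i, r i
    have h_term (i : ι) : r i * stoppedAverage α r T f (J + 1) (T i y) ≤
        r i * stoppedAverage α r T f J (T i y) +
          r i * (ρ ^ J * (q ^ (J + 1) * (q - 1)) * f y) := by
      by_cases hi : r i = 0
      · simp [hi]
      · rw [← mul_add]
        gcongr
        refine (ih _).trans (add_le_add le_rfl ?_)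
        calc ρ ^ J * (q ^ J * (q - 1)) * f (T i y)
            ≤ ρ ^ J * (q ^ J * (q - 1)) * (q * f y) := by gcongr; exact hf i hi y
          _ = _ := by ring
    have h_sum := ENNReal.tsum_le_tsum h_term
    rw [ENNReal.tsum_add, ENNReal.tsum_mul_right] at h_sum
    calc stoppedAverage α r T f (J + 1 + 1) y
        = α * f y + ∑' i, r i * stoppedAverage α r T f (J + 1) (T i y) := rfl
      _ ≤ α * f y + (∑' i, r i * stoppedAverage α r T f J (T i y) +
            ρ * (ρ ^ J * (q ^ (J + 1) * (q - 1)) * f y)) := by gcongr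
      _ = _ := by
        rw [← add_assoc, pow_succ' ρ]
        simp only [stoppedAverage, mul_assoc]

end StoppedAverage

section Contraction

open scoped ENNReal

lemma exp_sub_one_le_two_mul {v : ℝ} (hv : 0 ≤ v) (hv_le : v ≤ 1) : Real.exp v - 1 ≤ 2 * v := by
  have := (abs_le.1 (Real.abs_exp_sub_one_sub_id_le (x := v) (by rwa [abs_of_nonneg hv]))).2
  nlinarith

-- First `J` is chosen such that `ρ ^ J` is small compared with `α / Λ`, then `t` such that the
-- exponentials are bounded.
lemma exists_rate_and_length {α ρ Λ E : ℝ} (hα : 0 < α) (hρ : 0 ≤ ρ) (h_mass : α + ρ = 1)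
    (hΛ : 0 < Λ) (hE : 1 ≤ E) :
    ∃ (t : ℝ) (J : ℕ), 0 < t ∧ t * (E + J * Λ) ≤ 1 / 14 ∧ Real.exp (t * Λ) ^ J ≤ 3 ∧
      ρ ^ J * (Real.exp (t * Λ) ^ J * (Real.exp (t * Λ) - 1)) ≤ α * t / 16 := by
  obtain ⟨J, hJ⟩ := exists_pow_lt_of_lt_one (show 0 < α / (96 * Λ) by positivity)
    (show ρ < 1 by linarith)
  rw [lt_div_iff₀ (by positivity)] at hJ
  have hJΛ : 0 ≤ J * Λ := by positivity
  set t := 1 / (14 * (E + J * Λ + Λ)) with ht_def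
  have ht : 0 < t := by positivity
  have ht_mul : t * (E + J * Λ + Λ) = 1 / 14 := by rw [ht_def]; field_simp
  have ht_le {a : ℝ} (ha : a ≤ E + J * Λ + Λ) : t * a ≤ 1 / 14 := by
    rw [← ht_mul]; gcongr
  have h_pow : Real.exp (t * Λ) ^ J ≤ 3 := by
    have h_exp := exp_sub_one_le_two_mul (v := t * (J * Λ)) (by positivity)
      (by linarith [ht_le (a := J * Λ) (by linarith)])
    rw [← Real.exp_nat_mul, mul_left_comm]
    linarith [ht_le (a := J * Λ) (by linarith)]
  have h_exp : Real.exp (t * Λ) - 1 ≤ 2 * (t * Λ) := exp_sub_one_le_two_mul (by positivity)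
    (by linarith [ht_le (a := Λ) (by linarith)])
  refine ⟨t, J, ht, ht_le (by linarith), h_pow, ?_⟩
  calc ρ ^ J * (Real.exp (t * Λ) ^ J * (Real.exp (t * Λ) - 1))
      ≤ ρ ^ J * (3 * (2 * (t * Λ))) := by
        gcongr
        linarith [Real.one_le_exp (show 0 ≤ t * Λ by positivity)]
    _ = ρ ^ J * (96 * Λ) * t / 16 := by ring
    _ ≤ α * t / 16 := by gcongr

lemma le_ofReal_one_sub_mul_of_add_le {p f g : ℝ≥0∞} {α β ε η : ℝ} (hf : f ≠ ⊤)
    (hgf : g ≤ 3 * f) (hα : 0 ≤ α) (hβ : 0 ≤ β) (hε : 0 ≤ ε) (hη : 0 ≤ η) (hη_le : η ≤ 1)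
    (h_gain : 3 * η ≤ α * (1 - β) - ε)
    (h : p + ENNReal.ofReal α * f ≤
      ENNReal.ofReal α * (ENNReal.ofReal β * f) + (g + ENNReal.ofReal ε * f)) :
    p ≤ ENNReal.ofReal (1 - η) * g := by
  have hg : g ≠ ⊤ := ne_top_of_le_ne_top (ENNReal.mul_ne_top (by simp) hf) hgf
  have hp : p ≠ ⊤ := ne_top_of_le_ne_top
    (by simp [ENNReal.mul_eq_top, hf, hg]) (le_self_add.trans h)
  lift f to ℝ≥0 using hf
  lift g to ℝ≥0 using hg
  lift p to ℝ≥0 using hp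
  lift α to ℝ≥0 using hα
  lift β to ℝ≥0 using hβ
  lift ε to ℝ≥0 using hε
  simp only [ENNReal.ofReal_coe_nnreal] at h
  have h_real : (p : ℝ) + α * f ≤ α * (β * f) + (g + ε * f) := by exact_mod_cast h
  have hgf_real : (g : ℝ) ≤ 3 * f := by exact_mod_cast hgf
  rw [← ENNReal.ofReal_coe_nnreal, ← ENNReal.ofReal_coe_nnreal (p := g),
    ← ENNReal.ofReal_mul (by linarith)]
  refine ENNReal.ofReal_le_ofReal ?_
  linarith [mul_le_mul_of_nonneg_right h_gain f.coe_nonneg, mul_le_mul_of_nonneg_left hgf_real hη]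

variable {G : Type*} [Group G] {X : Type*} [MetricSpace X] [MulAction G X] {μ : PMF G}
  {δ C E t Λ : ℝ} {x : X}

lemma IsSchottky.injective {s : Fin 8 → G} (h_hyp : FourPointHyperbolic X δ)
    (h : IsSchottky x δ C E s) : Function.Injective s := by
  intro i j hij
  by_contra h_ne
  have h_sep := h.sep i j h_ne
  rw [hij, gromovProd_self] at h_sep
  linarith [h.long j, h.one_le, h.nonneg, h_hyp.nonneg x]

variable [IsIsometricSMul G X]

-- The law of `w * u`, where `u` runs through the remainder steps, satisfies the same bounds as `w`,
-- which is why an arbitrary isometry `w` is allowed to follow the Schottky element.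
lemma IsSchottky.sum_stoppedAverage_le (h_hyp : FourPointHyperbolic X δ) {s : Fin 8 → G}
    (h : IsSchottky x δ C E s) (ht : 0 ≤ t) {α : ℝ≥0∞} {r : List G → ℝ≥0∞}
    (h_mass : α + ∑' l, r l = 1) (hΛ : 0 ≤ Λ) (hr : ∀ l, r l ≠ 0 → dist x (l.prod • x) ≤ Λ)
    (J : ℕ) {w : G} (hw : t * (E + dist x (w • x) + J * Λ) ≤ 1 / 14) (y : X) :
    ∑ i, stoppedAverage α r (fun l z => l.prod⁻¹ • z) (decay t x) J (w⁻¹ • (s i)⁻¹ • y) ≤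
      8 * (ENNReal.ofReal (1 - t / 8) * decay t x y) := by
  induction J generalizing w with
  | zero => exact h.sum_decay_le h_hyp ht (by simpa using hw) y
  | succ J ih =>
    set avg := stoppedAverage α r (fun (l : List G) z => l.prod⁻¹ • z) (decay t x)
    set B := 8 * (ENNReal.ofReal (1 - t / 8) * decay t x y)
    push_cast at hw
    have hJΛ : 0 ≤ J * Λ := by positivity
    have h_decay : ∑ i, decay t x (w⁻¹ • (s i)⁻¹ • y) ≤ B :=
      h.sum_decay_le h_hyp ht ((mul_le_mul_of_nonneg_left (by linarith) ht).trans hw) y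
    have h_term (l : List G) : r l * ∑ i, avg J (l.prod⁻¹ • w⁻¹ • (s i)⁻¹ • y) ≤ r l * B := by
      by_cases hl : r l = 0
      · simp [hl]
      · gcongr
        simpa only [mul_inv_rev, mul_smul] using ih (w := w * l.prod)
          ((mul_le_mul_of_nonneg_left
            (by linarith [dist_mul_smul_le x w l.prod, hr l hl]) ht).trans hw)
    calc ∑ i, avg (J + 1) (w⁻¹ • (s i)⁻¹ • y)
        = α * ∑ i, decay t x (w⁻¹ • (s i)⁻¹ • y) +
          ∑' l, r l * ∑ i, avg J (l.prod⁻¹ • w⁻¹ • (s i)⁻¹ • y) := by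
          simp only [avg, stoppedAverage, Finset.sum_add_distrib, Finset.mul_sum]
          rw [Summable.tsum_finsetSum fun _ _ => ENNReal.summable]
      _ ≤ α * B + ∑' l, r l * B := by
          refine add_le_add ?_ (ENNReal.tsum_le_tsum h_term)
          gcongr
      _ = B := by rw [ENNReal.tsum_mul_right, ← add_mul, h_mass, one_mul]

-- `stoppedAverage (J + 1)` is the expectation of `stoppedAverage J` after one block, except that
-- the Schottky elements have been replaced by the identity.
lemma IsSchottky.wordExp_stoppedAverage_le (h_hyp : FourPointHyperbolic X δ) {m : ℕ}
    {word : Fin 8 → List G} (h : IsSchottky x δ C E fun i => (word i).prod) (ht : 0 ≤ t)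
    {a : ℝ≥0∞} {r : List G → ℝ≥0∞}
    (h_split : ∀ F, wordExp μ m F = a * ∑ i, F (word i) + ∑' l, r l * F l)
    (h_mass : a * 8 + ∑' l, r l = 1) (hΛ : 0 ≤ Λ)
    (hr : ∀ l, r l ≠ 0 → dist x (l.prod • x) ≤ Λ) {J : ℕ} (htJ : t * (E + J * Λ) ≤ 1 / 14)
    {q : ℝ≥0∞} (hq : q = ENNReal.ofReal (Real.exp (t * Λ))) (y : X) :
    let avg := stoppedAverage (a * 8) r (fun l z => l.prod⁻¹ • z) (decay t x)
    wordExp μ m (fun l => avg J (l.prod⁻¹ • y)) + a * 8 * decay t x y ≤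
      a * 8 * (ENNReal.ofReal (1 - t / 8) * decay t x y) +
        (avg J y + (∑' l, r l) ^ J * (q ^ J * (q - 1)) * decay t x y) := by
  intro avg
  have hq_one : 1 ≤ q := by
    rw [hq, ENNReal.one_le_ofReal]
    exact Real.one_le_exp (by positivity)
  have h_succ := stoppedAverage_succ_le (T := fun (l : List G) z => l.prod⁻¹ • z) h_mass hq_one
    (fun l hl => hq ▸ decay_inv_smul_le ht (hr l hl)) J y
  have h_sum := h.sum_stoppedAverage_le h_hyp ht h_mass hΛ hr J (w := 1) (by simpa using htJ) y
  simp only [inv_one, one_smul] at h_sum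
  calc _ = a * ∑ i, avg J ((word i).prod⁻¹ • y) + avg (J + 1) y := by
        rw [h_split, add_assoc, add_comm (∑' l, _)]
        rfl
    _ ≤ a * (8 * (ENNReal.ofReal (1 - t / 8) * decay t x y)) +
        (avg J y + (∑' l, r l) ^ J * (q ^ J * (q - 1)) * decay t x y) :=
      add_le_add (mul_le_mul_right h_sum a) h_succ
    _ = _ := by rw [mul_assoc a 8]

lemma stoppedAverage_decay_bounds {α : ℝ≥0∞} {r : List G → ℝ≥0∞} (h_mass : α + ∑' l, r l = 1)
    (hr : ∀ l, r l ≠ 0 → dist x (l.prod • x) ≤ Λ) (hΛ : 0 ≤ Λ) (ht : 0 ≤ t) {J : ℕ}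
    (h_pow : Real.exp (t * Λ) ^ J ≤ 3) (y : X) :
    let avg := stoppedAverage α r (fun l z => l.prod⁻¹ • z) (decay t x)
    avg J y ≤ 3 * decay t x y ∧ decay t x y ≤ 3 * avg J y := by
  intro avg
  have hq_one : 1 ≤ ENNReal.ofReal (Real.exp (t * Λ)) :=
    ENNReal.one_le_ofReal.2 (Real.one_le_exp (by positivity))
  have hq_pow : ENNReal.ofReal (Real.exp (t * Λ)) ^ J ≤ 3 := by
    rw [← ENNReal.ofReal_pow (by positivity)]
    exact ENNReal.ofReal_le_of_le_toReal (by simpa using h_pow)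
  constructor
  · exact (stoppedAverage_le h_mass hq_one
      (fun l hl => decay_inv_smul_le ht (hr l hl)) J y).trans (by gcongr)
  · exact (le_stoppedAverage h_mass hq_one
      (fun l hl => decay_le_exp_mul_decay_inv_smul ht (hr l hl)) J y).trans (by gcongr)

lemma IsSchottky.wordExp_stoppedAverage_le_mul (h_hyp : FourPointHyperbolic X δ) {m : ℕ}
    {word : Fin 8 → List G} (h : IsSchottky x δ C E fun i => (word i).prod) (ht : 0 < t)
    {a : ℝ≥0∞} {r : List G → ℝ≥0∞}
    (h_split : ∀ F, wordExp μ m F = a * ∑ i, F (word i) + ∑' l, r l * F l)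
    {α ρ : ℝ≥0} (hα : a * 8 = α) (hρ : ∑' l, r l = ρ) (h_mass : α + ρ = 1) (hΛ : 0 ≤ Λ)
    (hr : ∀ l, r l ≠ 0 → dist x (l.prod • x) ≤ Λ) {J : ℕ} (htJ : t * (E + J * Λ) ≤ 1 / 14)
    (h_pow : Real.exp (t * Λ) ^ J ≤ 3)
    (h_gain : ρ ^ J * (Real.exp (t * Λ) ^ J * (Real.exp (t * Λ) - 1)) ≤ α * t / 16) (y : X) :
    let avg := stoppedAverage (a * 8) r (fun l z => l.prod⁻¹ • z) (decay t x)
    wordExp μ m (fun l => avg J (l.prod⁻¹ • y)) ≤ ENNReal.ofReal (1 - α * t / 48) * avg J y := by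
  intro avg
  have h_mass_ennreal : a * 8 + ∑' l, r l = 1 := by rw [hα, hρ]; exact_mod_cast h_mass
  have ht_lt : t < 1 := by nlinarith [h.one_le, show 0 ≤ t * (J * Λ) by positivity]
  have hα_le : (α : ℝ) ≤ 1 := by exact_mod_cast h_mass ▸ le_self_add
  set e := Real.exp (t * Λ)
  have he_one : 0 ≤ e - 1 := sub_nonneg.2 (Real.one_le_exp (by positivity))
  have h_error : (∑' l, r l) ^ J * (ENNReal.ofReal e ^ J * (ENNReal.ofReal e - 1)) =
      ENNReal.ofReal (ρ ^ J * (e ^ J * (e - 1))) := by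
    rw [hρ, ENNReal.ofReal_mul (by positivity), ENNReal.ofReal_mul (by positivity),
      ENNReal.ofReal_sub _ zero_le_one, ENNReal.ofReal_pow (by positivity),
      ENNReal.ofReal_pow (by positivity), ENNReal.ofReal_one, ENNReal.ofReal_coe_nnreal]
  refine le_ofReal_one_sub_mul_of_add_le (f := decay t x y) (β := 1 - t / 8)
    (ε := ρ ^ J * (e ^ J * (e - 1))) ENNReal.ofReal_ne_top
    (stoppedAverage_decay_bounds h_mass_ennreal hr hΛ ht.le h_pow y).1 α.coe_nonneg (by linarith)
    (by positivity) (by positivity) (by nlinarith [hα_le, ht_lt]) (by linarith) ?_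
  rw [← h_error, ENNReal.ofReal_coe_nnreal, ← hα]
  exact h.wordExp_stoppedAverage_le h_hyp ht.le h_split h_mass_ennreal hΛ hr htJ rfl y

lemma IsSchottky.exists_contracted (h_hyp : FourPointHyperbolic X δ) {m : ℕ} {L : ℝ}
    {word : Fin 8 → List G} (hm : 0 < m) (h_length : ∀ i, (word i).length = m)
    (h_supp : ∀ i, ∀ g ∈ word i, g ∈ μ.support)
    (h : IsSchottky x δ C E fun i => (word i).prod) (hL : 0 < L)
    (hμ : ∀ g ∈ μ.support, dist x (g • x) ≤ L) :
    ∃ (t κ : ℝ) (φ : X → ℝ≥0∞), 0 < t ∧ 0 < κ ∧ κ < 1 ∧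
      (∀ y, φ y ≤ 3 * decay t x y ∧ decay t x y ≤ 3 * φ y) ∧
      ∀ y, wordExp μ m (fun l => φ (l.prod⁻¹ • y)) ≤ ENNReal.ofReal κ * φ y := by
  have h_inj : Function.Injective word := (h.injective h_hyp).of_comp (f := List.prod)
  obtain ⟨a, r, ha, h_split, hr⟩ := exists_wordExp_eq_mul_sum_add_tsum m h_inj h_length h_supp
  have h_mass : a * 8 + ∑' l, r l = 1 := by simpa [wordExp_const] using (h_split fun _ => 1).symm
  have hr_dist (l : List G) (hl : r l ≠ 0) : dist x (l.prod • x) ≤ L * m := by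
    obtain ⟨rfl, hl_supp⟩ := hr l hl
    exact dist_list_prod_smul_le fun g hg => hμ g (hl_supp g hg)
  obtain ⟨α, hα⟩ : ∃ α : ℝ≥0, a * 8 = α := ⟨_, (ENNReal.coe_toNNReal
    (ne_top_of_le_ne_top ENNReal.one_ne_top (h_mass ▸ le_self_add))).symm⟩
  obtain ⟨ρ, hρ⟩ : ∃ ρ : ℝ≥0, ∑' l, r l = ρ := ⟨_, (ENNReal.coe_toNNReal
    (ne_top_of_le_ne_top ENNReal.one_ne_top (h_mass ▸ le_add_self))).symm⟩
  have h_mass_nnreal : α + ρ = 1 := by rw [hα, hρ] at h_mass; exact_mod_cast h_mass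
  have hα_pos : 0 < α := by
    have : 0 < a * 8 := ENNReal.mul_pos ha.ne' (by simp)
    rwa [hα, ENNReal.coe_pos] at this
  have hΛ : 0 < L * m := by positivity
  obtain ⟨t, J, ht, htJ, h_pow, h_gain⟩ := exists_rate_and_length (NNReal.coe_pos.2 hα_pos)
    ρ.coe_nonneg (by exact_mod_cast h_mass_nnreal) hΛ h.one_le
  have hα_le : (α : ℝ) ≤ 1 := by exact_mod_cast h_mass_nnreal ▸ le_self_add
  have ht_lt : t < 1 := by nlinarith [h.one_le, show 0 ≤ t * (J * (L * m)) by positivity]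
  exact ⟨t, 1 - α * t / 48, _, ht, by nlinarith [hα_le, ht_lt],
    sub_lt_self _ (by positivity),
    stoppedAverage_decay_bounds h_mass hr_dist hΛ.le ht.le h_pow,
    h.wordExp_stoppedAverage_le_mul h_hyp ht h_split hα hρ h_mass_nnreal hΛ.le hr_dist htJ
      h_pow h_gain⟩

end Contraction

section Drift

open scoped ENNReal

lemma pow_div_le_inv_mul_pow {c : ℝ} (hc : 0 < c) (hc_le : c ≤ 1) {m : ℕ} (hm : 0 < m) (n : ℕ) :
    (c ^ m) ^ (n / m) ≤ (c ^ m)⁻¹ * c ^ n := by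
  rw [inv_mul_eq_div, le_div_iff₀ (by positivity), ← pow_mul, ← pow_add]
  exact pow_le_pow_of_le_one hc.le hc_le
    ((Nat.lt_mul_div_succ n hm).le.trans_eq (Nat.mul_succ m (n / m)))

variable {G : Type*} [Group G] {X : Type*} [MulAction G X] {μ : PMF G}

lemma wordExp_mul_le {m : ℕ} {κ : ℝ≥0∞} {φ : X → ℝ≥0∞}
    (h : ∀ y, wordExp μ m (fun l => φ (l.prod⁻¹ • y)) ≤ κ * φ y) (k : ℕ) (y : X) :
    wordExp μ (m * k) (fun l => φ (l.prod⁻¹ • y)) ≤ κ ^ k * φ y := by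
  induction k generalizing y with
  | zero => simp [wordExp]
  | succ k ih =>
    rw [Nat.mul_succ, add_comm, wordExp_append]
    calc _ ≤ wordExp μ m (fun l => κ ^ k * φ (l.prod⁻¹ • y)) := by
          refine wordExp_mono fun l _ _ => ?_
          simpa only [List.prod_append, mul_inv_rev, mul_smul] using ih (l.prod⁻¹ • y)
      _ ≤ κ ^ k * (κ * φ y) := by
          rw [wordExp_const_mul]
          gcongr
          exact h y
      _ = _ := by rw [pow_succ, mul_assoc]

variable [MetricSpace X] [IsIsometricSMul G X] {δ t L : ℝ} {x : X}

lemma wordExp_decay_le (hμ : ∀ g ∈ μ.support, dist x (g • x) ≤ L) (ht : 0 ≤ t) (k : ℕ) (y : X) :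
    wordExp μ k (fun l => decay t x (l.prod⁻¹ • y)) ≤
      ENNReal.ofReal (Real.exp (t * (L * k))) * decay t x y := by
  rw [← wordExp_const (μ := μ) k (_ * decay t x y)]
  refine wordExp_mono fun l hl h_supp => decay_inv_smul_le ht ?_ y
  exact (dist_list_prod_smul_le fun g hg => hμ g (h_supp g hg)).trans_eq (by rw [hl])

lemma wordExp_decay_le_of_contracted (hμ : ∀ g ∈ μ.support, dist x (g • x) ≤ L) (ht : 0 ≤ t)
    {m : ℕ} {κ : ℝ≥0∞} {φ : X → ℝ≥0∞}
    (hφ : ∀ y, φ y ≤ 3 * decay t x y ∧ decay t x y ≤ 3 * φ y)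
    (h_contract : ∀ y, wordExp μ m (fun l => φ (l.prod⁻¹ • y)) ≤ κ * φ y) (k r : ℕ) (y : X) :
    wordExp μ (m * k + r) (fun l => decay t x (l.prod⁻¹ • y)) ≤
      9 * ENNReal.ofReal (Real.exp (t * (L * r))) * κ ^ k * decay t x y := by
  set M := ENNReal.ofReal (Real.exp (t * (L * r)))
  calc wordExp μ (m * k + r) (fun l => decay t x (l.prod⁻¹ • y))
      = wordExp μ (m * k) (fun l => wordExp μ r
          fun l' => decay t x (l'.prod⁻¹ • l.prod⁻¹ • y)) := by
        rw [wordExp_append]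
        simp only [List.prod_append, mul_inv_rev, mul_smul]
    _ ≤ wordExp μ (m * k) (fun l => M * 3 * φ (l.prod⁻¹ • y)) := by
        refine wordExp_mono fun l _ _ => (wordExp_decay_le hμ ht r _).trans ?_
        rw [mul_assoc]
        gcongr
        exact (hφ _).2
    _ ≤ M * 3 * (κ ^ k * (3 * decay t x y)) := by
        rw [wordExp_const_mul]
        gcongr
        exact (wordExp_mul_le h_contract k y).trans (by gcongr; exact (hφ y).1)
    _ = 9 * M * κ ^ k * decay t x y := by ring

lemma IsNonElementary.exists_wordExp_decay_le (h_hyp : FourPointHyperbolic X δ)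
    (h : IsNonElementary X μ) (x : X) (hL : 0 < L)
    (hμ : ∀ g ∈ μ.support, dist x (g • x) ≤ L) :
    ∃ t B c : ℝ, 0 < t ∧ 0 < B ∧ 0 < c ∧ c < 1 ∧ ∀ (n : ℕ) (y : X),
      wordExp μ n (fun l => decay t x (l.prod⁻¹ • y)) ≤
        ENNReal.ofReal (B * c ^ n) * decay t x y := by
  obtain ⟨m, C, E, word, hm, h_length, h_supp, h_schottky⟩ := h.exists_isSchottky h_hyp x
  obtain ⟨t, κ, φ, ht, hκ, hκ_lt, hφ, h_contract⟩ :=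
    h_schottky.exists_contracted h_hyp hm h_length h_supp hL hμ
  obtain ⟨c, hc, rfl⟩ : ∃ c, 0 < c ∧ c ^ m = κ :=
    ⟨κ ^ (m : ℝ)⁻¹, by positivity, Real.rpow_inv_natCast_pow hκ.le hm.ne'⟩
  have hc_lt : c < 1 := (pow_lt_one_iff_of_nonneg hc.le hm.ne').1 hκ_lt
  set M := Real.exp (t * (L * m))
  have h_rest (n : ℕ) : Real.exp (t * (L * (n % m : ℕ))) ≤ M :=
    Real.exp_le_exp.2 (by gcongr; exact (Nat.mod_lt n hm).le)
  refine ⟨t, 9 * M * (c ^ m)⁻¹, c, ht, by positivity, hc, hc_lt, fun n y => ?_⟩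
  calc wordExp μ n (fun l => decay t x (l.prod⁻¹ • y))
      ≤ 9 * ENNReal.ofReal (Real.exp (t * (L * (n % m : ℕ)))) *
          ENNReal.ofReal (c ^ m) ^ (n / m) * decay t x y := by
        conv_lhs => rw [← Nat.div_add_mod n m]
        exact wordExp_decay_le_of_contracted hμ ht.le hφ h_contract (n / m) (n % m) y
    _ ≤ 9 * ENNReal.ofReal M * ENNReal.ofReal (c ^ m) ^ (n / m) * decay t x y := by
        gcongr
        exact h_rest n
    _ = ENNReal.ofReal (9 * M * (c ^ m) ^ (n / m)) * decay t x y := by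
        rw [ENNReal.ofReal_mul (by positivity), ENNReal.ofReal_mul (by positivity),
          ENNReal.ofReal_pow hκ.le, ENNReal.ofReal_ofNat]
    _ ≤ ENNReal.ofReal (9 * M * (c ^ m)⁻¹ * c ^ n) * decay t x y := by
        rw [mul_assoc _ _ (c ^ n)]
        gcongr
        exact pow_div_le_inv_mul_pow hc hc_lt.le hm n

end Drift

section LinearDrift

open scoped ENNReal

variable {G : Type*} [Group G] {X : Type*} [MetricSpace X] [MulAction G X] {δ κ A L t B q : ℝ}
  {μ : PMF G} {x : X}

/-- The walk moves away from every point at speed at least `κ`, up to exponentially small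
probability. -/
structure LinearDrift (μ : PMF G) (x : X) (κ t B q : ℝ) : Prop where
  speed_pos : 0 < κ
  rate_pos : 0 < t
  const_pos : 0 < B
  base_pos : 0 < q
  base_lt_one : q < 1
  bound : ∀ (n : ℕ) (y : X) (A : ℝ),
    wordProb μ n {l | dist y (l.prod • x) < dist y x + κ * n - A} ≤
      ENNReal.ofReal (B * q ^ n * Real.exp (-(t * A)))

/-- The path with steps `l` moves away linearly from `z`. -/
def Diverges (κ A : ℝ) (x z : X) (l : List G) : Prop :=
  ∀ i ≤ l.length, dist z x + κ * i - A ≤ dist z ((l.take i).prod • x)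

variable [IsIsometricSMul G X]

lemma wordProb_dist_lt_le (ht : 0 ≤ t) (n : ℕ) (y : X) (R : ℝ) :
    wordProb μ n {l | dist y (l.prod • x) < R} ≤
      ENNReal.ofReal (Real.exp (t * R)) * wordExp μ n (fun l => decay t x (l.prod⁻¹ • y)) := by
  rw [← wordExp_const_mul]
  refine wordExp_mono fun l _ _ => Set.indicator_apply_le' (fun hl => ?_) fun _ => zero_le
  rw [Set.mem_ofPred_eq] at hl
  rw [decay, ← ENNReal.ofReal_mul (by positivity), ← Real.exp_add,
    dist_smul_left_eq_dist_inv_smul_right, inv_inv, Pi.one_apply, ENNReal.one_le_ofReal]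
  exact Real.one_le_exp (by linarith [mul_le_mul_of_nonneg_left hl.le ht])

-- The speed is half of the one at which the exponential moment stops decaying.
lemma exists_linearDrift (h_hyp : FourPointHyperbolic X δ) (h_nonelem : IsNonElementary X μ) (x : X)
    (hL : 0 < L) (hμ : ∀ g ∈ μ.support, dist x (g • x) ≤ L) :
    ∃ κ t B q : ℝ, LinearDrift μ x κ t B q := by
  obtain ⟨t, B, c, ht, hB, hc, hc_lt, h_drift⟩ := h_nonelem.exists_wordExp_decay_le h_hyp x hL hμ
  have h_log : Real.log c < 0 := Real.log_neg hc hc_lt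
  set κ := -Real.log c / (2 * t) with hκ
  have htκ : t * κ = -Real.log c / 2 := by rw [hκ]; field_simp
  have hq : Real.exp (-(t * κ)) < 1 := Real.exp_lt_one_iff.2 (by linarith)
  have hc_exp : c = Real.exp (-(t * κ)) * Real.exp (-(t * κ)) := by
    rw [← Real.exp_add, htκ, ← Real.exp_log hc]
    simp only [Real.log_exp]
    ring_nf
  refine ⟨κ, t, B, _, div_pos (by linarith) (by positivity), ht, hB, by positivity, hq,
    fun n y A => ?_⟩
  refine (wordProb_dist_lt_le ht.le n y _).trans ?_
  calc ENNReal.ofReal (Real.exp (t * (dist y x + κ * n - A))) *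
        wordExp μ n (fun l => decay t x (l.prod⁻¹ • y))
      ≤ ENNReal.ofReal (Real.exp (t * (dist y x + κ * n - A))) *
          (ENNReal.ofReal (B * c ^ n) * decay t x y) := by
        gcongr
        exact h_drift n y
    _ = ENNReal.ofReal (B * Real.exp (-(t * κ)) ^ n * Real.exp (-(t * A))) := by
        rw [decay, ← ENNReal.ofReal_mul (by positivity), ← ENNReal.ofReal_mul (by positivity)]
        congr 1
        rw [hc_exp, ← Real.exp_add, ← Real.exp_nat_mul, ← Real.exp_nat_mul, mul_left_comm,
          mul_assoc B, ← Real.exp_add, ← Real.exp_add, mul_assoc B, ← Real.exp_add]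
        ring_nf

lemma Diverges.gromovProd_le (hX : IsGromovSpace X δ) {s : ℕ} (hL : 0 ≤ L) (hκ : 0 ≤ κ)
    (hs : 2 * δ ≤ κ * s) (hs_pos : 0 < s) {z : X} {l : List G} (hl : ∀ g ∈ l, dist x (g • x) ≤ L)
    (h : Diverges κ A x z l) : gromovProd x z (l.prod • x) ≤ A + L * s + 2 * δ := by
  have h_step (i : ℕ) (hi : i < l.length) :
      dist ((l.take i).prod • x) ((l.take (i + 1)).prod • x) ≤ L := by
    rw [List.prod_take_succ l i hi, mul_smul, dist_smul]
    exact hl _ (List.getElem_mem hi)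
  simpa using hX.gromovProd_le_of_diverges (v := fun i => (l.take i).prod • x) (n := l.length)
    (z := z) hL hκ hs hs_pos h_step (fun i hi => by simpa using h i hi)

lemma dist_prod_take_smul_le {l : List G} (hL : 0 ≤ L) (hl : ∀ g ∈ l, dist x (g • x) ≤ L)
    (i : ℕ) : dist x ((l.take i).prod • x) ≤ L * i := by
  refine (dist_list_prod_smul_le fun g hg => hl g (List.mem_of_mem_take hg)).trans ?_
  gcongr
  simp

-- In the first `j` steps divergence cannot fail, since the path is `L`-Lipschitz.
lemma exists_dist_prod_take_lt_of_not_diverges {l : List G} {y : X} {j : ℕ} (hL : 0 ≤ L)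
    (hκ : 0 ≤ κ) (hl : ∀ g ∈ l, dist x (g • x) ≤ L) (h : ¬ Diverges κ ((L + κ) * j) x y l) :
    ∃ i ∈ Finset.Ico j (l.length + 1), dist y ((l.take i).prod • x) < dist y x + κ * i := by
  simp only [Diverges, not_forall, not_le] at h
  obtain ⟨i, hi, h_lt⟩ := h
  have hji : j ≤ i := by
    by_contra! hij
    have h_take := dist_prod_take_smul_le hL hl i
    have h_triangle := dist_triangle_right y x ((l.take i).prod • x)
    have : (L + κ) * i ≤ (L + κ) * j := by gcongr
    linarith
  refine ⟨i, Finset.mem_Ico.2 ⟨hji, by omega⟩, ?_⟩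
  have : 0 ≤ (L + κ) * j := by positivity
  linarith

lemma LinearDrift.wordProb_not_diverges_le (h_drift : LinearDrift μ x κ t B q) (hL : 0 ≤ L)
    (hμ : ∀ g ∈ μ.support, dist x (g • x) ≤ L) (n j : ℕ) (y : X) :
    wordProb μ n {l | ¬ Diverges κ ((L + κ) * j) x y l} ≤
      ENNReal.ofReal (B / (1 - q) * q ^ j) := by
  have hq := h_drift.base_pos
  have hB := h_drift.const_pos
  calc wordProb μ n {l | ¬ Diverges κ ((L + κ) * j) x y l}
      ≤ wordProb μ n (⋃ i ∈ Finset.Ico j (n + 1),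
          {l | l.take i ∈ {l | dist y (l.prod • x) < dist y x + κ * i}}) := by
        refine wordProb_mono fun l hl h_supp h_not => ?_
        obtain ⟨i, hi, h_lt⟩ := exists_dist_prod_take_lt_of_not_diverges hL h_drift.speed_pos.le
          (fun g hg => hμ g (h_supp g hg)) h_not
        exact Set.mem_biUnion (hl ▸ hi) h_lt
    _ ≤ ∑ i ∈ Finset.Ico j (n + 1), ENNReal.ofReal (B * q ^ i) := by
        refine (wordProb_biUnion_le _ _ _).trans (Finset.sum_le_sum fun i hi => ?_)
        rw [wordProb_take (Nat.lt_succ_iff.1 (Finset.mem_Ico.1 hi).2)]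
        simpa using h_drift.bound i y 0
    _ = ENNReal.ofReal (B * ∑ i ∈ Finset.Ico j (n + 1), q ^ i) := by
        rw [Finset.mul_sum, ENNReal.ofReal_sum_of_nonneg fun i _ => by positivity]
    _ ≤ ENNReal.ofReal (B / (1 - q) * q ^ j) := by
        rw [div_mul_eq_mul_div, mul_div_assoc]
        gcongr
        exact geom_sum_Ico_le_of_lt_one hq.le h_drift.base_lt_one

end LinearDrift

section Matching

open scoped ENNReal

lemma exists_lt_one_le_and_le_pow {a b : ℝ} (ha_lt : a < 1) (hb : 0 ≤ b)
    (hb_lt : b < 1) {m : ℕ} (hm : 0 < m) : ∃ ρ, ρ < 1 ∧ a ≤ ρ ∧ b ≤ ρ ^ m := by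
  refine ⟨max a (b ^ (m : ℝ)⁻¹), max_lt ha_lt (Real.rpow_lt_one hb hb_lt (by positivity)),
    le_max_left _ _, ?_⟩
  calc b = (b ^ (m : ℝ)⁻¹) ^ m := (Real.rpow_inv_natCast_pow hb hm.ne').symm
    _ ≤ _ := by gcongr; exact le_max_right _ _

variable {G : Type*} {μ : PMF G}

lemma wordProb_take_mem_drop_mem_le {i k : ℕ} {S : Set (List G)} {T : List G → Set (List G)}
    {c : ℝ≥0∞} (hT : ∀ u, wordProb μ k (T u) ≤ c) :
    wordProb μ (i + k) {l | l.take i ∈ S ∧ l.drop i ∈ T (l.take i)} ≤ wordProb μ i S * c := by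
  rw [wordProb_append, wordProb, ← wordExp_mul_const]
  refine wordExp_mono fun u hu _ => ?_
  by_cases h_mem : u ∈ S
  · simpa [← hu, h_mem] using hT u
  · simp [← hu, h_mem, wordProb, wordExp_const]

-- If the prescribed word `w` is read, which happens with probability at least `p`, then the chance
-- of `S` is halved.
lemma wordProb_append_le_of_halved {m n : ℕ} {w : List G} {S : Set (List G)} {p c : ℝ}
    (hc : 0 ≤ c) (hp : ENNReal.ofReal p ≤ wordProb μ m {w})
    (h_word : wordProb μ n {l | w ++ l ∈ S} ≤ ENNReal.ofReal (c / 2))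
    (h_any : ∀ u : List G, u.length = m → wordProb μ n {l | u ++ l ∈ S} ≤ ENNReal.ofReal c) :
    wordProb μ (m + n) S ≤ ENNReal.ofReal ((1 - p / 2) * c) := by
  have h_add := wordProb_add_compl (μ := μ) m {w}
  have h_split : wordProb μ (m + n) S ≤ wordProb μ m {w} * ENNReal.ofReal (c / 2) +
      wordProb μ m {w}ᶜ * ENNReal.ofReal c := by
    rw [wordProb_append, wordProb, wordProb, ← wordExp_mul_const, ← wordExp_mul_const,
      ← wordExp_add]
    refine wordExp_mono fun u hu _ => ?_
    by_cases h_eq : u = w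
    · subst h_eq
      simpa using h_word
    · simpa [h_eq] using h_any u hu
  have hP_top : wordProb μ m {w} ≠ ⊤ := ne_top_of_le_ne_top ENNReal.one_ne_top (wordProb_le_one _ _)
  have hQ_top : wordProb μ m {w}ᶜ ≠ ⊤ :=
    ne_top_of_le_ne_top ENNReal.one_ne_top (wordProb_le_one _ _)
  lift wordProb μ m {w} to ℝ≥0 using hP_top with P
  lift wordProb μ m {w}ᶜ to ℝ≥0 using hQ_top with Q
  have h_add_real : (P : ℝ) + Q = 1 := by exact_mod_cast h_add
  have hp_real : p ≤ P := by simpa using hp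
  refine h_split.trans ?_
  rw [← ENNReal.ofReal_coe_nnreal, ← ENNReal.ofReal_coe_nnreal (p := Q),
    ← ENNReal.ofReal_mul P.coe_nonneg, ← ENNReal.ofReal_mul Q.coe_nonneg,
    ← ENNReal.ofReal_add (by positivity) (by positivity)]
  exact ENNReal.ofReal_le_ofReal (by linear_combination h_add_real * c + hp_real * (c / 2))

variable [Group G] {X : Type*} [MetricSpace X] [MulAction G X] {x y : X} {W : X → List G}
  {κ t A B D q ρ : ℝ}

/-- Some time before `j`, the walk `l` follows the word prescribed by `W` for the position of `y`
seen from the current location, and moves away linearly from `y` afterwards. -/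
def Matches (W : X → List G) (κ A : ℝ) (x : X) (j : ℕ) (y : X) (l : List G) : Prop :=
  ∃ l₁ l₃ : List G, l = l₁ ++ (W (l₁.prod⁻¹ • y) ++ l₃) ∧ l₁.length < j ∧
    Diverges κ A x ((W (l₁.prod⁻¹ • y)).prod⁻¹ • l₁.prod⁻¹ • y) l₃

lemma Matches.append_left {j : ℕ} {u v : List G}
    (h : Matches W κ A x (j - u.length) (u.prod⁻¹ • y) v) : Matches W κ A x j y (u ++ v) := by
  obtain ⟨l₁, l₃, rfl, h_length, h_div⟩ := h
  have h_smul : (u ++ l₁).prod⁻¹ • y = l₁.prod⁻¹ • u.prod⁻¹ • y := by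
    rw [List.prod_append, mul_inv_rev, mul_smul]
  refine ⟨u ++ l₁, l₃, ?_, by rw [List.length_append]; omega, ?_⟩
  · rw [h_smul, List.append_assoc]
  · rwa [h_smul]

lemma exists_not_matches_drop {j : ℕ} {l : List G} (hj : 0 < j)
    (h : ¬ Matches W κ A x j y (W y ++ l)) : ∃ i ≤ l.length,
      dist ((W y).prod⁻¹ • y) ((l.take i).prod • x) < dist ((W y).prod⁻¹ • y) x + κ * i - A ∧
      ¬ Matches W κ A x (j - (W y).length - i) ((l.take i).prod⁻¹ • (W y).prod⁻¹ • y)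
        (l.drop i) := by
  have h_not_div : ¬ Diverges κ A x ((W y).prod⁻¹ • y) l :=
    fun h_div => h ⟨[], l, by simp, by simpa using hj, by simpa using h_div⟩
  simp only [Diverges, not_forall, not_le] at h_not_div
  obtain ⟨i, hi, h_lt⟩ := h_not_div
  refine ⟨i, hi, h_lt, fun h_drop => h (Matches.append_left ?_)⟩
  rw [← List.take_append_drop i l]
  refine Matches.append_left ?_
  rwa [List.length_take, min_eq_left hi]

lemma LinearDrift.wordProb_lt_and_not_matches_le (h_drift : LinearDrift μ x κ t B q)
    (hD : 0 ≤ D) (hqρ : √q ≤ ρ) (hρ : ρ ≤ 1) {i j k : ℕ} {z : X}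
    (h_not_matches : ∀ w,
      wordProb μ k {l | ¬ Matches W κ A x (j - i) w l} ≤ ENNReal.ofReal (D * ρ ^ (j - i))) :
    wordProb μ (i + k) {l | dist z ((l.take i).prod • x) < dist z x + κ * i - A ∧
        ¬ Matches W κ A x (j - i) ((l.take i).prod⁻¹ • z) (l.drop i)} ≤
      ENNReal.ofReal (D * ρ ^ j * (B * Real.exp (-(t * A))) * √q ^ i) := by
  have hq := h_drift.base_pos
  have hB := h_drift.const_pos
  have hρ_nonneg : 0 ≤ ρ := (Real.sqrt_nonneg q).trans hqρ
  have hq_pow : q ^ i ≤ √q ^ i * ρ ^ i := by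
    rw [← mul_pow]
    nth_rewrite 1 [← Real.mul_self_sqrt hq.le]
    gcongr
  have hρ_pow : ρ ^ i * ρ ^ (j - i) ≤ ρ ^ j := by
    rw [← pow_add]
    exact pow_le_pow_of_le_one hρ_nonneg hρ (by omega)
  refine (wordProb_take_mem_drop_mem_le
    (T := fun u => {v | ¬ Matches W κ A x (j - i) (u.prod⁻¹ • z) v})
    fun u => h_not_matches _).trans ((mul_le_mul_left (h_drift.bound i z A) _).trans ?_)
  rw [← ENNReal.ofReal_mul (by positivity)]
  refine ENNReal.ofReal_le_ofReal ?_
  calc B * q ^ i * Real.exp (-(t * A)) * (D * ρ ^ (j - i))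
      ≤ B * (√q ^ i * ρ ^ i) * Real.exp (-(t * A)) * (D * ρ ^ (j - i)) := by gcongr
    _ = D * (ρ ^ i * ρ ^ (j - i)) * (B * Real.exp (-(t * A))) * √q ^ i := by ring
    _ ≤ D * ρ ^ j * (B * Real.exp (-(t * A))) * √q ^ i := by gcongr

-- After the word `W y` the only obstruction is a failure of divergence at some time `i`, and then
-- the walk starts afresh.
lemma LinearDrift.wordProb_not_matches_append_le (h_drift : LinearDrift μ x κ t B q)
    (hA : B * Real.exp (-(t * A)) / (1 - √q) ≤ 1 / 2) (hD : 0 ≤ D) (hqρ : √q ≤ ρ) (hρ : ρ ≤ 1)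
    {n j : ℕ} (hj : 0 < j) (hjn : j ≤ (W y).length + n)
    (ih : ∀ k ≤ n, ∀ i ≤ k, ∀ z,
      wordProb μ k {l | ¬ Matches W κ A x i z l} ≤ ENNReal.ofReal (D * ρ ^ i)) :
    wordProb μ n {l | ¬ Matches W κ A x j y (W y ++ l)} ≤
      ENNReal.ofReal (D * ρ ^ (j - (W y).length) / 2) := by
  have hB := h_drift.const_pos
  have hρ_nonneg : 0 ≤ ρ := (Real.sqrt_nonneg q).trans hqρ
  have h_sqrt : √q < 1 := (Real.sqrt_lt' one_pos).2 (by simpa using h_drift.base_lt_one)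
  set z := (W y).prod⁻¹ • y
  set m := (W y).length
  set c := D * ρ ^ (j - m)
  calc wordProb μ n {l | ¬ Matches W κ A x j y (W y ++ l)}
      ≤ wordProb μ n (⋃ i ∈ Finset.Ico 0 (n + 1),
          {l | dist z ((l.take i).prod • x) < dist z x + κ * i - A ∧
            ¬ Matches W κ A x (j - m - i) ((l.take i).prod⁻¹ • z) (l.drop i)}) := by
        refine wordProb_mono fun l hl _ h_not => ?_
        obtain ⟨i, hi, h_fail⟩ := exists_not_matches_drop hj h_not
        exact Set.mem_biUnion (Finset.mem_Ico.2 ⟨i.zero_le, by omega⟩) h_fail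
    _ ≤ ∑ i ∈ Finset.Ico 0 (n + 1), ENNReal.ofReal (c * (B * Real.exp (-(t * A))) * √q ^ i) := by
        refine (wordProb_biUnion_le _ _ _).trans (Finset.sum_le_sum fun i hi => ?_)
        obtain ⟨k, rfl⟩ := Nat.exists_eq_add_of_le (Nat.lt_succ_iff.1 (Finset.mem_Ico.1 hi).2)
        exact h_drift.wordProb_lt_and_not_matches_le hD hqρ hρ
          (ih k (by omega) (j - m - i) (by omega))
    _ = ENNReal.ofReal (c * (B * Real.exp (-(t * A))) * ∑ i ∈ Finset.Ico 0 (n + 1), √q ^ i) := by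
        rw [Finset.mul_sum, ENNReal.ofReal_sum_of_nonneg fun i _ => by positivity]
    _ ≤ ENNReal.ofReal (c * (B * Real.exp (-(t * A))) * (√q ^ 0 / (1 - √q))) := by
        gcongr
        exact geom_sum_Ico_le_of_lt_one (Real.sqrt_nonneg q) h_sqrt
    _ = ENNReal.ofReal (c * (B * Real.exp (-(t * A)) / (1 - √q))) := by rw [pow_zero]; ring_nf
    _ ≤ ENNReal.ofReal (c * (1 / 2)) := by gcongr
    _ = ENNReal.ofReal (c / 2) := by ring_nf

lemma LinearDrift.exists_wordProb_not_matches_le (h_drift : LinearDrift μ x κ t B q) {m : ℕ}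
    (hm : 0 < m) (hW : ∀ z, (W z).length = m) {p : ℝ} (hp : 0 < p)
    (h_word : ∀ z, ENNReal.ofReal p ≤ wordProb μ m {W z})
    (hA : B * Real.exp (-(t * A)) / (1 - √q) ≤ 1 / 2) :
    ∃ D ρ : ℝ, 0 < D ∧ 0 < ρ ∧ ρ < 1 ∧ ∀ (n j : ℕ) (y : X), j ≤ n →
      wordProb μ n {l | ¬ Matches W κ A x j y l} ≤ ENNReal.ofReal (D * ρ ^ j) := by
  have h_sqrt_pos : 0 < √q := Real.sqrt_pos.2 h_drift.base_pos
  have h_sqrt : √q < 1 := (Real.sqrt_lt' one_pos).2 (by simpa using h_drift.base_lt_one)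
  have hp_le : p ≤ 1 := ENNReal.ofReal_le_one.1 ((h_word x).trans (wordProb_le_one _ _))
  obtain ⟨ρ, hρ_lt, hqρ, hpρ⟩ := exists_lt_one_le_and_le_pow h_sqrt
    (show 0 ≤ 1 - p / 2 by linarith) (by linarith) hm
  have hρ : 0 < ρ := h_sqrt_pos.trans_le hqρ
  refine ⟨(ρ ^ m)⁻¹, ρ, by positivity, hρ, hρ_lt, fun n => ?_⟩
  induction n using Nat.strong_induction_on with
  | _ n ih =>
    intro j y hjn
    rcases le_or_gt j m with hjm | hjm
    · refine (wordProb_le_one _ _).trans ?_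
      rw [ENNReal.one_le_ofReal, inv_mul_eq_div, one_le_div (by positivity)]
      exact pow_le_pow_of_le_one hρ.le hρ_lt.le hjm
    obtain ⟨n, rfl⟩ := Nat.exists_eq_add_of_le (hjm.le.trans hjn)
    have h_any (u : List G) (hu : u.length = m) :
        wordProb μ n {l | u ++ l ∈ {l | ¬ Matches W κ A x j y l}} ≤
          ENNReal.ofReal ((ρ ^ m)⁻¹ * ρ ^ (j - m)) := by
      subst hu
      refine (wordProb_mono fun l _ _ h_not => ?_).trans
        (ih n (by omega) (j - u.length) (u.prod⁻¹ • y) (by omega))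
      exact fun h_match => h_not (Matches.append_left h_match)
    have h_spec := h_drift.wordProb_not_matches_append_le (y := y) (W := W) hA
      (show 0 ≤ (ρ ^ m)⁻¹ by positivity) hqρ hρ_lt.le (n := n) (j := j) (by omega) (by rwa [hW])
      (fun k hk i hi z => ih k (by omega) i z hi)
    rw [hW] at h_spec
    refine (wordProb_append_le_of_halved (by positivity) (h_word y) h_spec h_any).trans
      (ENNReal.ofReal_le_ofReal ?_)
    calc (1 - p / 2) * ((ρ ^ m)⁻¹ * ρ ^ (j - m)) ≤ ρ ^ m * ((ρ ^ m)⁻¹ * ρ ^ (j - m)) := by gcongr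
      _ = (ρ ^ m)⁻¹ * ρ ^ j := by
        rw [mul_left_comm, ← pow_add, Nat.add_sub_cancel' hjm.le]

end Matching

section QuasiAxes

variable {X : Type*} [MetricSpace X] {δ : ℝ}

lemma FourPointHyperbolic.gromovProd_le_of_long (h_hyp : FourPointHyperbolic X δ) {z a b e : X}
    {c₀ c₂ : ℝ} (h_left : gromovProd a z b ≤ c₂) (h_right : gromovProd b z e ≤ c₀)
    (h_long : c₀ + c₂ + 2 * δ < dist a b) : gromovProd a z e ≤ c₂ + δ := by
  have hδ := h_hyp.nonneg z
  have h_swap_z := gromovProd_add_gromovProd_swap b a z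
  rw [dist_comm, gromovProd_comm a b z] at h_swap_z
  have h_right_a : gromovProd b e a ≤ c₀ + δ := by
    refine h_hyp.gromovProd_le_of_lt (b := z) (by rwa [gromovProd_comm]) ?_
    rw [gromovProd_comm]
    linarith
  have h_swap_e := gromovProd_add_gromovProd_swap a b e
  rw [gromovProd_comm b a e] at h_swap_e
  exact h_hyp.gromovProd_le_of_lt h_left (by linarith)

lemma FourPointHyperbolic.gromovProd_le_of_near (h_hyp : FourPointHyperbolic X δ) {o a b a' b' : X}
    {c r : ℝ} (h : gromovProd o a b ≤ c) (ha : dist a a' ≤ r) (hb : dist b b' ≤ r)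
    (hoa : r + c + 2 * δ < dist o a) (hob : r + c + 2 * δ < dist o b) :
    gromovProd o a' b' ≤ c + 2 * δ := by
  have hδ := h_hyp.nonneg o
  have h_right : gromovProd o a b' ≤ c + δ :=
    h_hyp.gromovProd_le_of_lt h (by linarith [dist_sub_dist_le_gromovProd o b b'])
  rw [gromovProd_comm] at h_right ⊢
  linarith [h_hyp.gromovProd_le_of_lt h_right (c := a')
    (by linarith [dist_sub_dist_le_gromovProd o a a'])]

lemma IsQuasigeodesicOn.dist_bounds {K s t : ℝ} {γ : ℝ → X}
    (hγ : IsQuasigeodesicOn 1 K Set.univ γ) (hst : s ≤ t) :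
    t - s - K ≤ dist (γ s) (γ t) ∧ dist (γ s) (γ t) ≤ t - s + K := by
  have h_bounds := hγ s trivial t trivial
  rwa [abs_sub_comm, abs_of_nonneg (by linarith), inv_one, one_mul] at h_bounds

-- The point of the quasigeodesic at distance about `(x | γ t)_{γ s}` from `γ s` is near `x`.
lemma FourPointHyperbolic.exists_dist_quasigeodesic_le (h_hyp : FourPointHyperbolic X δ) {K : ℝ}
    {γ : ℝ → X} (hγ : IsQuasigeodesicOn 1 K Set.univ γ) (x : X) (s t : ℝ) :
    ∃ r, dist x (γ r) ≤ gromovProd x (γ s) (γ t) + 5 * K + 2 * δ := by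
  wlog hst : s ≤ t generalizing s t
  · rw [gromovProd_comm]
    exact this t s (le_of_not_ge hst)
  set e := gromovProd (γ s) x (γ t)
  obtain ⟨h_lower_st, h_upper_st⟩ := hγ.dist_bounds hst
  have he_nonneg : 0 ≤ e := gromovProd_nonneg _ _ _
  have he_le : e ≤ t - s + K := (gromovProd_le_right _ _ _).trans h_upper_st
  have hK : 0 ≤ K := by simpa using (hγ.dist_bounds (le_refl s)).2
  set ρ := min e (t - s)
  have hρ_nonneg : 0 ≤ ρ := le_min he_nonneg (by linarith)
  have hρ_le : ρ ≤ e := min_le_left _ _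
  have hρ_le_sub : ρ ≤ t - s := min_le_right _ _
  have hρ_ge : e - K ≤ ρ := le_min (by linarith) (by linarith)
  obtain ⟨h_lower_sρ, h_upper_sρ⟩ := hγ.dist_bounds (show s ≤ s + ρ by linarith)
  have h_upper_ρt := (hγ.dist_bounds (show s + ρ ≤ t by linarith)).2
  have h_prod_end : ρ - 3 / 2 * K ≤ gromovProd (γ s) (γ t) (γ (s + ρ)) := by
    rw [gromovProd_comm]
    simp only [gromovProd]
    linarith
  have h_prod_x : ρ - 3 / 2 * K - δ ≤ gromovProd (γ s) x (γ (s + ρ)) :=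
    (sub_le_sub_right (le_min (by linarith) h_prod_end) δ).trans (h_hyp (γ s) x (γ t) (γ (s + ρ)))
  have h_swap := gromovProd_add_gromovProd_swap x (γ s) (γ t)
  rw [dist_comm x (γ s)] at h_swap
  exact ⟨s + ρ, by linarith [hK, dist_eq_sub_gromovProd (γ s) x (γ (s + ρ))]⟩

variable {G : Type*} [Group G] [MulAction G X]

lemma IsQuasiAxis.pow_smul_mem {K : ℝ} {w : G} {α : Set X} (h : IsQuasiAxis K w α) {p : X}
    (hp : p ∈ α) (i : ℕ) : w ^ i • p ∈ α ∧ w⁻¹ ^ i • p ∈ α := by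
  have h_smul : ∀ q ∈ α, w • q ∈ α := fun q hq => h.2 ▸ ⟨q, hq, rfl⟩
  have h_inv_smul : ∀ q ∈ α, w⁻¹ • q ∈ α := by
    intro q hq
    rw [← h.2] at hq
    obtain ⟨q', hq', rfl⟩ := hq
    simpa using hq'
  induction i with
  | zero => simpa using hp
  | succ i ih =>
    rw [pow_succ', pow_succ', mul_smul, mul_smul]
    exact ⟨h_smul _ ih.1, h_inv_smul _ ih.2⟩

variable [IsIsometricSMul G X] {x : X}

-- The orbit of `p` diverges from `x` in both directions, so high powers of `w` carry `p` to points
-- of the axis whose Gromov product at `x` is small.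
lemma dist_closestPoint_le (h_hyp : FourPointHyperbolic X δ) {w : G} {R K : ℝ} (hR : 0 ≤ R)
    (h_trans : gromovProd x (w⁻¹ • x) (w • x) ≤ R) (h_long : 2 * R + 3 * δ < dist x (w • x))
    {α : Set X} {p : X} (hα : IsQuasiAxis K w α) (hp : IsClosestPoint x α p) :
    dist x p ≤ R + 6 * δ + 5 * K := by
  have hδ := h_hyp.nonneg x
  obtain ⟨i, hi⟩ : ∃ i : ℕ, dist x p + R + 4 * δ < dist x (w ^ i • x) := by
    obtain ⟨i, hi⟩ := exists_nat_gt
      ((dist x p + R + 4 * δ) / (dist x (w • x) - 2 * R - 2 * δ))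
    rw [div_lt_iff₀ (by linarith)] at hi
    exact ⟨i, by linarith [mul_le_dist_pow_smul h_hyp hR (by linarith) h_trans le_rfl i]⟩
  have h_orbit_p : gromovProd x (w⁻¹ ^ i • p) (w ^ i • p) ≤ R + 2 * δ + 2 * δ := by
    refine h_hyp.gromovProd_le_of_near (gromovProd_pow_le h_hyp hR h_long h_trans le_rfl i i)
      (dist_smul _ _ _).le (dist_smul _ _ _).le ?_ (by linarith)
    rw [inv_pow, dist_inv_smul_self]
    linarith
  obtain ⟨h_mem, h_inv_mem⟩ := hα.pow_smul_mem hp.1 i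
  obtain ⟨⟨γ, hγ, rfl⟩, -⟩ := hα
  obtain ⟨t, ht⟩ := h_mem
  obtain ⟨s, hs⟩ := h_inv_mem
  obtain ⟨r, hr⟩ := h_hyp.exists_dist_quasigeodesic_le hγ x s t
  rw [hs, ht] at hr
  linarith [hp.2 (γ r) ⟨r, rfl⟩]

lemma encard_jointStab_le (h_hyp : FourPointHyperbolic X δ) {p q : X} {u f : G} {K c : ℝ}
    (h_left : gromovProd (u • x) p q ≤ c) (h_right : gromovProd (u • f • x) p q ≤ c) :
    (jointStab G K p q).encard ≤ (jointStab G (7 * K + 2 * c + 2 * δ) x (f • x)).encard := by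
  refine Set.encard_le_encard_of_injOn (f := fun g => u⁻¹ * g * u) ?_ ?_
  · rintro g ⟨hp, hq⟩
    have h_conj : ∀ o : X, gromovProd (u • o) p q ≤ c →
        dist o ((u⁻¹ * g * u) • o) ≤ 7 * K + 2 * c + 2 * δ := by
      intro o ho
      have h_dist := h_hyp.dist_smul_le hp hq ho
      rwa [dist_smul_left_eq_dist_inv_smul_right, ← mul_smul, ← mul_smul] at h_dist
    exact ⟨h_conj _ h_left, h_conj _ h_right⟩
  · intro a _ b _ hab
    simpa using hab

lemma IsWPD.exists_finite_jointStab (h_hyp : FourPointHyperbolic X δ) {h : G} (hw : IsWPD X h)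
    (x : X) {K : ℝ} (hK : 0 ≤ K) :
    ∃ M₀ : ℕ, ∀ M ≥ M₀, (jointStab G K x (h ^ M • x)).Finite := by
  have hδ := h_hyp.nonneg x
  obtain ⟨C, hC⟩ := hw.1.exists_gromovProd_pow_le h_hyp x
  have hC_nonneg : 0 ≤ C := (gromovProd_nonneg _ _ _).trans (hC 0 0)
  obtain ⟨M₀, -, h_finite⟩ := hw.2 (7 * K + 2 * C + 2 * δ) (by positivity) x
  refine ⟨M₀, fun M hM => h_finite.subset ?_⟩
  rintro g ⟨h_start, h_end⟩
  refine ⟨by linarith, h_hyp.dist_smul_le h_start h_end ?_⟩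
  have h_sub : h⁻¹ ^ M₀ * h ^ M = h ^ (M - M₀) := by
    rw [inv_pow, inv_mul_eq_iff_eq_mul, ← pow_add, Nat.add_sub_cancel' hM]
  rw [gromovProd_smul_base, ← inv_pow, ← mul_smul, h_sub]
  exact hC _ _

end QuasiAxes

section DeepMatches

variable {G : Type*} [Group G] {X : Type*} [MetricSpace X] [MulAction G X]
  {δ κ A C L Y K₁ e : ℝ} {x y : X} {m : ℕ} {F : List G} {W : X → List G}

variable (G) in
/-- Paths with steps of length at most `L` which move away from `z` with speed `κ` and error `A`
have Gromov product at most `A + e` with `z`. -/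
def HasDivergenceConst (x : X) (L κ e : ℝ) : Prop :=
  ∀ (A : ℝ) (z : X) (l : List G), (∀ g ∈ l, dist x (g • x) ≤ L) → Diverges κ A x z l →
    gromovProd x z (l.prod • x) ≤ A + e

lemma HasDivergenceConst.nonneg (h : HasDivergenceConst G x L κ e) : 0 ≤ e := by
  simpa [gromovProd_self] using h 0 x [] (by simp) (by simp [Diverges])

/-- A rule which prescribes, for each position `z` of the origin of the walk, a word of length `m`
ending with the long word `F`, such that the path along this word makes no backtracking before the
translate of `F`. -/
structure IsMatchRule (x : X) (δ C : ℝ) (F : List G) (m : ℕ) (W : X → List G) : Prop where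
  length_eq : ∀ z, (W z).length = m
  exists_eq_append : ∀ z, ∃ v, W z = v ++ F ∧
    gromovProd x (v.prod⁻¹ • z) (F.prod • x) ≤ C
  lt_dist : 2 * C + 2 * δ < dist x (F.prod • x)

lemma IsMatchRule.nonneg (h : IsMatchRule x δ C F m W) : 0 ≤ C := by
  obtain ⟨v, -, h_back⟩ := h.exists_eq_append x
  exact (gromovProd_nonneg _ _ _).trans h_back

/-- `o` is far from `p` and from `q` and close to a geodesic between these points. -/
def IsDeepPoint (c R : ℝ) (p q o : X) : Prop :=
  gromovProd o p q ≤ c ∧ R < dist o p ∧ R < dist o q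

/-- `w` is loxodromic with quasi-axes near `x`, and the middle part of the geodesic from `x` to
`w • x` passes near a translate of the pair `(x, f • x)`. -/
def HasDeepMatch (x : X) (δ c K₁ : ℝ) (f w : G) : Prop :=
  ∃ (r : ℝ) (u : G), gromovProd x (w⁻¹ • x) (w • x) ≤ r ∧ 2 * r + 3 * δ < dist x (w • x) ∧
    IsDeepPoint c (r + 8 * δ + 5 * K₁ + c) x (w • x) (u • x) ∧
    IsDeepPoint c (r + 8 * δ + 5 * K₁ + c) x (w • x) (u • f • x)

/-- The properties of a walk which hold outside a set of exponentially small probability: it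
diverges linearly from both its past and its future, cut at the time `a`, and contains a match soon
after this time. -/
structure IsTypical (W : X → List G) (κ A Y : ℝ) (x : X) (a : ℕ) (l : List G) : Prop where
  matches_drop : Matches W κ A x a ((l.take a).prod⁻¹ • x) (l.drop a)
  diverges : Diverges κ Y x x l
  diverges_take : Diverges κ Y x ((l.drop a).prod⁻¹ • x) (l.take a)
  diverges_drop : Diverges κ Y x ((l.take a).prod⁻¹ • x) (l.drop a)
  le_dist_drop : ∀ i, i + a ≤ l.length → κ * a ≤ dist x ((l.drop i).prod • x)

lemma prod_take_mul_prod_drop (l : List G) (i : ℕ) :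
    (l.take i).prod * (l.drop i).prod = l.prod := by
  rw [← List.prod_append, List.take_append_drop]

lemma Diverges.le_dist_prod_take {l : List G} (h : Diverges κ Y x x l) (hκ : 0 ≤ κ) {a i : ℕ}
    (ha : a ≤ i) (hi : i ≤ l.length) : κ * a - Y ≤ dist x ((l.take i).prod • x) := by
  have h_dist := h i hi
  rw [dist_self] at h_dist
  linarith [mul_le_mul_of_nonneg_left (show (a : ℝ) ≤ i by exact_mod_cast ha) hκ]

variable [IsIsometricSMul G X]

lemma IsGromovSpace.exists_hasDivergenceConst (hX : IsGromovSpace X δ) (hL : 0 ≤ L) (hκ : 0 < κ)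
    (x : X) : ∃ e, HasDivergenceConst G x L κ e := by
  obtain ⟨s, hs⟩ := exists_nat_gt (2 * δ / κ)
  rw [div_lt_iff₀ hκ] at hs
  refine ⟨L * (s + 1 : ℕ) + 2 * δ, fun A z l hl h => ?_⟩
  have hs_succ : 2 * δ ≤ κ * (s + 1 : ℕ) := by
    push_cast
    linarith
  linarith [h.gromovProd_le hX hL hκ.le hs_succ s.succ_pos hl]

lemma Matches.exists_gromovProd_le (h_hyp : FourPointHyperbolic X δ)
    (h_const : HasDivergenceConst G x L κ e) (hW : IsMatchRule x δ C F m W) (hAC : A + e ≤ C)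
    {j : ℕ} {l : List G} (hl : ∀ g ∈ l, dist x (g • x) ≤ L) (h : Matches W κ A x j y l) :
    ∃ k k' : ℕ, k ≤ k' ∧ k' ≤ j + m ∧
      (l.take k').prod = (l.take k).prod * F.prod ∧
      gromovProd ((l.take k).prod • x) y (l.prod • x) ≤ C + δ ∧
      gromovProd ((l.take k').prod • x) y (l.prod • x) ≤ C + δ := by
  obtain ⟨l₁, l₃, rfl, h_length, h_div⟩ := h
  set z := l₁.prod⁻¹ • y with hz
  have h_length_W := hW.length_eq z
  obtain ⟨v, hv, h_back⟩ := hW.exists_eq_append z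
  rw [hv] at h_div h_length_W hl ⊢
  have h_eq : l₁ ++ (v ++ F ++ l₃) = l₁ ++ v ++ (F ++ l₃) := by simp only [List.append_assoc]
  have h_eq' : l₁ ++ (v ++ F ++ l₃) = l₁ ++ v ++ F ++ l₃ := by simp only [List.append_assoc]
  have h_take : (l₁ ++ (v ++ F ++ l₃)).take (l₁ ++ v).length = l₁ ++ v := by
    rw [h_eq, List.take_left]
  have h_take' : (l₁ ++ (v ++ F ++ l₃)).take (l₁ ++ v ++ F).length = l₁ ++ v ++ F := by
    rw [h_eq', List.take_left]
  set u := (l₁ ++ v).prod with hu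
  have h_prod : (l₁ ++ v ++ F).prod = u * F.prod := List.prod_append
  have h_left : gromovProd (u • x) y (u • F.prod • x) ≤ C := by
    rwa [gromovProd_smul_base, inv_smul_smul, hu, List.prod_append, mul_inv_rev, mul_smul]
  have h_right :
      gromovProd (u • F.prod • x) y ((l₁ ++ (v ++ F ++ l₃)).prod • x) ≤ C := by
    have h_future := h_const A _ l₃ (fun g hg => hl g (by simp [hg])) h_div
    refine le_trans (le_of_eq ?_) (h_future.trans hAC)
    rw [← mul_smul, gromovProd_smul_base, hz]
    simp only [hu, List.prod_append, mul_inv_rev, mul_smul, inv_smul_smul]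
  refine ⟨(l₁ ++ v).length, (l₁ ++ v ++ F).length, ?_, ?_, ?_, ?_, ?_⟩
  · simp
  · simp only [List.length_append] at h_length_W ⊢
    omega
  · rw [h_take, h_take', h_prod]
  · rw [h_take]
    refine h_hyp.gromovProd_le_of_long h_left h_right ?_
    rw [dist_smul]
    linarith [hW.lt_dist]
  · rw [h_take', h_prod, mul_smul]
    linarith [h_hyp.nonneg x]

-- `w = u * v` moves `x` along `u • x`, and its inverse moves `x` along `v⁻¹ • x`.
lemma FourPointHyperbolic.gromovProd_inv_mul_smul_le (h_hyp : FourPointHyperbolic X δ) {u v : G}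
    {r d : ℝ} (hu : d ≤ dist x (u • x)) (hv : d ≤ dist x (v • x))
    (h_ends : gromovProd x (v⁻¹ • x) (u • x) ≤ r) (h_cut : gromovProd x (u⁻¹ • x) (v • x) ≤ r)
    (hd : 2 * r + 2 * δ < d) : gromovProd x ((u * v)⁻¹ • x) ((u * v) • x) ≤ r + 2 * δ := by
  have hδ := h_hyp.nonneg x
  have h_forward :
      gromovProd x (u • x) ((u * v) • x) + gromovProd x (u⁻¹ • x) (v • x) =
        dist x (u • x) := by
    rw [← gromovProd_add_gromovProd_swap x (u • x), gromovProd_smul_base u, mul_smul,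
      inv_smul_smul]
  have h_backward :
      gromovProd x (v⁻¹ • x) ((u * v)⁻¹ • x) + gromovProd x (u⁻¹ • x) (v • x) =
        dist x (v • x) := by
    rw [← dist_inv_smul_self v, ← gromovProd_add_gromovProd_swap x (v⁻¹ • x),
      gromovProd_smul_base v⁻¹, inv_inv, mul_inv_rev, mul_smul, smul_inv_smul,
      gromovProd_comm x (v • x)]
  have h_right := h_hyp.gromovProd_le_of_lt h_ends (c := (u * v) • x) (by linarith)
  rw [gromovProd_comm] at h_right ⊢
  linarith [h_hyp.gromovProd_le_of_lt h_right (c := (u * v)⁻¹ • x) (by linarith)]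

lemma HasDeepMatch.isLoxodromic (h_hyp : FourPointHyperbolic X δ) {c : ℝ} {f w : G}
    (h : HasDeepMatch x δ c K₁ f w) : IsLoxodromic X w := by
  obtain ⟨r, -, h_trans, h_long, -⟩ := h
  have hδ := h_hyp.nonneg x
  have hr : 0 ≤ r := (gromovProd_nonneg _ _ _).trans h_trans
  refine isLoxodromic_of_mul_le_dist (x := x) (c := dist x (w • x) - 2 * r - 2 * δ)
    (by linarith) (mul_le_dist_pow_smul h_hyp hr (by linarith) h_trans le_rfl)

lemma HasDeepMatch.encard_jointStab_le (h_hyp : FourPointHyperbolic X δ) {c K : ℝ} {f w : G}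
    (h : HasDeepMatch x δ c K₁ f w) : (jointStab G K x (w • x)).encard ≤
      (jointStab G (7 * K + 2 * (c + 2 * δ) + 2 * δ) x (f • x)).encard := by
  obtain ⟨_, _, _, _, h_start, h_end⟩ := h
  have hδ := h_hyp.nonneg x
  exact HypWalk.encard_jointStab_le h_hyp (h_start.1.trans (by linarith))
    (h_end.1.trans (by linarith))

lemma HasDeepMatch.encard_jointStab_closestPoint_le (h_hyp : FourPointHyperbolic X δ) {c K : ℝ}
    {f w : G} (h : HasDeepMatch x δ c K₁ f w) {α : Set X} {p : X} (hα : IsQuasiAxis K₁ w α)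
    (hp : IsClosestPoint x α p) : (jointStab G K p (w • p)).encard ≤
      (jointStab G (7 * K + 2 * (c + 2 * δ) + 2 * δ) x (f • x)).encard := by
  obtain ⟨r, u, h_trans, h_long, h_start, h_end⟩ := h
  have hr : 0 ≤ r := (gromovProd_nonneg _ _ _).trans h_trans
  have h_near := dist_closestPoint_le h_hyp hr h_trans h_long hα hp
  have h_deep (o : X) (ho : IsDeepPoint c (r + 8 * δ + 5 * K₁ + c) x (w • x) o) :
      gromovProd o p (w • p) ≤ c + 2 * δ :=
    h_hyp.gromovProd_le_of_near ho.1 h_near (by rwa [dist_smul]) (by linarith [ho.2.1])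
      (by linarith [ho.2.2])
  exact HypWalk.encard_jointStab_le h_hyp (h_deep _ h_start) (h_deep _ h_end)

lemma IsTypical.gromovProd_inv_smul_le (h_hyp : FourPointHyperbolic X δ)
    (h_const : HasDivergenceConst G x L κ e) (hκ : 0 ≤ κ) {a : ℕ} {l : List G}
    (hl : ∀ g ∈ l, dist x (g • x) ≤ L) (ha : a + a ≤ l.length) (hY : 0 ≤ Y)
    (h_large : 3 * Y + 2 * e + 2 * δ < κ * a) (h : IsTypical W κ A Y x a l) :
    gromovProd x (l.prod⁻¹ • x) (l.prod • x) ≤ Y + e + 2 * δ := by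
  rw [← prod_take_mul_prod_drop l a]
  exact h_hyp.gromovProd_inv_mul_smul_le (d := κ * a - Y)
    (h.diverges.le_dist_prod_take hκ le_rfl (by omega)) (by linarith [h.le_dist_drop a ha])
    (h_const Y _ _ (fun g hg => hl g (List.mem_of_mem_take hg)) h.diverges_take)
    (h_const Y _ _ (fun g hg => hl g (List.mem_of_mem_drop hg)) h.diverges_drop) (by linarith)

lemma IsTypical.isDeepPoint (hκ : 0 ≤ κ) {a i : ℕ} {l : List G} {c R : ℝ} (hY : 0 ≤ Y)
    (hR : R + Y < κ * a) (hi : a + i + a ≤ l.length) (h : IsTypical W κ A Y x a l)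
    (h_prod : gromovProd (((l.drop a).take i).prod • x) ((l.take a).prod⁻¹ • x)
      ((l.drop a).prod • x) ≤ c) :
    IsDeepPoint c R x (l.prod • x) ((l.take (a + i)).prod • x) := by
  refine ⟨?_, ?_, ?_⟩
  · rwa [List.take_add, List.prod_append, mul_smul, gromovProd_smul_base,
      ← prod_take_mul_prod_drop l a, mul_smul, inv_smul_smul]
  · rw [dist_comm]
    linarith [h.diverges.le_dist_prod_take hκ (show a ≤ a + i by omega) (by omega)]
  · rw [← prod_take_mul_prod_drop l (a + i), mul_smul, dist_smul]
    linarith [h.le_dist_drop (a + i) hi]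

lemma IsTypical.hasDeepMatch (h_hyp : FourPointHyperbolic X δ)
    (h_const : HasDivergenceConst G x L κ e) (hκ : 0 ≤ κ) (hW : IsMatchRule x δ C F m W)
    (hAC : A + e ≤ C) {a : ℕ} {l : List G} (hl : ∀ g ∈ l, dist x (g • x) ≤ L)
    (hm : m ≤ a) (ha : 4 * a ≤ l.length) (hY : 0 ≤ Y) (hK₁ : 0 ≤ K₁)
    (h_large : 3 * Y + (2 * e + 11 * δ + 5 * K₁ + C) < κ * a) (h : IsTypical W κ A Y x a l) :
    HasDeepMatch x δ (C + δ) K₁ F.prod l.prod := by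
  have hδ := h_hyp.nonneg x
  have he := h_const.nonneg
  have hC := hW.nonneg
  obtain ⟨k, k', hk, hk_le, h_prod, h_start, h_end⟩ :=
    h.matches_drop.exists_gromovProd_le h_hyp h_const hW hAC
      fun g hg => hl g (List.mem_of_mem_drop hg)
  have h_last := h.diverges.le_dist_prod_take hκ (show a ≤ l.length by omega) le_rfl
  rw [List.take_length] at h_last
  refine ⟨Y + e + 2 * δ, (l.take (a + k)).prod,
    h.gromovProd_inv_smul_le h_hyp h_const hκ hl (by omega) hY (by linarith), by linarith,
    h.isDeepPoint hκ hY (by linarith) (by omega) h_start, ?_⟩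
  have h_translate : (l.take (a + k)).prod • F.prod • x = (l.take (a + k')).prod • x := by
    simp only [List.take_add, List.prod_append, h_prod, mul_smul]
  rw [h_translate]
  exact h.isDeepPoint hκ hY (by linarith) (by omega) h_end

end DeepMatches

section TypicalWalks

open scoped ENNReal

variable {G : Type*} {μ : PMF G}

lemma wordExp_comm (m n : ℕ) (F : List G → List G → ℝ≥0∞) :
    wordExp μ m (fun u => wordExp μ n fun v => F u v) =
      wordExp μ n fun v => wordExp μ m fun u => F u v := by
  induction m generalizing F with
  | zero => rfl
  | succ m ih => simp only [wordExp, ih, wordExp_tsum, wordExp_const_mul]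

lemma wordProb_take_drop_le_left {a n : ℕ} (ha : a ≤ n) {R : List G → List G → Prop} {c : ℝ≥0∞}
    (h : ∀ u, wordProb μ (n - a) {v | R u v} ≤ c) :
    wordProb μ n {l | R (l.take a) (l.drop a)} ≤ c := by
  obtain ⟨k, rfl⟩ := Nat.exists_eq_add_of_le ha
  rw [Nat.add_sub_cancel_left] at h
  calc wordProb μ (a + k) {l | R (l.take a) (l.drop a)}
      ≤ wordProb μ (a + k) {l | l.take a ∈ Set.univ ∧ l.drop a ∈ {v | R (l.take a) v}} :=
        wordProb_mono fun l _ _ hl => ⟨trivial, hl⟩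
    _ ≤ wordProb μ a Set.univ * c := wordProb_take_mem_drop_mem_le (T := fun u => {v | R u v}) h
    _ ≤ c := mul_le_of_le_one_left zero_le (wordProb_le_one _ _)

lemma wordProb_take_drop_le_right {a n : ℕ} (ha : a ≤ n) {R : List G → List G → Prop} {c : ℝ≥0∞}
    (h : ∀ v, wordProb μ a {u | R u v} ≤ c) :
    wordProb μ n {l | R (l.take a) (l.drop a)} ≤ c := by
  classical
  obtain ⟨k, rfl⟩ := Nat.exists_eq_add_of_le ha
  calc wordProb μ (a + k) {l | R (l.take a) (l.drop a)}
      = wordExp μ a fun u => wordExp μ k fun v => {u | R u v}.indicator 1 u := by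
        rw [wordProb, wordExp_append]
        refine wordExp_congr fun u hu => wordExp_congr fun v _ => ?_
        simp [Set.indicator_apply, ← hu]
    _ = wordExp μ k fun v => wordProb μ a {u | R u v} := wordExp_comm _ _ _
    _ ≤ wordExp μ k fun _ => c := wordExp_mono fun v _ _ => h v
    _ = c := wordExp_const k c

lemma wordProb_not_and_le {n : ℕ} {P Q : List G → Prop} {a b : ℝ} (ha : 0 ≤ a) (hb : 0 ≤ b)
    (hP : wordProb μ n {l | ¬ P l} ≤ ENNReal.ofReal a)
    (hQ : wordProb μ n {l | ¬ Q l} ≤ ENNReal.ofReal b) :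
    wordProb μ n {l | ¬ (P l ∧ Q l)} ≤ ENNReal.ofReal (a + b) := by
  rw [ENNReal.ofReal_add ha hb]
  refine (wordProb_mono fun l _ _ hl => ?_).trans
    ((wordProb_union_le n {l | ¬ P l} {l | ¬ Q l}).trans (add_le_add hP hQ))
  exact not_and_or.1 hl

variable [Group G] {X : Type*} [MetricSpace X] [MulAction G X] {x : X} {κ t A B D L q ρ : ℝ}
  {W : X → List G}

lemma LinearDrift.wordProb_short_suffix_le (h_drift : LinearDrift μ x κ t B q) (n a : ℕ) :
    wordProb μ n {l | ¬ ∀ i, i + a ≤ l.length → κ * a ≤ dist x ((l.drop i).prod • x)} ≤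
      ENNReal.ofReal (B / (1 - q) * q ^ a) := by
  have hκ := h_drift.speed_pos
  have hB := h_drift.const_pos
  have hq := h_drift.base_pos
  calc _ ≤ wordProb μ n (⋃ k ∈ Finset.Ico a (n + 1), {l | l.drop (n - k) ∈
          {l | dist x (l.prod • x) < dist x x + κ * k - 0}}) := by
        refine wordProb_mono fun l hl _ h_short => ?_
        simp only [Set.mem_ofPred_eq, not_forall, not_le] at h_short
        obtain ⟨i, hi, h_lt⟩ := h_short
        simp only [Set.mem_iUnion]
        refine ⟨n - i, Finset.mem_Ico.2 ⟨by omega, by omega⟩, ?_⟩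
        have ha : (a : ℝ) ≤ (n - i : ℕ) := by exact_mod_cast (by omega : a ≤ n - i)
        simp only [Set.mem_ofPred_eq, dist_self, zero_add, sub_zero]
        rw [show n - (n - i) = i by omega]
        exact h_lt.trans_le (mul_le_mul_of_nonneg_left ha hκ.le)
    _ ≤ ∑ k ∈ Finset.Ico a (n + 1), ENNReal.ofReal (B * q ^ k) := by
        refine (wordProb_biUnion_le _ _ _).trans (Finset.sum_le_sum fun k hk => ?_)
        have hk_le := (Finset.mem_Ico.1 hk).2
        rw [wordProb_drop (by omega), show n - (n - k) = k by omega]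
        simpa using h_drift.bound k x 0
    _ ≤ _ := by
        rw [← ENNReal.ofReal_sum_of_nonneg (fun i _ => by positivity), ← Finset.mul_sum,
          div_mul_eq_mul_div, mul_div_assoc]
        exact ENNReal.ofReal_le_ofReal (mul_le_mul_of_nonneg_left
          (geom_sum_Ico_le_of_lt_one hq.le h_drift.base_lt_one) hB.le)

variable [IsIsometricSMul G X]

lemma LinearDrift.wordProb_not_isTypical_le (h_drift : LinearDrift μ x κ t B q) (hL : 0 ≤ L)
    (hμ : ∀ g ∈ μ.support, dist x (g • x) ≤ L) (hD : 0 ≤ D) (hρ : 0 ≤ ρ)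
    (hρ_le : ρ ≤ 1) (h_matches : ∀ (n j : ℕ) (y : X), j ≤ n →
      wordProb μ n {l | ¬ Matches W κ A x j y l} ≤ ENNReal.ofReal (D * ρ ^ j))
    {a j n : ℕ} (hj : j ≤ a) (ha : a + a ≤ n) :
    wordProb μ n {l | ¬ IsTypical W κ A ((L + κ) * j) x a l} ≤
      ENNReal.ofReal ((D + 4 * (B / (1 - q))) * max ρ q ^ j) := by
  have hq := h_drift.base_pos
  have hq_lt := h_drift.base_lt_one
  set b := B / (1 - q)
  have hb : 0 ≤ b := div_nonneg h_drift.const_pos.le (by linarith)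
  set Y := (L + κ) * j
  have h_diverges := h_drift.wordProb_not_diverges_le hL hμ
  have h_match : wordProb μ n {l | ¬ Matches W κ A x a ((l.take a).prod⁻¹ • x) (l.drop a)} ≤
      ENNReal.ofReal (D * ρ ^ a) :=
    wordProb_take_drop_le_left (R := fun u v => ¬ Matches W κ A x a (u.prod⁻¹ • x) v) (by omega)
      fun u => h_matches (n - a) a _ (by omega)
  have h_take : wordProb μ n {l | ¬ Diverges κ Y x ((l.drop a).prod⁻¹ • x) (l.take a)} ≤
      ENNReal.ofReal (b * q ^ j) :=
    wordProb_take_drop_le_right (R := fun u v => ¬ Diverges κ Y x (v.prod⁻¹ • x) u) (by omega)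
      fun v => h_diverges a j _
  have h_drop : wordProb μ n {l | ¬ Diverges κ Y x ((l.take a).prod⁻¹ • x) (l.drop a)} ≤
      ENNReal.ofReal (b * q ^ j) :=
    wordProb_take_drop_le_left (R := fun u v => ¬ Diverges κ Y x (u.prod⁻¹ • x) v) (by omega)
      fun u => h_diverges (n - a) j _
  have h_all := wordProb_not_and_le (by positivity) (by positivity) h_match
    (wordProb_not_and_le (by positivity) (by positivity) (h_diverges n j x)
      (wordProb_not_and_le (by positivity) (by positivity) h_take
        (wordProb_not_and_le (by positivity) (by positivity) h_drop
          (h_drift.wordProb_short_suffix_le n a))))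
  have h_pow_le {r : ℝ} (hr : 0 ≤ r) (hr_le : r ≤ max ρ q) : r ^ a ≤ max ρ q ^ j :=
    (pow_le_pow_left₀ hr hr_le a).trans
      (pow_le_pow_of_le_one (hr.trans hr_le) (max_le hρ_le hq_lt.le) hj)
  have hρ_pow := mul_le_mul_of_nonneg_left (h_pow_le hρ (le_max_left ρ q)) hD
  have hq_pow := mul_le_mul_of_nonneg_left (h_pow_le hq.le (le_max_right ρ q)) hb
  have hq_pow' := mul_le_mul_of_nonneg_left (pow_le_pow_left₀ hq.le (le_max_right ρ q) j) hb
  refine le_trans (wordProb_mono fun l _ _ hl => ?_)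
    (h_all.trans (ENNReal.ofReal_le_ofReal (by linarith)))
  exact fun h => hl ⟨h.1, h.2.1, h.2.2.1, h.2.2.2.1, h.2.2.2.2⟩

end TypicalWalks

section DeepMatchProbability

open scoped ENNReal

lemma exists_pos_forall_ofReal_le {ι : Type*} [Finite ι] [Nonempty ι] {f : ι → ℝ≥0∞}
    (hf : ∀ i, 0 < f i) : ∃ p : ℝ, 0 < p ∧ ∀ i, ENNReal.ofReal p ≤ f i := by
  obtain ⟨i, hi⟩ := Finite.exists_min f
  obtain ⟨p, hp, hp_lt⟩ := ENNReal.lt_iff_exists_nnreal_btwn.1 (hf i)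
  refine ⟨p, by exact_mod_cast hp, fun j => ?_⟩
  rw [ENNReal.ofReal_coe_nnreal]
  exact hp_lt.le.trans (hi j)

lemma exists_pow_bound_of_pow_div_bound {f : ℕ → ℝ≥0∞} (hf : ∀ n, f n ≤ 1) {B c : ℝ}
    (hB : 0 ≤ B) (hc : 0 < c) (hc_lt : c < 1) {M j₀ : ℕ} (hM : 0 < M)
    (h : ∀ n, j₀ ≤ n / M → f n ≤ ENNReal.ofReal (B * c ^ (n / M))) :
    ∃ B' θ : ℝ, 0 < B' ∧ 0 < θ ∧ θ < 1 ∧ ∀ n, f n ≤ ENNReal.ofReal (B' * θ ^ n) := by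
  set θ := c ^ ((M : ℝ)⁻¹)
  have hθ : 0 < θ := Real.rpow_pos_of_pos hc _
  have hθ_lt : θ < 1 := Real.rpow_lt_one hc.le hc_lt (by positivity)
  have hθ_pow : θ ^ M = c := Real.rpow_inv_natCast_pow hc.le hM.ne'
  set B₀ := B + (c ^ j₀)⁻¹
  have hB₀ : 0 < B₀ := by positivity
  have h_pow_div (n : ℕ) : f n ≤ ENNReal.ofReal (B₀ * c ^ (n / M)) := by
    rcases le_or_gt j₀ (n / M) with hn | hn
    · refine (h n hn).trans (ENNReal.ofReal_le_ofReal ?_)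
      exact mul_le_mul_of_nonneg_right (le_add_of_nonneg_right (by positivity)) (by positivity)
    · refine (hf n).trans (ENNReal.one_le_ofReal.2 ?_)
      calc (1 : ℝ) = (c ^ j₀)⁻¹ * c ^ j₀ := (inv_mul_cancel₀ (by positivity)).symm
        _ ≤ B₀ * c ^ (n / M) := mul_le_mul (le_add_of_nonneg_left hB)
            (pow_le_pow_of_le_one hc.le hc_lt.le hn.le) (by positivity) hB₀.le
  refine ⟨B₀ * c⁻¹, θ, by positivity, hθ, hθ_lt, fun n => (h_pow_div n).trans ?_⟩
  have h_root := pow_div_le_inv_mul_pow hθ hθ_lt.le hM n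
  rw [hθ_pow] at h_root
  rw [mul_assoc]
  exact ENNReal.ofReal_le_ofReal (mul_le_mul_of_nonneg_left h_root hB₀.le)

lemma pow_le_rpow_sqrt {c : ℝ} (hc : 0 < c) (hc_le : c ≤ 1) (n : ℕ) :
    c ^ n ≤ c ^ Real.sqrt n := by
  rw [← Real.rpow_natCast]
  refine Real.rpow_le_rpow_of_exponent_ge hc hc_le ?_
  rw [Real.sqrt_le_left (by positivity)]
  exact_mod_cast Nat.le_self_pow two_ne_zero n

variable {G : Type*} [Group G] {X : Type*} [MetricSpace X] [MulAction G X] {μ : PMF G}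
  {δ κ t A B C E L K K₁ e p q : ℝ} {x : X} {m : ℕ} {F : List G} {W : X → List G}

lemma IsSchottky.exists_gromovProd_le (h_hyp : FourPointHyperbolic X δ) {s : Fin 8 → G}
    (h : IsSchottky x δ C E s) (y z : X) :
    ∃ i, gromovProd x y (s i • x) ≤ C + δ ∧ gromovProd x ((s i)⁻¹ • x) z ≤ C + δ := by
  by_contra! h_bad
  have h_card := h.card_not_le h_hyp y z
  rw [Finset.filter_true_of_mem fun i _ hi => absurd hi.2 (not_le.2 (h_bad i hi.1))] at h_card
  simp at h_card

lemma LinearDrift.exists_failure_le_half (h_drift : LinearDrift μ x κ t B q) :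
    ∃ A : ℝ, B * Real.exp (-(t * A)) / (1 - √q) ≤ 1 / 2 := by
  have h_exp := (Real.tendsto_exp_neg_atTop_nhds_zero.comp
    (tendsto_id.const_mul_atTop h_drift.rate_pos)).const_mul B |>.div_const (1 - √q)
  rw [mul_zero, zero_div] at h_exp
  obtain ⟨A, hA⟩ := (h_exp.eventually (gt_mem_nhds (show (0 : ℝ) < 1 / 2 by norm_num))).exists
  exact ⟨A, hA.le⟩

variable [IsIsometricSMul G X]

lemma IsNonElementary.exists_isMatchRule (h_hyp : FourPointHyperbolic X δ)
    (h : IsNonElementary X μ) (x : X) : ∃ C₀ : ℝ, ∀ C ≥ C₀, ∀ F : List G,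
      (∀ g ∈ F, g ∈ μ.support) → 2 * C + 2 * δ < dist x (F.prod • x) →
      ∃ (m : ℕ) (W : X → List G) (p : ℝ), 0 < m ∧ 0 < p ∧ IsMatchRule x δ C F m W ∧
        ∀ z, ENNReal.ofReal p ≤ wordProb μ m {W z} := by
  obtain ⟨m, C, E, word, hm, h_length, h_supp, h_schottky⟩ := h.exists_isSchottky h_hyp x
  refine ⟨C + 2 * δ, fun C' hC' F hF h_long => ?_⟩
  choose idx h_start h_end using fun z => h_schottky.exists_gromovProd_le h_hyp z (F.prod • x)
  have h_length_append (i : Fin 8) : (word i ++ F).length = m + F.length := by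
    rw [List.length_append, h_length]
  have h_pos (i : Fin 8) : 0 < wordProb μ (m + F.length) {word i ++ F} := by
    rw [← h_length_append i]
    refine wordProb_singleton_pos fun g hg => ?_
    exact (List.mem_append.1 hg).elim (h_supp i g) (hF g)
  obtain ⟨p, hp, hp_le⟩ := exists_pos_forall_ofReal_le h_pos
  refine ⟨m + F.length, fun z => word (idx z) ++ F, p, by omega, hp, ?_, fun z => hp_le _⟩
  exact ⟨fun z => h_length_append _, fun z => ⟨word (idx z), rfl,
    (h_schottky.gromovProd_inv_smul_le h_hyp (h_start z) (h_end z)).trans hC'⟩, h_long⟩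

lemma IsWPDMeasure.exists_list (h_hyp : FourPointHyperbolic X δ) (h : IsWPDMeasure X μ) (x : X)
    (hK : 0 ≤ K) (R : ℝ) : ∃ F : List G, (∀ g ∈ F, g ∈ μ.support) ∧
      R < dist x (F.prod • x) ∧ (jointStab G K x (F.prod • x)).Finite := by
  obtain ⟨_, h_mem, h_wpd⟩ := h
  obtain ⟨l, -, hl, rfl⟩ := exists_list_prod_eq_of_mem_generatedSemigroup h_mem
  obtain ⟨M₀, h_fin⟩ := h_wpd.exists_finite_jointStab h_hyp x hK
  obtain ⟨M, h_long, hM⟩ := ((h_wpd.1.eventually_le_dist_pow_smul x (R + 1)).and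
    (eventually_ge_atTop M₀)).exists
  refine ⟨(List.replicate M l).flatten, fun g hg => hl g (mem_of_mem_flatten_replicate hg), ?_⟩
  rw [List.prod_flatten, List.map_replicate, List.prod_replicate]
  exact ⟨by linarith, h_fin M hM⟩

lemma LinearDrift.exists_wordProb_not_hasDeepMatch_le (h_drift : LinearDrift μ x κ t B q)
    (h_hyp : FourPointHyperbolic X δ) (hL : 0 ≤ L) (hμ : ∀ g ∈ μ.support, dist x (g • x) ≤ L)
    (h_const : HasDivergenceConst G x L κ e) (hm : 0 < m) (hW : IsMatchRule x δ C F m W)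
    (hAC : A + e ≤ C) (hp : 0 < p) (h_word : ∀ z, ENNReal.ofReal p ≤ wordProb μ m {W z})
    (hA : B * Real.exp (-(t * A)) / (1 - √q) ≤ 1 / 2) (hK₁ : 0 ≤ K₁) :
    ∃ B' θ : ℝ, 0 < B' ∧ 0 < θ ∧ θ < 1 ∧ ∀ n : ℕ,
      wordProb μ n {l | ¬ HasDeepMatch x δ (C + δ) K₁ F.prod l.prod} ≤
        ENNReal.ofReal (B' * θ ^ n) := by
  have hκ := h_drift.speed_pos
  obtain ⟨D, ρ, hD, hρ, hρ_lt, h_matches⟩ :=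
    h_drift.exists_wordProb_not_matches_le hm hW.length_eq hp h_word hA
  obtain ⟨N, hN⟩ := exists_nat_gt ((3 * (L + κ) + 1) / κ)
  rw [div_lt_iff₀ hκ] at hN
  have hN_pos : 0 < N := by
    by_contra! hN_le
    rw [Nat.le_zero.1 hN_le, Nat.cast_zero, zero_mul] at hN
    linarith
  obtain ⟨j₀, hj₀⟩ := exists_nat_gt (max (m : ℝ) (2 * e + 11 * δ + 5 * K₁ + C))
  rw [max_lt_iff, Nat.cast_lt] at hj₀
  refine exists_pow_bound_of_pow_div_bound (fun n => wordProb_le_one n _)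
    (B := D + 4 * (B / (1 - q))) (c := max ρ q) (M := 4 * N) (j₀ := j₀)
    (add_nonneg hD.le (mul_nonneg zero_le_four (div_nonneg h_drift.const_pos.le
      (sub_nonneg.2 h_drift.base_lt_one.le)))) (lt_max_of_lt_left hρ)
    (max_lt hρ_lt h_drift.base_lt_one) (by omega) fun n hn => ?_
  set j := n / (4 * N)
  have h_div : 4 * (N * j) ≤ n := by
    rw [← mul_assoc]
    exact Nat.mul_div_le n (4 * N)
  have hj_le : j ≤ N * j := Nat.le_mul_of_pos_left j hN_pos
  have hj_real : (j₀ : ℝ) ≤ j := by exact_mod_cast hn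
  refine le_trans (wordProb_mono fun l hl_length hl_supp hl => ?_)
    (h_drift.wordProb_not_isTypical_le hL hμ hD.le hρ.le hρ_lt.le h_matches hj_le (by omega))
  refine fun h_typical => hl (h_typical.hasDeepMatch h_hyp h_const hκ.le hW hAC
    (fun g hg => hμ g (hl_supp g hg)) (by omega) (by omega) (by positivity) hK₁ ?_)
  push_cast
  linarith [mul_le_mul_of_nonneg_right hN.le (Nat.cast_nonneg (α := ℝ) j)]

lemma exists_wordProb_not_hasDeepMatch_le (hX : IsGromovSpace X δ)
    (h_nonelem : IsNonElementary X μ) (h_bdd : HasBoundedSupport X μ) (h_wpd : IsWPDMeasure X μ)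
    (x : X) (hK : 0 ≤ K) (hK₁ : 0 ≤ K₁) :
    ∃ (f : G) (c B θ : ℝ), 0 < B ∧ 0 < θ ∧ θ < 1 ∧
      (jointStab G (7 * K + 2 * (c + 2 * δ) + 2 * δ) x (f • x)).Finite ∧ ∀ n : ℕ,
      wordProb μ n {l | ¬ HasDeepMatch x δ c K₁ f l.prod} ≤ ENNReal.ofReal (B * θ ^ n) := by
  have h_hyp := hX.fourPoint
  have hδ := h_hyp.nonneg x
  obtain ⟨L, hL, hμ⟩ := h_bdd.exists_dist_smul_le x
  obtain ⟨κ, t, B, q, h_drift⟩ := exists_linearDrift h_hyp h_nonelem x (by linarith) hμ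
  obtain ⟨A, hA⟩ := h_drift.exists_failure_le_half
  obtain ⟨e, h_const⟩ := hX.exists_hasDivergenceConst (G := G) (L := L) (by linarith)
    h_drift.speed_pos x
  obtain ⟨C₀, h_rule⟩ := h_nonelem.exists_isMatchRule h_hyp x
  obtain ⟨C, ⟨hC₀, hAC⟩, hC⟩ : ∃ C, (C₀ ≤ C ∧ A + e ≤ C) ∧ 0 ≤ C :=
    (((eventually_ge_atTop C₀).and (eventually_ge_atTop (A + e))).and
      (eventually_ge_atTop 0)).exists
  obtain ⟨F, hF, h_long, h_fin⟩ := h_wpd.exists_list h_hyp x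
    (K := 7 * K + 2 * (C + δ + 2 * δ) + 2 * δ) (by positivity) (2 * C + 2 * δ)
  obtain ⟨m, W, p, hm, hp, hW, h_word⟩ := h_rule C hC₀ F hF h_long
  obtain ⟨B', θ, hB', hθ, hθ_lt, h_bound⟩ := h_drift.exists_wordProb_not_hasDeepMatch_le h_hyp
    (by linarith) hμ h_const hm hW hAC hp h_word hA hK₁
  exact ⟨F.prod, C + δ, B', θ, hB', hθ, hθ_lt, h_fin, h_bound⟩

end DeepMatchProbability

end HypWalk

theorem mainTheorem9_general {G : Type*} [Group G] {X : Type*} [MetricSpace X] [MulAction G X]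
    [IsIsometricSMul G X] (hX : HypWalk.IsGromovHyperbolic X) (μ : PMF G)
    (hne : HypWalk.IsNonElementary X μ) (hbdd : HypWalk.HasBoundedSupport X μ)
    (hwpd : HypWalk.IsWPDMeasure X μ) (x : X) (K K₁ : ℝ) (hK : 0 ≤ K) (hK₁ : 0 ≤ K₁) :
    ∃ N : ℕ, 0 < N ∧ ∃ B c : ℝ, 0 < B ∧ 0 < c ∧ c < 1 ∧ ∀ n : ℕ,
      1 - B * c ^ n ≤
          HypWalk.walkProb μ n {w | (HypWalk.jointStab G K x (w • x)).encard ≤ N} ∧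
      1 - B * c ^ n ≤
          HypWalk.walkProb μ n {w | HypWalk.IsLoxodromic X w ∧
            ∀ (α : Set X) (p : X), HypWalk.IsQuasiAxis K₁ w α → HypWalk.IsClosestPoint x α p →
              (HypWalk.jointStab G K p (w • p)).encard ≤ N} := by
  obtain ⟨δ, hX⟩ := hX.exists_isGromovSpace
  have h_hyp := hX.fourPoint
  obtain ⟨f, c, B, θ, hB, hθ, hθ_lt, h_fin, h_bound⟩ :=
    HypWalk.exists_wordProb_not_hasDeepMatch_le hX hne hbdd hwpd x hK hK₁
  obtain ⟨N, hN⟩ := ENat.ne_top_iff_exists.1 h_fin.encard_lt_top.ne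
  have h_le_succ {S : Set G} (hS : S.encard ≤ N) : S.encard ≤ (N + 1 : ℕ) :=
    hS.trans (by exact_mod_cast N.le_succ)
  have h_deep {n : ℕ} {A : Set G} (hA : ∀ w, HypWalk.HasDeepMatch x δ c K₁ f w → w ∈ A) :
      1 - B * θ ^ n ≤ HypWalk.walkProb μ n A := by
    refine HypWalk.one_sub_le_walkProb (by positivity)
      (le_trans (HypWalk.wordProb_mono fun l _ _ hl => ?_) (h_bound n))
    exact fun h => hl (hA _ h)
  refine ⟨N + 1, N.succ_pos, B, θ, hB, hθ, hθ_lt, fun n => ⟨h_deep fun w hw => ?_,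
    h_deep fun w hw => ⟨hw.isLoxodromic h_hyp, fun α p hα hp => ?_⟩⟩⟩
  · exact h_le_succ (hN ▸ hw.encard_jointStab_le h_hyp)
  · exact h_le_succ (hN ▸ hw.encard_jointStab_closestPoint_le h_hyp hα hp)

theorem mainTheorem9 {G : Type*} [Group G] {X : Type*} [MetricSpace X] [MulAction G X]
    [IsIsometricSMul G X] (hX : HypWalk.IsGromovHyperbolic X) (μ : PMF G)
    (hne : HypWalk.IsNonElementary X μ) (hbdd : HypWalk.HasBoundedSupport X μ)
    (hwpd : HypWalk.IsWPDMeasure X μ) (x : X) (K K₁ : ℝ) (hK : 0 ≤ K) (hK₁ : 0 ≤ K₁) :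
    ∃ N : ℕ, 0 < N ∧ ∃ B c : ℝ, 0 < B ∧ 0 < c ∧ c < 1 ∧ ∀ n : ℕ,
      1 - B * c ^ Real.sqrt n ≤
          HypWalk.walkProb μ n {w | (HypWalk.jointStab G K x (w • x)).encard ≤ N} ∧
      1 - B * c ^ Real.sqrt n ≤
          HypWalk.walkProb μ n {w | HypWalk.IsLoxodromic X w ∧
            ∀ (α : Set X) (p : X), HypWalk.IsQuasiAxis K₁ w α → HypWalk.IsClosestPoint x α p →
              (HypWalk.jointStab G K p (w • p)).encard ≤ N} := by
  obtain ⟨N, hN, B, c, hB, hc, hc_lt, h⟩ :=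
    mainTheorem9_general hX μ hne hbdd hwpd x K K₁ hK hK₁
  have h_rate (n : ℕ) : 1 - B * c ^ Real.sqrt n ≤ 1 - B * c ^ n :=
    sub_le_sub_left (mul_le_mul_of_nonneg_left (HypWalk.pow_le_rpow_sqrt hc hc_lt.le n) hB.le) 1
  exact ⟨N, hN, B, c, hB, hc, hc_lt, fun n => (h n).imp (h_rate n).trans (h_rate n).trans⟩
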